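/- Let $C\le \mathbb{F}_2^{72}$ be an extremal self-dual binary linear code of length $72$; that is, $C=C^{\perp}$ with respect to the standard bilinear form $\sum_i x_iy_i$, and the minimum Hamming weight $d(C)$ of a nonzero codeword attains the upper bound $4\lfloor 72/24\rfloor+4=16$. Then the automorphism group $\mathrm{Aut}(C)=\{\sigma\in S_{72}\mid \sigma(C)=C\}$, where $S_{72}$ acts by permuting coordinates, contains no element of order $8$. -/

import Mathlib

/-- A binary linear code of length `n`: a linear subspace of `𝔽₂ⁿ`. -/
abbrev BinaryCode (n : ℕ) : Type := Submodule (ZMod 2) (Fin n → ZMod 2)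

namespace BinaryCode

variable {n : ℕ}

/-- The dual code with respect to the standard bilinear form `∑ i, x i * c i`. -/
def dual (C : BinaryCode n) : BinaryCode n where
  carrier := {x | ∀ c ∈ C, x ⬝ᵥ c = 0}
  zero_mem' := fun c _ => zero_dotProduct c
  add_mem' := fun hx hy c hc => by rw [add_dotProduct, hx c hc, hy c hc, add_zero]
  smul_mem' := fun a x hx c hc => by rw [smul_dotProduct, hx c hc, smul_zero]

/-- `C` is self-dual if it equals its dual code. -/
def IsSelfDual (C : BinaryCode n) : Prop := C = C.dual

/-- The minimum distance: the least Hamming weight of a nonzero codeword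
(with value `0` for the zero code). -/
noncomputable def minDist (C : BinaryCode n) : ℕ :=
  sInf {w | ∃ c ∈ C, c ≠ 0 ∧ hammingNorm c = w}

/-- The upper bound for the minimum distance of a binary self-dual code of length `n`. -/
def extremalBound (n : ℕ) : ℕ :=
  if n % 24 = 22 then 4 * (n / 24) + 6 else 4 * (n / 24) + 4

/-- An extremal code: a self-dual code whose minimum distance attains the bound. -/
structure IsExtremal (C : BinaryCode n) : Prop where
  isSelfDual : C.IsSelfDual
  minDist_eq : C.minDist = extremalBound n

/-- The coordinate permutation of `𝔽₂ⁿ` induced by `σ`, moving the entry in position `i`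
to position `σ i`; that is, `(σ c) i = c (σ⁻¹ i)`. -/
def permute (σ : Equiv.Perm (Fin n)) : (Fin n → ZMod 2) ≃ₗ[ZMod 2] (Fin n → ZMod 2) :=
  LinearEquiv.funCongrLeft (ZMod 2) (ZMod 2) σ.symm

/-- The automorphism group `{σ ∈ Sₙ | σ(C) = C}`. -/
def aut (C : BinaryCode n) : Subgroup (Equiv.Perm (Fin n)) where
  carrier := {σ | (permute σ) '' (C : Set (Fin n → ZMod 2)) = C}
  one_mem' := Set.image_id _
  mul_mem' := by
    intro σ τ hσ hτ
    have h : ⇑(permute (σ * τ)) = ⇑(permute σ) ∘ ⇑(permute τ) := rfl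
    rw [Set.mem_ofPred_eq] at hσ hτ ⊢
    rw [h, Set.image_comp, hτ, hσ]
  inv_mem' := by
    intro σ hσ
    have h : ⇑(permute σ⁻¹) = ⇑(permute σ).symm := rfl
    rw [Set.mem_ofPred_eq] at hσ ⊢
    rw [h]
    nth_rewrite 1 [← hσ]
    rw [← Set.image_comp]
    simp

end BinaryCode

/-!
Binary words are functions `ι → ZMod 2`, and all counting rests on Poisson summation for the
characters `chi`. A function on words has degree at most `r` (`DegLE`) if its Fourier transform is
supported on words of weight at most `r`; such a function has the same average over all words and
over the dual of a code whose nonzero words have weight larger than `r` (`sum_orth_of_degLE`). A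
polynomial in the weight has its usual degree, and prescribing a coordinate raises the degree by
one. Choosing polynomials that vanish at most of the possible weights, one first finds that an
extremal self-dual code `C` of length 72 is doubly even (`four_dvd_weight_of_extremal`), and one
counts its words of weight 16 with prescribed coordinates.

Let `σ` be an automorphism of order 8 and `τ = σ^4`, with `c` two-cycles and `72 - 2c` fixed points;
here `c` is a positive multiple of 4. The sums over the two-cycles of the words of `C` form a
self-orthogonal code `E` of length `c`. Its dual consists of the words whose doubles are words of
`C` vanishing on the fixed points, so it has even weights and minimum weight at least 8
(`DualWeightEight`). The averages of suitable polynomials, over `E` or over its shadow, show that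
`c` is 24, 32 or 36 (`ExtremalSeventyTwo.card_twoCycles`).

* If `c = 36`, then `E` is self-dual (`DualWeightEight.orth_eq_of_card_eq_thirtySix`). This says
  that the kernel of `τ - 1 = (σ - 1)^4` on `C` is its image, so all Jordan blocks of `σ` on `C`
  have size 8, whereas `C` has dimension 36 (`ExtremalSeventyTwo.card_twoCycles_ne_thirtySix`).
* If `c = 32`, there are five fixed points outside of which no `τ`-fixed word has a nonzero part.
  An odd number of words of weight 16 vanish there, while the `τ`-fixed ones among them correspond
  to the words of weight 8 of the dual of `E`. Their number is even
  (`DualWeightEight.even_card_weight_eight`), because a quadratic Gauss sum over that dual is zero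
  or, up to sign, a power of two (`ExtremalSeventyTwo.card_twoCycles_ne_thirtyTwo`).
* If `c = 24`, then both `E` and the code of restrictions of the `τ`-fixed words to the 24 fixed
  points have the weights of the extended Golay code. Every pair of two-cycles extends to a
  `τ`-fixed word of `C`, which meets the fixed points in 12 points. Hence these words form a
  Hadamard matrix of order 24 on which `σ` acts by signed permutations. By
  `exists_row_orbit_sum_eq_zero`, some orbit `S` of four fixed points indexes rows whose product
  sums to zero; in the only case where this could fail, averaging the columns over the cycles of
  `σ` would produce a ternary self-dual code of length 6. There are 442 words of weight 16
  containing `S`, of which exactly 54 are fixed by `τ`. But the words not fixed by `τ` lie in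
  orbits of length 8, and `442 - 54` is not divisible by 8
  (`TwentyFourCycles.false_of_pow_four_eq`).
-/

open Finset

/-! ### Binary words, weights and characters -/

section Words

/-- The sign `(-1)^a` of a bit. -/
def sgn (a : ZMod 2) : ℤ := if a = 0 then 1 else -1

lemma sgn_add : ∀ a b : ZMod 2, sgn (a + b) = sgn a * sgn b := by decide

@[simp] lemma sgn_zero : sgn 0 = 1 := by simp [sgn]

@[simp] lemma sgn_one : sgn 1 = -1 := by simp [sgn]

lemma zmod_two_cases : ∀ a : ZMod 2, a = 0 ∨ a = 1 := by decide

lemma sgn_mul_self : ∀ a : ZMod 2, sgn a * sgn a = 1 := by decide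

lemma sgn_eq_one_iff : ∀ a : ZMod 2, sgn a = 1 ↔ a = 0 := by decide

lemma sgn_eq_or : ∀ a : ZMod 2, sgn a = 1 ∨ sgn a = -1 := by decide

lemma sgn_natCast (n : ℕ) : sgn (n : ZMod 2) = (-1) ^ n := by
  induction n with
  | zero => simp
  | succ n ih => rw [Nat.cast_succ, sgn_add, ih, sgn_one, pow_succ]

lemma add_self_word {ι : Type*} (x : ι → ZMod 2) : x + x = 0 := by
  funext i
  exact CharTwo.add_self_eq_zero (x i)

lemma add_add_cancel_word {ι : Type*} (x y : ι → ZMod 2) : x + y + y = x := by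
  rw [add_assoc, add_self_word, add_zero]

lemma eq_of_add_eq_zero_word {ι : Type*} {x y : ι → ZMod 2} (h : x + y = 0) : x = y := by
  rw [← add_add_cancel_word x y, h, zero_add]

variable {ι : Type*} [Fintype ι]

/-- The character `x ↦ (-1)^(z·x)` of `𝔽₂^ι`. -/
def chi (z x : ι → ZMod 2) : ℤ := sgn (z ⬝ᵥ x)

lemma chi_add_left (z w x : ι → ZMod 2) : chi (z + w) x = chi z x * chi w x := by
  simp [chi, add_dotProduct, sgn_add]

lemma chi_zero_left (x : ι → ZMod 2) : chi 0 x = 1 := by simp [chi]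

lemma chi_comm (z x : ι → ZMod 2) : chi z x = chi x z := by simp [chi, dotProduct_comm]

lemma chi_eq_or (z x : ι → ZMod 2) : chi z x = 1 ∨ chi z x = -1 := sgn_eq_or _

lemma chi_eq_one_iff (z x : ι → ZMod 2) : chi z x = 1 ↔ z ⬝ᵥ x = 0 := sgn_eq_one_iff _

lemma hammingNorm_eq_sum (x : ι → ZMod 2) : hammingNorm x = ∑ i, (x i).val := by
  rw [hammingNorm, card_filter]
  refine sum_congr rfl fun i _ => ?_
  rcases zmod_two_cases (x i) with h | h <;> simp [h, ZMod.val_one]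

lemma sum_sgn (x : ι → ZMod 2) : ∑ i, sgn (x i) = Fintype.card ι - 2 * hammingNorm x := by
  have : ∀ i, sgn (x i) = 1 - 2 * ((x i).val : ℤ) := by
    intro i
    rcases zmod_two_cases (x i) with h | h <;> simp [h, ZMod.val_one]
  simp only [this, hammingNorm_eq_sum, sum_sub_distrib, ← mul_sum]
  simp

lemma natCast_hammingNorm (x : ι → ZMod 2) : (hammingNorm x : ZMod 2) = ∑ i, x i := by
  rw [hammingNorm_eq_sum]
  push_cast
  exact sum_congr rfl fun i _ => by simp

lemma dotProduct_self_word (x : ι → ZMod 2) : x ⬝ᵥ x = (hammingNorm x : ZMod 2) := by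
  rw [natCast_hammingNorm, dotProduct]
  refine sum_congr rfl fun i _ => ?_
  rcases zmod_two_cases (x i) with h | h <;> simp [h]

lemma dotProduct_one_word (x : ι → ZMod 2) : x ⬝ᵥ 1 = (hammingNorm x : ZMod 2) := by
  rw [natCast_hammingNorm, dotProduct_one]

/-- `|x + y| = |x| + |y| - 2 |x ∩ y|`. -/
lemma hammingNorm_add_add (x y : ι → ZMod 2) :
    hammingNorm (x + y) + 2 * hammingNorm (x * y) = hammingNorm x + hammingNorm y := by
  simp only [hammingNorm_eq_sum, mul_sum, ← sum_add_distrib]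
  refine sum_congr rfl fun i _ => ?_
  rcases zmod_two_cases (x i) with h | h <;> rcases zmod_two_cases (y i) with h' | h' <;>
    simp [h, h']
  decide

lemma dotProduct_eq_natCast (x y : ι → ZMod 2) : x ⬝ᵥ y = (hammingNorm (x * y) : ZMod 2) := by
  rw [natCast_hammingNorm]; rfl

lemma hammingNorm_add_le_add (x y : ι → ZMod 2) :
    hammingNorm (x + y) ≤ hammingNorm x + hammingNorm y := by
  have := hammingNorm_add_add x y
  omega

/-- Weights are additive modulo `4` on orthogonal words. -/
lemma hammingNorm_add_modEq {x y : ι → ZMod 2} (h : x ⬝ᵥ y = 0) :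
    hammingNorm (x + y) ≡ hammingNorm x + hammingNorm y [MOD 4] := by
  rw [dotProduct_eq_natCast, ZMod.natCast_eq_zero_iff] at h
  have := hammingNorm_add_add x y
  unfold Nat.ModEq
  omega

lemma hammingNorm_one_word : hammingNorm (1 : ι → ZMod 2) = Fintype.card ι := by
  simp [hammingNorm_eq_sum, ZMod.val_one]

lemma hammingNorm_add_one (x : ι → ZMod 2) :
    hammingNorm (x + 1) + hammingNorm x = Fintype.card ι := by
  have h := hammingNorm_add_add x 1
  rw [mul_one, hammingNorm_one_word] at h
  omega

end Words

/-! ### Sums of functions of the weight -/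

section Indicators

lemma sum_powerset_card {α : Type*} (S : Finset α) (h : ℕ → ℤ) :
    ∑ B ∈ S.powerset, h #B = ∑ b ∈ range (#S + 1), ((#S).choose b : ℤ) * h b := by
  rw [sum_powerset_apply_card]
  simp only [nsmul_eq_mul]

variable {ι : Type*} [Fintype ι] [DecidableEq ι]

/-- The word with support `S`. -/
def ind (S : Finset ι) : ι → ZMod 2 := fun i => if i ∈ S then 1 else 0

/-- Binary words correspond to finite sets of coordinates. -/
def indEquiv : Finset ι ≃ (ι → ZMod 2) where
  toFun := ind
  invFun x := univ.filter (x · ≠ 0)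
  left_inv S := by ext i; simp [ind]
  right_inv x := by
    funext i
    rcases zmod_two_cases (x i) with h | h <;> simp [ind, h]

lemma hammingNorm_ind (S : Finset ι) : hammingNorm (ind S) = #S := by
  simp [hammingNorm, ind]

lemma chi_ind (z : ι → ZMod 2) (S : Finset ι) :
    chi z (ind S) = (-1) ^ #(S.filter (z · ≠ 0)) := by
  have : z ⬝ᵥ ind S = (#(S.filter (z · ≠ 0)) : ZMod 2) := by
    rw [card_filter, dotProduct]
    simp only [ind, mul_ite, mul_one, mul_zero, sum_ite_mem, univ_inter]
    push_cast
    refine sum_congr rfl fun i _ => ?_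
    rcases zmod_two_cases (z i) with h | h <;> simp [h]
  rw [chi, this, sgn_natCast]

/-- A word is a choice of bits on `Z` and of bits off `Z`. -/
lemma sum_word_split {R : Type*} [AddCommMonoid R] (Z : Finset ι) (F : (ι → ZMod 2) → R) :
    ∑ x, F x = ∑ A ∈ Z.powerset, ∑ B ∈ Zᶜ.powerset, F (ind (A ∪ B)) := by
  rw [← Equiv.sum_comp indEquiv, ← sum_product']
  symm
  refine sum_bij' (fun p _ => p.1 ∪ p.2) (fun S _ => (S ∩ Z, S ∩ Zᶜ)) ?_ ?_ ?_ ?_ ?_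
  · simp
  · simp
  · rintro ⟨A, B⟩ h
    simp only [mem_product, mem_powerset] at h
    have hA := h.1
    have hB := h.2
    ext i <;> simp only [mem_inter, mem_union, mem_compl] <;>
      [have := @hA i; have := @hB i] <;> have h2 := @hB i <;> simp only [mem_compl] at * <;> tauto
  · intro S _
    ext i
    simp only [mem_union, mem_inter, mem_compl]
    tauto
  · intro p _
    rfl

/-- The sum of `(-1)^(|x ∩ Z|) g(|x|)` over all words `x` of length `n`, where `|Z| = w`. -/
def hatSum (n w : ℕ) (g : ℤ → ℤ) : ℤ :=
  ∑ a ∈ range (w + 1), (w.choose a : ℤ) * ∑ b ∈ range (n - w + 1),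
    ((n - w).choose b : ℤ) * ((-1) ^ a * g ((a + b : ℕ) : ℤ))

lemma sum_chi_mul_weight (z : ι → ZMod 2) (g : ℤ → ℤ) :
    ∑ x, g (hammingNorm x) * chi z x = hatSum (Fintype.card ι) (hammingNorm z) g := by
  set Z : Finset ι := univ.filter (z · ≠ 0) with hZ
  have hc : #Z = hammingNorm z := rfl
  have hcc : #Zᶜ = Fintype.card ι - hammingNorm z := by rw [card_compl, hc]
  rw [sum_word_split Z]
  have key : ∀ A ∈ Z.powerset, ∑ B ∈ Zᶜ.powerset,
      g (hammingNorm (ind (A ∪ B))) * chi z (ind (A ∪ B))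
      = ∑ b ∈ range (Fintype.card ι - hammingNorm z + 1),
        ((Fintype.card ι - hammingNorm z).choose b : ℤ) * ((-1) ^ #A * g ((#A + b : ℕ) : ℤ)) := by
    intro A hA
    rw [mem_powerset] at hA
    have h1 : ∀ B ∈ Zᶜ.powerset, g (hammingNorm (ind (A ∪ B))) * chi z (ind (A ∪ B))
        = (fun b : ℕ => (-1) ^ #A * g ((#A + b : ℕ) : ℤ)) #B := by
      intro B hB
      rw [mem_powerset] at hB
      have hd : Disjoint A B := by
        rw [Finset.disjoint_left]
        intro i hi hi'
        exact (mem_compl.1 (hB hi')) (hA hi)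
      have hf : (A ∪ B).filter (z · ≠ 0) = A := by
        ext i
        simp only [mem_filter, mem_union]
        constructor
        · rintro ⟨h | h, h'⟩
          · exact h
          · exact absurd (by simp [hZ, h'] : i ∈ Z) (mem_compl.1 (hB h))
        · intro h
          exact ⟨Or.inl h, (mem_filter.1 (hA h)).2⟩
      rw [hammingNorm_ind, chi_ind, hf, card_union_of_disjoint hd]
      ring
    refine (sum_congr rfl h1).trans
      ((sum_powerset_card Zᶜ fun b => (-1) ^ #A * g ((#A + b : ℕ) : ℤ)).trans ?_)
    rw [hcc]
  rw [sum_congr rfl key]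
  rw [sum_powerset_card Z (fun a => ∑ b ∈ range (Fintype.card ι - hammingNorm z + 1),
    ((Fintype.card ι - hammingNorm z).choose b : ℤ) * ((-1) ^ a * g ((a + b : ℕ) : ℤ))), hc]
  rfl

/-- The sum of `g(|x|)` over the words equal to `e` on a set of `t` of the `n` coordinates. -/
def restrSum (n t : ℕ) (e : ℕ) (g : ℤ → ℤ) : ℤ :=
  ∑ b ∈ range (n - t + 1), ((n - t).choose b : ℤ) * g ((e * t + b : ℕ) : ℤ)

lemma sum_eq_one_on (T : Finset ι) (g : ℤ → ℤ) :
    ∑ x : ι → ZMod 2, (if ∀ i ∈ T, x i = 1 then g (hammingNorm x) else 0)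
      = restrSum (Fintype.card ι) #T 1 g := by
  rw [sum_word_split T, sum_eq_single T]
  · have h1 : ∀ B ∈ Tᶜ.powerset, (if ∀ i ∈ T, ind (T ∪ B) i = 1 then
        g (hammingNorm (ind (T ∪ B))) else 0) = (fun b : ℕ => g ((1 * #T + b : ℕ) : ℤ)) #B := by
      intro B hB
      rw [mem_powerset] at hB
      have hd : Disjoint T B := by
        rw [Finset.disjoint_left]
        intro i hi hi'
        exact (mem_compl.1 (hB hi')) hi
      rw [if_pos (fun i hi => by simp [ind, hi]), hammingNorm_ind, card_union_of_disjoint hd,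
        one_mul]
    refine (sum_congr rfl h1).trans
      ((sum_powerset_card Tᶜ fun b => g ((1 * #T + b : ℕ) : ℤ)).trans ?_)
    rw [card_compl]
    rfl
  · intro A hA hne
    rw [mem_powerset] at hA
    refine sum_eq_zero fun B hB => if_neg fun h => hne (subset_antisymm hA fun i hi => ?_)
    rw [mem_powerset] at hB
    have := h i hi
    simp only [ind, mem_union] at this
    by_contra hiA
    rw [if_neg] at this
    · simp at this
    · rintro (h | h)
      · exact hiA h
      · exact mem_compl.1 (hB h) hi
  · intro h
    exact absurd (mem_powerset_self T) h

lemma sum_eq_zero_on (T : Finset ι) (g : ℤ → ℤ) :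
    ∑ x : ι → ZMod 2, (if ∀ i ∈ T, x i = 0 then g (hammingNorm x) else 0)
      = restrSum (Fintype.card ι) #T 0 g := by
  rw [sum_word_split T, sum_eq_single ∅]
  · have h1 : ∀ B ∈ Tᶜ.powerset, (if ∀ i ∈ T, ind (∅ ∪ B) i = 0 then
        g (hammingNorm (ind (∅ ∪ B))) else 0) = (fun b : ℕ => g ((0 * #T + b : ℕ) : ℤ)) #B := by
      intro B hB
      rw [mem_powerset] at hB
      rw [if_pos (fun i hi => ?_), hammingNorm_ind, empty_union]
      · simp only [zero_mul, zero_add]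
      rw [empty_union, ind, if_neg]
      exact fun h => mem_compl.1 (hB h) hi
    refine (sum_congr rfl h1).trans
      ((sum_powerset_card Tᶜ fun b => g ((0 * #T + b : ℕ) : ℤ)).trans ?_)
    rw [card_compl]
    rfl
  · intro A hA hne
    rw [mem_powerset] at hA
    refine sum_eq_zero fun B hB => if_neg fun h => hne ?_
    rw [eq_empty_iff_forall_notMem]
    intro i hi
    have := h i (hA hi)
    simp [ind, hi] at this
  · intro h
    exact absurd (empty_mem_powerset T) h

end Indicators

/-! ### Dual codes and Poisson summation -/

section Duality

open scoped Classical

variable {ι : Type*} [Fintype ι]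

/-- The dual of a binary code on an arbitrary finite set of coordinates. -/
def orth (E : Submodule (ZMod 2) (ι → ZMod 2)) : Submodule (ZMod 2) (ι → ZMod 2) where
  carrier := {x | ∀ c ∈ E, x ⬝ᵥ c = 0}
  zero_mem' := fun c _ => zero_dotProduct c
  add_mem' := fun hx hy c hc => by rw [add_dotProduct, hx c hc, hy c hc, add_zero]
  smul_mem' := fun a x hx c hc => by rw [smul_dotProduct, hx c hc, smul_zero]

lemma mem_orth {E : Submodule (ZMod 2) (ι → ZMod 2)} {x : ι → ZMod 2} :
    x ∈ orth E ↔ ∀ c ∈ E, x ⬝ᵥ c = 0 := Iff.rfl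

lemma le_orth_orth (E : Submodule (ZMod 2) (ι → ZMod 2)) : E ≤ orth (orth E) :=
  fun x hx c hc => by rw [dotProduct_comm]; exact hc x hx

lemma one_mem_of_orth_eq {C : Submodule (ZMod 2) (ι → ZMod 2)} (hC : orth C = C) :
    (1 : ι → ZMod 2) ∈ C := by
  rw [← hC]
  intro c hc
  have := (hC.symm ▸ hc : c ∈ orth C) c hc
  rwa [dotProduct_comm, dotProduct_one_word, ← dotProduct_self_word]

/-- A sum over a code is invariant under translation by a codeword. -/
lemma sum_code_add {R : Type*} [AddCommMonoid R] [DecidableEq ι]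
    (E : Submodule (ZMod 2) (ι → ZMod 2))
    {e : ι → ZMod 2} (he : e ∈ E) (f : (ι → ZMod 2) → R) :
    ∑ x with x ∈ E, f (x + e) = ∑ x with x ∈ E, f x := by
  refine sum_bij' (fun x _ => x + e) (fun x _ => x + e) ?_ ?_ ?_ ?_ ?_
  · intro x hx
    simp only [mem_filter, mem_univ, true_and] at hx ⊢
    exact E.add_mem hx he
  · intro x hx
    simp only [mem_filter, mem_univ, true_and] at hx ⊢
    exact E.add_mem hx he
  · intro x _; exact add_add_cancel_word x e
  · intro x _; exact add_add_cancel_word x e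
  · intro x _; rfl

/-- The number of codewords. -/
noncomputable def codeCard [DecidableEq ι] (E : Submodule (ZMod 2) (ι → ZMod 2)) : ℕ :=
  #(univ.filter (· ∈ E))

lemma natCard_eq_codeCard [DecidableEq ι] (E : Submodule (ZMod 2) (ι → ZMod 2)) :
    Nat.card E = codeCard E := by
  rw [codeCard, Nat.card_eq_fintype_card, Fintype.card_subtype]

lemma codeCard_eq_two_pow [DecidableEq ι] (E : Submodule (ZMod 2) (ι → ZMod 2)) :
    codeCard E = 2 ^ Module.finrank (ZMod 2) E := by
  rw [← natCard_eq_codeCard, Module.natCard_eq_pow_finrank (K := ZMod 2)]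
  simp

lemma codeCard_mono [DecidableEq ι] {E K : Submodule (ZMod 2) (ι → ZMod 2)} (h : E ≤ K) :
    codeCard E ≤ codeCard K :=
  card_le_card fun x hx => by
    simp only [mem_filter, mem_univ, true_and] at hx ⊢
    exact h hx

lemma eq_of_codeCard_le [DecidableEq ι] {E K : Submodule (ZMod 2) (ι → ZMod 2)} (h : E ≤ K)
    (hc : codeCard K ≤ codeCard E) : E = K := by
  have h1 : univ.filter (· ∈ E) = univ.filter (· ∈ K) :=
    eq_of_subset_of_card_le (fun x hx => by
      simp only [mem_filter, mem_univ, true_and] at hx ⊢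
      exact h hx) hc
  ext x
  have := Finset.ext_iff.1 h1 x
  simpa using this

variable [DecidableEq ι]

lemma codeCard_pos (E : Submodule (ZMod 2) (ι → ZMod 2)) : 0 < codeCard E :=
  card_pos.2 ⟨0, by simp⟩

/-- Orthogonality relations for the characters of a code. -/
lemma sum_chi_code (E : Submodule (ZMod 2) (ι → ZMod 2)) (x : ι → ZMod 2) :
    ∑ z with z ∈ E, chi z x = if x ∈ orth E then (codeCard E : ℤ) else 0 := by
  split_ifs with h
  · rw [codeCard, card_eq_sum_ones, Nat.cast_sum]
    refine sum_congr rfl fun z hz => ?_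
    simp only [mem_filter, mem_univ, true_and] at hz
    have : chi z x = 1 := by
      rw [chi_comm, chi_eq_one_iff]
      exact h z hz
    simp [this]
  · rw [mem_orth] at h
    push Not at h
    obtain ⟨e, he, hne⟩ := h
    have h1 := sum_code_add E he (fun z => chi z x)
    have h2 : chi e x = -1 := by
      rcases chi_eq_or e x with h | h
      · rw [chi_comm, chi_eq_one_iff] at h
        exact absurd h hne
      · exact h
    simp only [chi_add_left, h2, mul_neg, mul_one, sum_neg_distrib] at h1
    omega

/-- The (unnormalised) Fourier transform of `f` on `𝔽₂^ι`. -/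
def hat {R : Type*} [CommRing R] (f : (ι → ZMod 2) → R) (z : ι → ZMod 2) : R :=
  ∑ x, f x * (chi z x : R)

/-- Poisson summation. -/
lemma poisson {R : Type*} [CommRing R] (E : Submodule (ZMod 2) (ι → ZMod 2))
    (f : (ι → ZMod 2) → R) (s : ι → ZMod 2) :
    ∑ z with z ∈ E, hat f (z + s) =
      codeCard E * ∑ x with x ∈ orth E, f x * (chi s x : R) := by
  simp only [hat]
  rw [sum_comm]
  have h1 : ∀ x, ∑ z with z ∈ E, f x * (chi (z + s) x : R)
      = if x ∈ orth E then (codeCard E : R) * (f x * (chi s x : R)) else 0 := by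
    intro x
    have h2 : ∑ z with z ∈ E, f x * (chi (z + s) x : R)
        = ((∑ z with z ∈ E, chi z x : ℤ) : R) * (f x * (chi s x : R)) := by
      rw [Int.cast_sum, sum_mul]
      refine sum_congr rfl fun z _ => ?_
      rw [chi_add_left]
      push_cast
      ring
    rw [h2, sum_chi_code]
    split_ifs <;> simp
  simp only [h1]
  rw [mul_sum, sum_filter]

/-- `f` has degree at most `r`: its Fourier transform is supported on words of weight `≤ r`. -/
def DegLE (f : (ι → ZMod 2) → ℤ) (r : ℕ) : Prop := ∀ z, r < hammingNorm z → hat f z = 0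

lemma hat_zero_right (f : (ι → ZMod 2) → ℤ) : hat f 0 = ∑ x, f x := by
  simp [hat, chi_zero_left]

lemma sum_chi_univ {z : ι → ZMod 2} (hz : z ≠ 0) : ∑ x, chi z x = 0 := by
  have h := sum_chi_code (⊤ : Submodule (ZMod 2) (ι → ZMod 2)) z
  simp only [Submodule.mem_top, filter_true] at h
  simp only [chi_comm z]
  rw [h, if_neg]
  intro hz'
  apply hz
  funext i
  have := hz' (Pi.single i 1) trivial
  simpa using this

lemma DegLE.const (a : ℤ) (r : ℕ) : DegLE (fun _ : ι → ZMod 2 => a) r := by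
  intro z hz
  have hz' : z ≠ 0 := by
    rintro rfl
    simp at hz
  simp only [hat, Int.cast_id]
  rw [← mul_sum, sum_chi_univ hz', mul_zero]

lemma DegLE.mono {f : (ι → ZMod 2) → ℤ} {r s : ℕ} (h : DegLE f r) (hrs : r ≤ s) : DegLE f s :=
  fun z hz => h z (hrs.trans_lt hz)

lemma DegLE.add {f g : (ι → ZMod 2) → ℤ} {r : ℕ} (hf : DegLE f r) (hg : DegLE g r) :
    DegLE (fun x => f x + g x) r := by
  intro z hz
  have h1 := hf z hz
  have h2 := hg z hz
  simp only [hat, add_mul, sum_add_distrib] at *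
  rw [h1, h2, add_zero]

lemma DegLE.const_mul {f : (ι → ZMod 2) → ℤ} {r : ℕ} (hf : DegLE f r) (a : ℤ) :
    DegLE (fun x => a * f x) r := by
  intro z hz
  have h1 := hf z hz
  simp only [hat, mul_assoc, ← mul_sum] at *
  rw [h1, mul_zero]

lemma DegLE.sum {α : Type*} (s : Finset α) {f : α → (ι → ZMod 2) → ℤ} {r : ℕ}
    (hf : ∀ a ∈ s, DegLE (f a) r) : DegLE (fun x => ∑ a ∈ s, f a x) r := by
  intro z hz
  simp only [hat, sum_mul]
  rw [sum_comm]
  exact sum_eq_zero fun a ha => hf a ha z hz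

/-- Multiplication by the sign of one coordinate translates the Fourier transform. -/
lemma DegLE.sgn_mul {f : (ι → ZMod 2) → ℤ} {r : ℕ} (hf : DegLE f r) (i : ι) :
    DegLE (fun x => sgn (x i) * f x) (r + 1) := by
  intro z hz
  have h1 : hat (fun x => sgn (x i) * f x) z = hat f (z + Pi.single i 1) := by
    simp only [hat]
    refine sum_congr rfl fun x _ => ?_
    have : chi (Pi.single i 1) x = sgn (x i) := by simp [chi]
    rw [chi_add_left, this]
    push_cast
    ring
  rw [h1]
  apply hf
  have h2 : hammingNorm (Pi.single i (1 : ZMod 2) : ι → ZMod 2) = 1 := by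
    rw [hammingNorm, card_eq_one]
    exact ⟨i, by ext j; by_cases h : j = i <;> simp [h, Pi.single_apply]⟩
  have h3 := hammingNorm_add_le_add (z + Pi.single i 1) (Pi.single i 1)
  rw [add_add_cancel_word] at h3
  omega

lemma DegLE.of_two_mul {f : (ι → ZMod 2) → ℤ} {r : ℕ} (hf : DegLE (fun x => 2 * f x) r) :
    DegLE f r := by
  intro z hz
  have h := hf z hz
  simp only [hat, mul_assoc, ← mul_sum] at h ⊢
  omega

/-- Multiplying by a linear polynomial in the weight raises the degree by at most one, the weight
being a sum of functions of a single coordinate. -/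
lemma DegLE.weight_sub_mul {f : (ι → ZMod 2) → ℤ} {r : ℕ} (hf : DegLE f r) (a : ℤ) :
    DegLE (fun x => ((hammingNorm x : ℤ) - a) * f x) (r + 1) := by
  apply DegLE.of_two_mul
  have h1 := ((hf.mono (Nat.le_succ r)).const_mul (Fintype.card ι - 2 * a)).add
    ((DegLE.sum univ fun i (_ : i ∈ univ) => hf.sgn_mul i).const_mul (-1))
  convert h1 using 2 with x
  rw [← sum_mul, sum_sgn]
  ring

lemma DegLE.ite_eq {f : (ι → ZMod 2) → ℤ} {r : ℕ} (hf : DegLE f r) (i : ι) (b : ZMod 2) :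
    DegLE (fun x => if x i = b then f x else 0) (r + 1) := by
  apply DegLE.of_two_mul
  have h1 := (hf.mono (Nat.le_succ r)).add ((hf.sgn_mul i).const_mul (sgn b))
  convert h1 using 2 with x
  rcases zmod_two_cases (x i) with h | h <;> rcases zmod_two_cases b with h' | h' <;>
    simp [h, h', two_mul]

/-- Prescribing the coordinates in `T` raises the degree by at most `#T`. -/
lemma DegLE.ite_forall_eq {f : (ι → ZMod 2) → ℤ} {r : ℕ} (hf : DegLE f r) (T : Finset ι)
    (b : ZMod 2) : DegLE (fun x => if ∀ i ∈ T, x i = b then f x else 0) (r + #T) := by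
  induction T using Finset.induction_on with
  | empty => simpa using hf
  | insert i T hi ih =>
    rw [card_insert_of_notMem hi, ← add_assoc]
    convert ih.ite_eq i b using 2 with x
    simp only [forall_mem_insert]
    split_ifs <;> tauto

/-- A function of degree at most `r` has the same average over a code as over the whole space
when the nonzero words of the dual code have weight more than `r`. -/
lemma sum_orth_of_degLE {E : Submodule (ZMod 2) (ι → ZMod 2)} {r : ℕ}
    (hE : ∀ z ∈ E, z ≠ 0 → r < hammingNorm z) {f : (ι → ZMod 2) → ℤ} (hf : DegLE f r) :
    codeCard E * ∑ x with x ∈ orth E, f x = ∑ x, f x := by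
  have h := poisson E f 0
  simp only [add_zero, chi_zero_left, Int.cast_one, mul_one] at h
  rw [← h, sum_eq_single 0, hat_zero_right]
  · intro z hz hne
    simp only [mem_filter, mem_univ, true_and] at hz
    exact hf z (hE z hz hne)
  · intro h0
    simp at h0

lemma codeCard_mul_codeCard_orth (E : Submodule (ZMod 2) (ι → ZMod 2)) :
    codeCard E * codeCard (orth E) = 2 ^ Fintype.card ι := by
  have h := sum_orth_of_degLE (E := E) (r := 0)
    (fun z _ hne => hammingNorm_pos_iff.2 hne) (DegLE.const 1 0)
  simp only [sum_const, nsmul_eq_mul, mul_one, card_univ, Fintype.card_fun] at h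
  have h2 : ((codeCard E * codeCard (orth E) : ℕ) : ℤ) = ((2 ^ Fintype.card ι : ℕ) : ℤ) := by
    push_cast
    rw [codeCard, codeCard] at *
    rw [h]
    simp
  exact_mod_cast h2

lemma orth_orth (E : Submodule (ZMod 2) (ι → ZMod 2)) : orth (orth E) = E := by
  symm
  apply eq_of_codeCard_le (le_orth_orth E)
  have h1 := codeCard_mul_codeCard_orth E
  have h2 := codeCard_mul_codeCard_orth (orth E)
  have h3 := codeCard_pos (orth E)
  have : codeCard (orth E) * codeCard (orth (orth E)) = codeCard (orth E) * codeCard E := by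
    rw [h2, ← h1, mul_comm]
  exact (Nat.eq_of_mul_eq_mul_left h3 this).le

/-- Every linear functional on a code is the dot product with some word. -/
lemma exists_dotProduct_eq (E : Submodule (ZMod 2) (ι → ZMod 2)) (φ : E →ₗ[ZMod 2] ZMod 2) :
    ∃ s : ι → ZMod 2, ∀ e : E, s ⬝ᵥ (e : ι → ZMod 2) = φ e := by
  obtain ⟨g, hg⟩ := LinearMap.exists_extend φ
  refine ⟨fun i => g fun j => if i = j then 1 else 0, fun e => ?_⟩
  have h1 : φ e = g e := by rw [← hg]; rfl
  rw [h1, LinearMap.pi_apply_eq_sum_univ g, dotProduct]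
  exact sum_congr rfl fun i _ => by rw [smul_eq_mul, mul_comm]

/-- On a self-orthogonal code, half the weight modulo `2` is a linear functional. -/
lemma exists_chi_eq_half_weight {E : Submodule (ZMod 2) (ι → ZMod 2)} (hE : E ≤ orth E) :
    ∃ s : ι → ZMod 2, ∀ e ∈ E, chi s e = (-1) ^ (hammingNorm e / 2) := by
  have heven : ∀ e ∈ E, 2 ∣ hammingNorm e := by
    intro e he
    have := hE he e he
    rwa [dotProduct_self_word, ZMod.natCast_eq_zero_iff] at this
  let φ : E →ₗ[ZMod 2] ZMod 2 :=
    AddMonoidHom.toZModLinearMap 2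
      { toFun := fun e => ((hammingNorm (e : ι → ZMod 2) / 2 : ℕ) : ZMod 2)
        map_zero' := by simp
        map_add' := by
          intro x y
          have h := hammingNorm_add_modEq (hE x.2 y y.2)
          have hx := heven x x.2
          have hy := heven y y.2
          have hxy := heven _ (x + y).2
          rw [← Nat.cast_add, ZMod.natCast_eq_natCast_iff]
          simp only [Submodule.coe_add] at *
          unfold Nat.ModEq at *
          omega }
  obtain ⟨s, hs⟩ := exists_dotProduct_eq E φ
  refine ⟨s, fun e he => ?_⟩
  have := hs ⟨e, he⟩
  rw [chi, this]
  exact sgn_natCast _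

end Duality

/-! ### Extremal self-dual codes of length 72 are doubly even -/

section DoublyEven

open scoped Classical

variable {ι : Type*} [Fintype ι] [DecidableEq ι]

lemma hat_weight (g : ℤ → ℤ) (z : ι → ZMod 2) :
    hat (fun x => g (hammingNorm x)) z = hatSum (Fintype.card ι) (hammingNorm z) g := by
  simp only [hat, Int.cast_id]
  exact sum_chi_mul_weight z g

/-- Words of weight at most `r` at mutual distance at least `2r` have weight exactly `r` and
disjoint supports, unless there is at most one of them. -/
lemma card_le_one_or_packing {W : Finset (ι → ZMod 2)} {r : ℕ}
    (hw : ∀ z ∈ W, hammingNorm z ≤ r)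
    (hd : ∀ z ∈ W, ∀ z' ∈ W, z ≠ z' → 2 * r ≤ hammingNorm (z + z')) :
    #W ≤ 1 ∨ ((∀ z ∈ W, hammingNorm z = r) ∧ #W * r ≤ Fintype.card ι) := by
  by_cases h1 : #W ≤ 1
  · exact Or.inl h1
  right
  have hpair : ∀ z ∈ W, ∀ z' ∈ W, z ≠ z' → hammingNorm z = r ∧ hammingNorm (z * z') = 0 := by
    intro z hz z' hz' hne
    have a := hd z hz z' hz' hne
    have b := hammingNorm_add_add z z'
    have c := hw z hz
    have d := hw z' hz'
    omega
  have hr : ∀ z ∈ W, hammingNorm z = r := by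
    intro z hz
    obtain ⟨z', hz', hne⟩ := exists_mem_ne (by omega : 1 < #W) z
    exact (hpair z hz z' hz' hne.symm).1
  refine ⟨hr, ?_⟩
  have hdisj : (W : Set (ι → ZMod 2)).PairwiseDisjoint
      (fun z : ι → ZMod 2 => univ.filter (z · ≠ 0)) := by
    intro z hz z' hz' hne
    have h := (hpair z hz z' hz' hne).2
    rw [hammingNorm_eq_zero] at h
    rw [Function.onFun, Finset.disjoint_left]
    intro i hi hi'
    simp only [mem_filter, mem_univ, true_and] at hi hi'
    have := congrFun h i
    simp only [Pi.mul_apply, Pi.zero_apply] at this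
    rcases zmod_two_cases (z i) with h2 | h2 <;> rcases zmod_two_cases (z' i) with h3 | h3 <;>
      simp_all
  have h2 := card_biUnion hdisj
  have h3 : ∑ z ∈ W, #(univ.filter (z · ≠ 0)) = #W * r := sum_const_nat hr
  rw [← h3, ← h2]
  exact card_le_univ _

/-- The Fourier transform of `i ^ |x|`. -/
lemma sum_I_pow_weight_mul_chi (z : ι → ZMod 2) :
    hat (fun x => Complex.I ^ hammingNorm x) z =
      (1 + Complex.I) ^ Fintype.card ι * (-Complex.I) ^ hammingNorm z := by
  have h1 : ∀ x : ι → ZMod 2, Complex.I ^ hammingNorm x * ((chi z x : ℤ) : ℂ)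
      = ∏ i, (Complex.I ^ (x i).val * ((sgn (z i * x i) : ℤ) : ℂ)) := by
    intro x
    rw [prod_mul_distrib, prod_pow_eq_pow_sum, ← hammingNorm_eq_sum, chi, dotProduct]
    congr 1
    have : ∀ s : Finset ι, ((sgn (∑ i ∈ s, z i * x i) : ℤ) : ℂ)
        = ∏ i ∈ s, ((sgn (z i * x i) : ℤ) : ℂ) := by
      intro s
      induction s using Finset.induction_on with
      | empty => simp
      | insert i s hi ih => rw [sum_insert hi, prod_insert hi, sgn_add, Int.cast_mul, ih]
    exact this univ
  have h2 := (prod_univ_sum (fun _ : ι => (univ : Finset (ZMod 2)))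
    (fun i a => Complex.I ^ a.val * ((sgn (z i * a) : ℤ) : ℂ)))
  rw [Fintype.piFinset_univ] at h2
  rw [hat, sum_congr rfl (fun x _ => h1 x), ← h2]
  have h3 : ∀ i, ∑ a : ZMod 2, Complex.I ^ a.val * ((sgn (z i * a) : ℤ) : ℂ)
      = (1 + Complex.I) * (-Complex.I) ^ (z i).val := by
    intro i
    have hu : (univ : Finset (ZMod 2)) = {0, 1} := rfl
    rw [hu, sum_pair (by decide)]
    rcases zmod_two_cases (z i) with h | h
    · simp [h, ZMod.val_one]
    · simp only [h, ZMod.val_zero, ZMod.val_one, mul_zero, mul_one, sgn_zero, sgn_one, pow_zero,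
        pow_one, Int.cast_one, Int.cast_neg]
      linear_combination Complex.I_mul_I
  rw [prod_congr rfl (fun i _ => h3 i), prod_mul_distrib, prod_const, prod_pow_eq_pow_sum,
    ← hammingNorm_eq_sum, card_univ]

/-- The words of the shadow of a self-dual code have weight divisible by `4`
if the length is divisible by `8`. -/
lemma four_dvd_weight_shadow {C : Submodule (ZMod 2) (ι → ZMod 2)} (hC : orth C = C)
    (hn : 8 ∣ Fintype.card ι) {s : ι → ZMod 2}
    (hs : ∀ c ∈ C, chi s c = (-1) ^ (hammingNorm c / 2)) {z : ι → ZMod 2} (hz : z ∈ C) :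
    4 ∣ hammingNorm (z + s) := by
  obtain ⟨m, hm⟩ := hn
  have hcard : (codeCard C : ℂ) = 2 ^ (4 * m) := by
    have h := codeCard_mul_codeCard_orth C
    rw [hC, hm, show 8 * m = 4 * m + 4 * m by ring, pow_add] at h
    exact_mod_cast Nat.mul_self_inj.1 h
  have heven : ∀ c ∈ C, 2 ∣ hammingNorm c := by
    intro e he
    have := (hC.symm ▸ he : e ∈ orth C) e he
    rwa [dotProduct_self_word, ZMod.natCast_eq_zero_iff] at this
  have hI : (1 + Complex.I) ^ (8 * m) = 2 ^ (4 * m) := by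
    rw [pow_mul, pow_mul]
    congr 1
    have : (1 + Complex.I) ^ 2 = 2 * Complex.I := by linear_combination Complex.I_sq
    calc (1 + Complex.I) ^ 8 = ((1 + Complex.I) ^ 2) ^ 4 := by ring
      _ = 2 ^ 4 * Complex.I ^ 4 := by rw [this, mul_pow]
      _ = 2 ^ 4 := by rw [Complex.I_pow_four, mul_one]
  have hp := poisson C (fun x => Complex.I ^ hammingNorm x) s
  simp only [sum_I_pow_weight_mul_chi, hm, hI] at hp
  rw [hC, ← mul_sum] at hp
  have h1 : ∑ x with x ∈ C, Complex.I ^ hammingNorm x * ((chi s x : ℤ) : ℂ) = codeCard C := by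
    rw [codeCard, card_eq_sum_ones, Nat.cast_sum]
    refine sum_congr rfl fun c hc => ?_
    simp only [mem_filter, mem_univ, true_and] at hc
    obtain ⟨k, hk⟩ := heven c hc
    rw [hs c hc, hk, pow_mul, Complex.I_sq, Nat.mul_div_cancel_left k (by norm_num)]
    push_cast
    rw [← mul_pow]
    simp
  rw [h1, hcard] at hp
  have h2 : ∑ z with z ∈ C, (-Complex.I) ^ hammingNorm (z + s) = codeCard C := by
    rw [hcard]
    exact mul_left_cancel₀ (pow_ne_zero _ two_ne_zero) hp
  have hre : ∀ w : ℕ, ((-Complex.I) ^ w).re ≤ 1 ∧ (((-Complex.I) ^ w).re = 1 → 4 ∣ w) := by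
    intro w
    have h4 : (-Complex.I) ^ 4 = 1 := by
      rw [neg_pow, Complex.I_pow_four]; norm_num
    rw [← Nat.div_add_mod w 4, pow_add, pow_mul, h4, one_pow, one_mul]
    have : w % 4 < 4 := Nat.mod_lt _ (by norm_num)
    interval_cases w % 4 <;> simp [pow_succ]
    all_goals norm_num
  have h3 : ∑ z with z ∈ C, (1 - ((-Complex.I) ^ hammingNorm (z + s)).re) = 0 := by
    have := congrArg Complex.re h2
    rw [Complex.re_sum, Complex.natCast_re] at this
    rw [sum_sub_distrib, this, codeCard]
    simp
  have h4 := (sum_eq_zero_iff_of_nonneg (fun z _ => sub_nonneg.2 (hre _).1)).1 h3 z (by simpa)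
  exact (hre _).2 (by linarith)

/-- A polynomial in the weight, given by its list of roots, has as function on words at most its
usual degree. -/
lemma degLE_prod_weight_sub (L : List ℤ) :
    DegLE (fun x : ι → ZMod 2 => (L.map fun a => (hammingNorm x : ℤ) - a).prod) L.length := by
  induction L with
  | nil => simpa using DegLE.const 1 0
  | cons a L ih => simpa using ih.weight_sub_mul a

/-- An extremal self-dual code of length 72 is doubly even. Otherwise its doubly even subcode has
index two, and a polynomial vanishing at all possible singly even weights has the same sum over the
code and over the shadow. The sum over the shadow involves only words of weight 4 and 8, of which
there are too few. -/
theorem four_dvd_weight_of_extremal (hn : Fintype.card ι = 72)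
    {C : Submodule (ZMod 2) (ι → ZMod 2)} (hC : orth C = C)
    (hd : ∀ c ∈ C, c ≠ 0 → 16 ≤ hammingNorm c) : ∀ c ∈ C, 4 ∣ hammingNorm c := by
  have hone := one_mem_of_orth_eq hC
  have hupper : ∀ c ∈ C, hammingNorm c = 72 ∨ hammingNorm c ≤ 56 := by
    intro c hc
    have h1 := hammingNorm_add_one c
    by_cases h : c + 1 = 0
    · rw [h, hammingNorm_zero] at h1
      omega
    · have := hd _ (C.add_mem hc hone) h
      omega
  have heven : ∀ c ∈ C, 2 ∣ hammingNorm c := by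
    intro e he
    have := (hC.symm ▸ he : e ∈ orth C) e he
    rwa [dotProduct_self_word, ZMod.natCast_eq_zero_iff] at this
  obtain ⟨s, hs⟩ := exists_chi_eq_half_weight hC.ge
  by_contra hcon
  push Not at hcon
  obtain ⟨c₀, hc₀, hc₀4⟩ := hcon
  have hsC : s ∉ C := by
    intro h
    have h1 : chi s c₀ = 1 := by
      rw [chi_eq_one_iff]
      exact (hC.symm ▸ h : s ∈ orth C) c₀ hc₀
    rw [hs c₀ hc₀] at h1
    have : Odd (hammingNorm c₀ / 2) := by
      rw [Nat.odd_iff]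
      have := heven c₀ hc₀
      omega
    rw [this.neg_one_pow] at h1
    norm_num at h1
  -- A polynomial vanishing at all the singly-even weights that can occur.
  set g : ℤ → ℤ := fun w => ([18, 22, 26, 30, 34, 38, 42, 46, 50, 54].map fun a => w - a).prod
    with hg
  have hdeg : DegLE (fun x : ι → ZMod 2 => g (hammingNorm x)) 10 := degLE_prod_weight_sub _
  have hgs : ∀ c ∈ C, g (hammingNorm c) = g (hammingNorm c) * chi s c := by
    intro c hc
    have h2 := heven c hc
    by_cases h4 : 4 ∣ hammingNorm c
    · rw [hs c hc, Even.neg_one_pow, mul_one]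
      rw [Nat.even_iff]
      omega
    · have h0 : c ≠ 0 := by rintro rfl; simp at h4
      have h5 := hd c hc h0
      have h6 := hupper c hc
      have : g (hammingNorm c) = 0 := by
        have h7 : hammingNorm c ≤ 56 := by omega
        interval_cases hammingNorm c <;> first | omega | decide
      rw [this, zero_mul]
  have hS1 : (codeCard C : ℤ) * ∑ c with c ∈ C, g (hammingNorm c) = hatSum 72 0 g := by
    have h := sum_orth_of_degLE (E := C) (r := 10) (fun z hz h0 => by
      have := hd z hz h0
      omega) hdeg
    rw [hC] at h
    rw [h, ← hat_zero_right, hat_weight, hn, hammingNorm_zero]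
  have hS2 : (codeCard C : ℤ) * ∑ c with c ∈ C, g (hammingNorm c)
      = ∑ z with z ∈ C, hatSum 72 (hammingNorm (z + s)) g := by
    have h := poisson C (fun x => g (hammingNorm x)) s
    rw [hC] at h
    simp only [hat_weight, hn, Int.cast_id] at h
    rw [h]
    refine congrArg _ (sum_congr rfl fun c hc => ?_)
    simp only [mem_filter, mem_univ, true_and] at hc
    exact hgs c hc
  -- Only the shadow words of weight `4` and `8` contribute.
  set W : Finset (ι → ZMod 2) := (univ.filter (fun z => z ∈ C ∧ hammingNorm (z + s) ≤ 8)).image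
    (· + s) with hW
  have hinj : Set.InjOn (· + s)
      (univ.filter (fun z : ι → ZMod 2 => z ∈ C ∧ hammingNorm (z + s) ≤ 8) : Set (ι → ZMod 2)) :=
    fun x _ y _ h => add_right_cancel h
  have hS3 : ∑ z with z ∈ C, hatSum 72 (hammingNorm (z + s)) g
      = ∑ y ∈ W, hatSum 72 (hammingNorm y) g := by
    rw [hW, sum_image hinj]
    symm
    apply sum_subset
    · intro z hz
      simp only [mem_filter, mem_univ, true_and] at hz ⊢
      exact hz.1
    · intro z hz hz'
      simp only [mem_filter, mem_univ, true_and, not_and, not_le] at hz hz'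
      have h8 := hz' hz
      have h4 := four_dvd_weight_shadow hC (by omega) hs hz
      have := hdeg (z + s) (by omega)
      rwa [hat_weight, hn] at this
  have hWmem : ∀ y ∈ W, hammingNorm y = 4 ∨ hammingNorm y = 8 := by
    intro y hy
    simp only [hW, mem_image, mem_filter, mem_univ, true_and] at hy
    obtain ⟨z, ⟨hz, hz8⟩, rfl⟩ := hy
    have h4 := four_dvd_weight_shadow hC (by omega) hs hz
    have h0 : hammingNorm (z + s) ≠ 0 := by
      rw [hammingNorm_ne_zero_iff]
      intro h
      exact hsC (eq_of_add_eq_zero_word h ▸ hz)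
    omega
  have hpack := card_le_one_or_packing (W := W) (r := 8)
    (fun y hy => by have := hWmem y hy; omega) (by
      intro y hy y' hy' hne
      simp only [hW, mem_image, mem_filter, mem_univ, true_and] at hy hy'
      obtain ⟨z, ⟨hz, -⟩, rfl⟩ := hy
      obtain ⟨z', ⟨hz', -⟩, rfl⟩ := hy'
      have h1 : z + s + (z' + s) = z + z' := by
        rw [add_add_add_comm, add_self_word, add_zero]
      rw [h1]
      apply hd _ (C.add_mem hz hz')
      intro h
      exact hne (congrArg (· + s) (eq_of_add_eq_zero_word h)))
  have e0 : hatSum 72 0 g = 2 ^ 72 * 1913625 := by decide +kernel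
  have e4 : hatSum 72 4 g = 2 ^ 72 * 226800 := by decide +kernel
  have e8 : hatSum 72 8 g = 2 ^ 72 * 14175 := by decide +kernel
  rw [hS2, hS3, e0] at hS1
  rcases hpack with h | ⟨h, h'⟩
  · have : ∑ y ∈ W, hatSum 72 (hammingNorm y) g ≤ ∑ y ∈ W, 2 ^ 72 * 226800 :=
      sum_le_sum fun y hy => by
        rcases hWmem y hy with h | h <;> rw [h]
        · rw [e4]
        · rw [e8]; norm_num
    rw [sum_const, nsmul_eq_mul] at this
    have h1 : ((#W : ℕ) : ℤ) ≤ 1 := by exact_mod_cast h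
    linarith
  · have : ∑ y ∈ W, hatSum 72 (hammingNorm y) g = ∑ y ∈ W, 2 ^ 72 * 14175 :=
      sum_congr rfl fun y hy => by rw [h y hy, e8]
    rw [sum_const, nsmul_eq_mul] at this
    have h1 : ((#W : ℕ) : ℤ) ≤ 9 := by
      have : #W ≤ 9 := by omega
      exact_mod_cast this
    linarith

end DoublyEven

/-! ### Self-orthogonal codes whose dual is even of minimum weight at least 8 -/

section DualWeightEight

open scoped Classical

variable {ι : Type*} [Fintype ι] [DecidableEq ι]

/-- Poisson summation, from the code to the translate of its dual by `s`. -/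
lemma sum_code_mul_chi (E : Submodule (ZMod 2) (ι → ZMod 2)) (s : ι → ZMod 2) (g : ℤ → ℤ) :
    codeCard (orth E) * ∑ x with x ∈ E, g (hammingNorm x) * chi s x
      = ∑ z with z ∈ orth E, hatSum (Fintype.card ι) (hammingNorm (z + s)) g := by
  have h := poisson (orth E) (fun x => g (hammingNorm x)) s
  rw [orth_orth] at h
  simp only [hat_weight, Int.cast_id] at h
  exact h.symm

/-- A self-orthogonal code whose dual has only even weights, the nonzero ones at least `8`. -/
structure DualWeightEight (E : Submodule (ZMod 2) (ι → ZMod 2)) : Prop where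
  le_orth : E ≤ orth E
  eight_le : ∀ x ∈ orth E, x ≠ 0 → 8 ≤ hammingNorm x
  even : ∀ x ∈ orth E, 2 ∣ hammingNorm x

namespace DualWeightEight

variable {E : Submodule (ZMod 2) (ι → ZMod 2)}

lemma one_mem (h : DualWeightEight E) : (1 : ι → ZMod 2) ∈ E := by
  rw [← orth_orth E]
  intro x hx
  rw [dotProduct_comm, dotProduct_one_word, ZMod.natCast_eq_zero_iff]
  exact h.even x hx

/-- Complementation turns the lower bound for the weights into an upper bound. -/
lemma eq_one_or_hammingNorm_add_le (h : DualWeightEight E) {x : ι → ZMod 2} (hx : x ∈ orth E) :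
    x = 1 ∨ hammingNorm x + 8 ≤ Fintype.card ι := by
  have h1 := hammingNorm_add_one x
  by_cases h0 : x + 1 = 0
  · left
    exact eq_of_add_eq_zero_word h0
  · right
    have := h.eight_le _ ((orth E).add_mem hx (h.le_orth h.one_mem)) h0
    omega

lemma card_le (h : DualWeightEight E) : codeCard E ≤ codeCard (orth E) := codeCard_mono h.le_orth

/-- A polynomial in the weight of degree at most 7 has the same average over the dual code and over
all words. -/
lemma sum_orth (h : DualWeightEight E) {g : ℤ → ℤ}
    (hg : DegLE (fun x : ι → ZMod 2 => g (hammingNorm x)) 7) :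
    codeCard E * ∑ x with x ∈ orth E, g (hammingNorm x) = hatSum (Fintype.card ι) 0 g := by
  rw [sum_orth_of_degLE (r := 7) (fun z hz h0 => h.eight_le z (h.le_orth hz) h0) hg,
    ← hat_zero_right, hat_weight, hammingNorm_zero]

/-- A polynomial in the weight of degree at most 7 has the same average over the code and over all
words. -/
lemma sum_code (h : DualWeightEight E) {g : ℤ → ℤ}
    (hg : DegLE (fun x : ι → ZMod 2 => g (hammingNorm x)) 7) :
    codeCard (orth E) * ∑ x with x ∈ E, g (hammingNorm x) = hatSum (Fintype.card ι) 0 g := by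
  have := sum_orth_of_degLE (E := orth E) (r := 7) (fun z hz h0 => h.eight_le z hz h0) hg
  rw [orth_orth] at this
  rw [this, ← hat_zero_right, hat_weight, hammingNorm_zero]

/-- A sum over words of which only `0` and the all-ones word contribute. -/
lemma sum_two_words {K : Submodule (ZMod 2) (ι → ZMod 2)} (h1 : (1 : ι → ZMod 2) ∈ K)
    (hn : 0 < Fintype.card ι) {f : (ι → ZMod 2) → ℤ} (hf : ∀ x ∈ K, x ≠ 0 → x ≠ 1 → f x = 0) :
    ∑ x with x ∈ K, f x = f 0 + f 1 := by
  have h01 : (0 : ι → ZMod 2) ≠ 1 := by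
    obtain ⟨i⟩ := Fintype.card_pos_iff.1 hn
    intro h
    simpa using congrFun h i
  rw [← sum_pair h01]
  symm
  apply sum_subset
  · intro x hx
    simp only [mem_insert, mem_singleton] at hx
    rcases hx with rfl | rfl <;> simp [h1]
  · intro x hx hx'
    simp only [mem_filter, mem_univ, true_and, mem_insert, mem_singleton, not_or] at hx hx'
    exact hf x hx hx'.1 hx'.2

lemma card_mul_card_le_four (h : DualWeightEight E) (hn : 0 < Fintype.card ι)
    (hn16 : Fintype.card ι < 16) : codeCard E * codeCard (orth E) ≤ 4 := by
  have h2 : codeCard (orth E) ≤ 2 := by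
    have h3 : univ.filter (· ∈ orth E) ⊆ ({0, 1} : Finset (ι → ZMod 2)) := by
      intro x hx
      simp only [mem_filter, mem_univ, true_and] at hx
      simp only [mem_insert, mem_singleton]
      by_contra hcon
      push Not at hcon
      have a := h.eight_le x hx hcon.1
      have b := (h.eq_one_or_hammingNorm_add_le hx).resolve_left hcon.2
      omega
    exact (card_le_card h3).trans (card_le_two)
  have h4 := h.card_le
  nlinarith

lemma sixteen_le_card (h : DualWeightEight E) (hn : 4 ≤ Fintype.card ι) :
    16 ≤ Fintype.card ι := by
  by_contra hlt
  have h1 := h.card_mul_card_le_four (by omega) (by omega)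
  rw [codeCard_mul_codeCard_orth E] at h1
  have : 2 ^ 4 ≤ 2 ^ Fintype.card ι := Nat.pow_le_pow_right (by norm_num) hn
  omega

/-- In length 16 the nonconstant words of the dual code would all have weight 8, and the average
of `(w - 8)^2` would determine the number of codewords to be too large. -/
lemma card_ne_sixteen (h : DualWeightEight E) : Fintype.card ι ≠ 16 := by
  intro hn
  set g : ℤ → ℤ := fun w => ([8, 8].map fun a => w - a).prod with hg
  have h1 := h.sum_orth (g := g) ((degLE_prod_weight_sub [8, 8]).mono (by simp))
  rw [sum_two_words (h.le_orth h.one_mem) (by omega) (fun x hx h0 hne => ?_), hammingNorm_zero,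
    hammingNorm_one_word, hn] at h1
  · have e : hatSum 16 0 g = 2 ^ 18 := by decide +kernel
    have e1 : g ((0 : ℕ) : ℤ) + g ((16 : ℕ) : ℤ) = 2 ^ 7 := by decide
    rw [e, e1] at h1
    have h2 : codeCard E = 2 ^ 11 := by
      have : (codeCard E : ℤ) = 2 ^ 11 := by linarith
      exact_mod_cast this
    have h3 := codeCard_mul_codeCard_orth E
    have h4 := h.card_le
    rw [h2, hn] at h3
    rw [h2] at h4
    omega
  · have a := h.eight_le x hx h0
    have b := (h.eq_one_or_hammingNorm_add_le hx).resolve_left hne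
    rw [show hammingNorm x = 8 by omega]
    decide

/-- In length 20 the nonconstant words of the dual code have weights 8, 10 and 12. A quartic with
these roots has an average that no code size explains. -/
lemma card_ne_twenty (h : DualWeightEight E) : Fintype.card ι ≠ 20 := by
  intro hn
  set g : ℤ → ℤ := fun w => ([8, 10, 10, 12].map fun a => w - a).prod with hg
  have h1 := h.sum_orth (g := g) ((degLE_prod_weight_sub [8, 10, 10, 12]).mono (by simp))
  rw [sum_two_words (h.le_orth h.one_mem) (by omega) (fun x hx h0 hne => ?_), hammingNorm_zero,
    hammingNorm_one_word, hn] at h1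
  · have e : hatSum 20 0 g = 55050240 := by decide +kernel
    have e1 : g ((0 : ℕ) : ℤ) + g ((20 : ℕ) : ℤ) = 19200 := by decide
    rw [e, e1] at h1
    omega
  · have a := h.eight_le x hx h0
    have b := (h.eq_one_or_hammingNorm_add_le hx).resolve_left hne
    have c := h.even x hx
    have d : hammingNorm x ≤ 12 := by omega
    interval_cases hammingNorm x <;> first | omega | decide

/-- In length 24 the code is self-dual with the weights of the extended Golay code. -/
lemma of_card_eq_twentyFour (h : DualWeightEight E) (hn : Fintype.card ι = 24) :
    codeCard E = 2 ^ 12 ∧ orth E = E ∧ ∀ x ∈ E, hammingNorm x = 0 ∨ hammingNorm x = 8 ∨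
      hammingNorm x = 12 ∨ hammingNorm x = 16 ∨ hammingNorm x = 24 := by
  set g : ℤ → ℤ := fun w => ([8, 12, 12, 16].map fun a => w - a).prod with hg
  -- `g` is nonpositive at all even weights from 8 to 16, except for the roots 8, 12 and 16
  set f : (ι → ZMod 2) → ℤ := fun x =>
    if x = 0 ∨ x = 1 then g (hammingNorm x) else 0 with hf
  have h1 := h.sum_orth (g := g) ((degLE_prod_weight_sub [8, 12, 12, 16]).mono (by simp))
  have hweights : ∀ x ∈ orth E, x ≠ 0 → x ≠ 1 → 8 ≤ hammingNorm x ∧ hammingNorm x ≤ 16 ∧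
      2 ∣ hammingNorm x := by
    intro x hx h0 hne
    have a := h.eight_le x hx h0
    have b := (h.eq_one_or_hammingNorm_add_le hx).resolve_left hne
    have c := h.even x hx
    omega
  have hle : ∀ x ∈ orth E, g (hammingNorm x) ≤ f x := by
    intro x hx
    simp only [hf]
    split_ifs with hx01
    · exact le_rfl
    · push Not at hx01
      obtain ⟨a, b, c⟩ := hweights x hx hx01.1 hx01.2
      interval_cases hammingNorm x <;> first | omega | decide
  have hfsum : ∑ x with x ∈ orth E, f x = 36864 := by
    rw [sum_two_words (h.le_orth h.one_mem) (by omega) (fun x hx h0 hne => by simp [hf, h0, hne])]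
    simp only [hf, true_or, or_true, if_true, hammingNorm_zero, hammingNorm_one_word, hn]
    decide
  have e : hatSum 24 0 g = 2 ^ 24 * 9 := by decide +kernel
  rw [hn, e] at h1
  have hsq : codeCard E * codeCard E ≤ 2 ^ 24 := by
    rw [← hn, ← codeCard_mul_codeCard_orth E]
    exact Nat.mul_le_mul_left _ h.card_le
  have hcard : codeCard E ≤ 2 ^ 12 := by nlinarith
  have hsum : ∑ x with x ∈ orth E, g (hammingNorm x) ≤ 36864 := by
    rw [← hfsum]
    exact sum_le_sum fun x hx => hle x (by simpa using hx)
  have hcard' : (codeCard E : ℤ) ≤ 2 ^ 12 := by exact_mod_cast hcard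
  have hpos : (0 : ℤ) < codeCard E := by exact_mod_cast codeCard_pos E
  have hEq : (codeCard E : ℤ) = 2 ^ 12 := by nlinarith
  have hEq' : codeCard E = 2 ^ 12 := by exact_mod_cast hEq
  have hK : E = orth E := by
    apply eq_of_codeCard_le h.le_orth
    have := codeCard_mul_codeCard_orth E
    rw [hEq', hn] at this
    omega
  refine ⟨hEq', hK.symm, fun x hx => ?_⟩
  have hx' := h.le_orth hx
  have hsum2 : ∑ x with x ∈ orth E, (f x - g (hammingNorm x)) = 0 := by
    rw [sum_sub_distrib, hfsum]
    rw [hEq] at h1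
    linarith
  have hz := (sum_eq_zero_iff_of_nonneg
    (fun x hx => sub_nonneg.2 (hle x (by simpa using hx)))).1 hsum2 x (by simpa using hx')
  by_cases h0 : x = 0
  · simp [h0]
  by_cases hone : x = 1
  · simp [hone, hammingNorm_one_word, hn]
  obtain ⟨a, b, c⟩ := hweights x hx' h0 hone
  simp only [hf, h0, hone, or_self, if_false, zero_sub, neg_eq_zero] at hz
  interval_cases hammingNorm x <;> first | omega | (revert hz; decide)

lemma even_code {ι : Type*} [Fintype ι] {E : Submodule (ZMod 2) (ι → ZMod 2)}
    (h : DualWeightEight E) {x : ι → ZMod 2} (hx : x ∈ E) : 2 ∣ hammingNorm x :=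
  h.even x (h.le_orth hx)

lemma chi_of_four_dvd {ι : Type*} [Fintype ι] {s x : ι → ZMod 2}
    (hs : chi s x = (-1) ^ (hammingNorm x / 2))
    (h4 : hammingNorm x % 4 = 0) : chi s x = 1 := by
  rw [hs, Even.neg_one_pow]
  rw [Nat.even_iff]
  omega

lemma chi_of_not_four_dvd {ι : Type*} [Fintype ι] {s x : ι → ZMod 2}
    (hs : chi s x = (-1) ^ (hammingNorm x / 2))
    (h4 : hammingNorm x % 4 = 2) : chi s x = -1 := by
  rw [hs, Odd.neg_one_pow]
  rw [Nat.odd_iff]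
  omega

lemma not_mem_orth_of_chi {ι : Type*} [Fintype ι] {E : Submodule (ZMod 2) (ι → ZMod 2)}
    {s x : ι → ZMod 2} (hx : x ∈ E) (h : chi s x = -1) : s ∉ orth E := by
  intro hs
  have := (chi_eq_one_iff s x).2 (hs x hx)
  omega

/-- Length 28 is impossible. In the doubly even case two polynomials vanishing at the weights
8, 12, 16, 20 have contradictory averages; otherwise the average of a quartic vanishing at the
singly even weights is computed on the shadow, where too few words have weight at most 4. -/
lemma card_ne_twentyEight (h : DualWeightEight E) : Fintype.card ι ≠ 28 := by
  intro hn
  have hweights : ∀ x ∈ E, x ≠ 0 → x ≠ 1 → 8 ≤ hammingNorm x ∧ hammingNorm x ≤ 20 ∧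
      2 ∣ hammingNorm x := by
    intro x hx h0 hne
    have a := h.eight_le x (h.le_orth hx) h0
    have b := (h.eq_one_or_hammingNorm_add_le (h.le_orth hx)).resolve_left hne
    have c := h.even_code hx
    omega
  obtain ⟨s, hs⟩ := exists_chi_eq_half_weight h.le_orth
  by_cases hDE : ∀ x ∈ E, 4 ∣ hammingNorm x
  · set g : ℤ → ℤ := fun w => ([8, 12, 16, 20].map fun a => w - a).prod with hg
    set g' : ℤ → ℤ := fun w => ([8, 12, 14, 14, 16, 20].map fun a => w - a).prod with hg'
    have h1 := h.sum_code (g := g) ((degLE_prod_weight_sub [8, 12, 16, 20]).mono (by simp))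
    have h2 := h.sum_code (g := g')
      ((degLE_prod_weight_sub [8, 12, 14, 14, 16, 20]).mono (by simp))
    rw [sum_two_words h.one_mem (by omega) (fun x hx h0 hne => ?_), hammingNorm_zero,
      hammingNorm_one_word, hn] at h1
    rw [sum_two_words h.one_mem (by omega) (fun x hx h0 hne => ?_), hammingNorm_zero,
      hammingNorm_one_word, hn] at h2
    · have e1 : hatSum 28 0 g = 2 ^ 27 * 15 := by decide +kernel
      have e2 : hatSum 28 0 g' = 2 ^ 27 * 105 := by decide +kernel
      have e3 : g ((0 : ℕ) : ℤ) + g ((28 : ℕ) : ℤ) = 61440 := by decide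
      have e4 : g' ((0 : ℕ) : ℤ) + g' ((28 : ℕ) : ℤ) = 12042240 := by decide
      rw [e1, e3] at h1
      rw [e2, e4] at h2
      omega
    · obtain ⟨a, b, -⟩ := hweights x hx h0 hne
      have c := hDE x hx
      interval_cases hammingNorm x <;> first | omega | decide
    · obtain ⟨a, b, -⟩ := hweights x hx h0 hne
      have c := hDE x hx
      interval_cases hammingNorm x <;> first | omega | decide
  · push Not at hDE
    obtain ⟨x₀, hx₀, h4⟩ := hDE
    have hsK : s ∉ orth E := not_mem_orth_of_chi hx₀
      (chi_of_not_four_dvd (hs x₀ hx₀) (by have := h.even_code hx₀; omega))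
    -- `g` vanishes at the singly even weights of the code
    set g : ℤ → ℤ := fun w => ([10, 14, 14, 18].map fun a => w - a).prod with hg
    have hdeg : DegLE (fun x : ι → ZMod 2 => g (hammingNorm x)) 4 := degLE_prod_weight_sub _
    have h1 := h.sum_code (g := g) (hdeg.mono (by norm_num))
    have h2 := sum_code_mul_chi E s g
    have h3 : ∑ x with x ∈ E, g (hammingNorm x) * chi s x = ∑ x with x ∈ E, g (hammingNorm x) := by
      refine sum_congr rfl fun x hx => ?_
      simp only [mem_filter, mem_univ, true_and] at hx
      by_cases h4 : hammingNorm x % 4 = 0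
      · rw [chi_of_four_dvd (hs x hx) h4, mul_one]
      · have : g (hammingNorm x) = 0 := by
          obtain ⟨a, b, c⟩ := hweights x hx (by rintro rfl; simp at h4)
            (by rintro rfl; simp [hammingNorm_one_word, hn] at h4)
          interval_cases hammingNorm x <;> first | omega | decide
        rw [this, zero_mul]
    have e0 : hatSum 28 0 g = 2 ^ 27 * 63 := by decide +kernel
    have e1 : hatSum 28 1 g = 0 := by decide +kernel
    have e2 : hatSum 28 2 g = 2 ^ 27 * 24 := by decide +kernel
    have e3 : hatSum 28 3 g = 0 := by decide +kernel
    have e4 : hatSum 28 4 g = 2 ^ 27 * 3 := by decide +kernel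
    rw [h3, h1, hn, e0] at h2
    set W : Finset (ι → ZMod 2) := (univ.filter
      (fun z => z ∈ orth E ∧ hammingNorm (z + s) ≤ 4)).image (· + s) with hW
    have hinj : Set.InjOn (· + s) (univ.filter
        (fun z : ι → ZMod 2 => z ∈ orth E ∧ hammingNorm (z + s) ≤ 4) : Set (ι → ZMod 2)) :=
      fun x _ y _ h => add_right_cancel h
    have hS3 : ∑ z with z ∈ orth E, hatSum 28 (hammingNorm (z + s)) g
        = ∑ y ∈ W, hatSum 28 (hammingNorm y) g := by
      rw [hW, sum_image hinj]
      symm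
      apply sum_subset
      · intro z hz
        simp only [mem_filter, mem_univ, true_and] at hz ⊢
        exact hz.1
      · intro z hz hz'
        simp only [mem_filter, mem_univ, true_and, not_and, not_le] at hz hz'
        have := hdeg (z + s) (hz' hz)
        rwa [hat_weight, hn] at this
    have hWmem : ∀ y ∈ W, 1 ≤ hammingNorm y ∧ hammingNorm y ≤ 4 := by
      intro y hy
      simp only [hW, mem_image, mem_filter, mem_univ, true_and] at hy
      obtain ⟨z, ⟨hz, hz8⟩, rfl⟩ := hy
      refine ⟨?_, hz8⟩
      rw [Nat.one_le_iff_ne_zero, hammingNorm_ne_zero_iff]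
      intro h
      exact hsK (eq_of_add_eq_zero_word h ▸ hz)
    have hpack := card_le_one_or_packing (W := W) (r := 4) (fun y hy => (hWmem y hy).2) (by
        intro y hy y' hy' hne
        simp only [hW, mem_image, mem_filter, mem_univ, true_and] at hy hy'
        obtain ⟨z, ⟨hz, -⟩, rfl⟩ := hy
        obtain ⟨z', ⟨hz', -⟩, rfl⟩ := hy'
        have h1 : z + s + (z' + s) = z + z' := by
          rw [add_add_add_comm, add_self_word, add_zero]
        rw [h1]
        apply h.eight_le _ ((orth E).add_mem hz hz')
        intro h
        exact hne (congrArg (· + s) (eq_of_add_eq_zero_word h)))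
    rw [hS3] at h2
    rcases hpack with hW1 | ⟨hW4, hWc⟩
    · have : ∑ y ∈ W, hatSum 28 (hammingNorm y) g ≤ ∑ y ∈ W, 2 ^ 27 * 24 :=
        sum_le_sum fun y hy => by
          obtain ⟨a, b⟩ := hWmem y hy
          interval_cases hammingNorm y
          · rw [e1]; norm_num
          · rw [e2]
          · rw [e3]; norm_num
          · rw [e4]; norm_num
      rw [sum_const, nsmul_eq_mul] at this
      have h1 : ((#W : ℕ) : ℤ) ≤ 1 := by exact_mod_cast hW1
      linarith
    · have : ∑ y ∈ W, hatSum 28 (hammingNorm y) g = ∑ y ∈ W, 2 ^ 27 * 3 :=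
        sum_congr rfl fun y hy => by rw [hW4 y hy, e4]
      rw [sum_const, nsmul_eq_mul] at this
      have h1 : ((#W : ℕ) : ℤ) ≤ 7 := by
        have : #W ≤ 7 := by omega
        exact_mod_cast this
      linarith

/-- In length 36 the code is self-dual: the averages of the polynomials below bound the number of
words of the dual code by `2 ^ 18`. -/
lemma orth_eq_of_card_eq_thirtySix (h : DualWeightEight E) (hn : Fintype.card ι = 36) :
    orth E = E := by
  have hweights : ∀ x ∈ E, x ≠ 0 → x ≠ 1 → 8 ≤ hammingNorm x ∧ hammingNorm x ≤ 28 ∧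
      2 ∣ hammingNorm x := by
    intro x hx h0 hne
    have a := h.eight_le x (h.le_orth hx) h0
    have b := (h.eq_one_or_hammingNorm_add_le (h.le_orth hx)).resolve_left hne
    have c := h.even_code hx
    omega
  obtain ⟨s, hs⟩ := exists_chi_eq_half_weight h.le_orth
  -- `ga` vanishes at the doubly-even weights, `gb` at the singly-even ones, and their
  -- difference is a multiple of the quartic polynomial `gu`.
  set ga : ℤ → ℤ := fun w => ([8, 12, 16, 20, 24, 28].map fun a => w - a).prod with hga
  set gb : ℤ → ℤ := fun w => ([10, 14, 18, 18, 22, 26].map fun a => w - a).prod with hgb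
  set gu : ℤ → ℤ := fun w => ([12, 14, 22, 24].map fun a => w - a).prod + (-336) with hgu
  have hdu : DegLE (fun x : ι → ZMod 2 => gu (hammingNorm x)) 4 :=
    (degLE_prod_weight_sub [12, 14, 22, 24]).add (DegLE.const (-336) 4)
  have ha := h.sum_code (g := ga)
    ((degLE_prod_weight_sub [8, 12, 16, 20, 24, 28]).mono (by simp))
  have hb := h.sum_code (g := gb)
    ((degLE_prod_weight_sub [10, 14, 18, 18, 22, 26]).mono (by simp))
  have ea : hatSum 36 0 ga = -(2 ^ 35 * 315) := by decide +kernel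
  have eb : hatSum 36 0 gb = 2 ^ 35 * 945 := by decide +kernel
  have ea0 : ga ((0 : ℕ) : ℤ) = 20643840 := by decide
  have ea36 : ga ((36 : ℕ) : ℤ) = 20643840 := by decide
  rw [hn, ea] at ha
  rw [hn, eb] at hb
  have hpos : (0 : ℤ) < codeCard (orth E) := by exact_mod_cast codeCard_pos _
  have hadiff : ∑ x with x ∈ E, (ga (hammingNorm x) + gb (hammingNorm x)
      - 60 * (gu (hammingNorm x) * chi s x)) = 4 * 20643840 := by
    rw [sum_two_words h.one_mem (by omega) (fun x hx h0 hne => ?_)]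
    · have hc1 : chi s 1 = 1 :=
        chi_of_four_dvd (hs 1 h.one_mem) (by simp [hammingNorm_one_word, hn])
      have hc0 : chi s 0 = 1 := chi_of_four_dvd (hs 0 E.zero_mem) (by simp)
      rw [hc0, hc1, hammingNorm_zero, hammingNorm_one_word, hn]
      decide
    · obtain ⟨a, b, c⟩ := hweights x hx h0 hne
      have hc0 := chi_of_four_dvd (hs x hx)
      have hc2 := chi_of_not_four_dvd (hs x hx)
      by_cases h4 : hammingNorm x % 4 = 0
      · rw [hc0 h4]
        interval_cases hammingNorm x <;> first | omega | decide
      · rw [hc2 (by omega)]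
        interval_cases hammingNorm x <;> first | omega | decide
  have hu : 0 ≤ ∑ x with x ∈ E, gu (hammingNorm x) * chi s x := by
    have h2 := sum_code_mul_chi E s gu
    have h3 : 0 ≤ ∑ z with z ∈ orth E, hatSum (Fintype.card ι) (hammingNorm (z + s)) gu := by
      refine sum_nonneg fun z _ => ?_
      by_cases h5 : hammingNorm (z + s) ≤ 4
      · rw [hn]
        interval_cases hammingNorm (z + s) <;> decide +kernel
      · have := hdu (z + s) (by omega)
        rw [hat_weight] at this
        exact this.ge
    rw [← h2] at h3
    exact nonneg_of_mul_nonneg_right h3 hpos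
  rw [sum_sub_distrib, sum_add_distrib, ← mul_sum] at hadiff
  have hle : (codeCard (orth E) : ℤ) ≤ 2 ^ 18 := by nlinarith
  have hle' : codeCard (orth E) ≤ 2 ^ 18 := by exact_mod_cast hle
  have hmul := codeCard_mul_codeCard_orth E
  rw [hn] at hmul
  symm
  apply eq_of_codeCard_le h.le_orth
  nlinarith [codeCard_pos E]

end DualWeightEight

end DualWeightEight

/-! ### The number of words of weight 8 in length 32 -/

section ThirtyTwo

open scoped Classical

variable {ι : Type*} [Fintype ι] [DecidableEq ι]

namespace DualWeightEight

variable {E : Submodule (ZMod 2) (ι → ZMod 2)}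

/-- The Gauss sum `∑ (-1)^(|x|/2)` over the dual code vanishes or has the square root of the
number of all words as its absolute value. -/
lemma gauss_sum_sq (h : DualWeightEight E) :
    (∑ x with x ∈ orth E, (-1 : ℤ) ^ (hammingNorm x / 2)) ^ 2 = 0 ∨
    (∑ x with x ∈ orth E, (-1 : ℤ) ^ (hammingNorm x / 2)) ^ 2 = 2 ^ Fintype.card ι := by
  obtain ⟨s, hs⟩ := exists_chi_eq_half_weight h.le_orth
  set ε : (ι → ZMod 2) → ℤ := fun x => (-1) ^ (hammingNorm x / 2) with hε
  have hmul : ∀ x ∈ orth E, ∀ z ∈ orth E, ε x * ε (z + x) = ε z * chi z x := by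
    intro x hx z hz
    have h1 := hammingNorm_add_add z x
    obtain ⟨a, ha⟩ := h.even x hx
    obtain ⟨b, hb⟩ := h.even z hz
    obtain ⟨c, hc⟩ := h.even _ ((orth E).add_mem hz hx)
    have hchi : chi z x = (-1) ^ hammingNorm (z * x) := by
      rw [chi, dotProduct_eq_natCast, sgn_natCast]
    simp only [hε, hchi, ha, hb, hc, Nat.mul_div_cancel_left _ (show 0 < 2 by norm_num)]
    have h2 : a + c + 2 * hammingNorm (z * x) = 2 * a + (b + hammingNorm (z * x)) := by omega
    have h3 : (-1 : ℤ) ^ (a + c + 2 * hammingNorm (z * x))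
        = (-1) ^ (2 * a + (b + hammingNorm (z * x))) := by rw [h2]
    rw [pow_add _ (a + c), pow_add _ (2 * a), pow_mul, pow_mul] at h3
    simpa [pow_add] using h3
  have hsq : (∑ x with x ∈ orth E, ε x) ^ 2
      = ∑ z with z ∈ orth E, ε z * (if z ∈ E then (codeCard (orth E) : ℤ) else 0) := by
    rw [sq, sum_mul]
    have h1 : ∀ x ∈ univ.filter (· ∈ orth E), ε x * ∑ y with y ∈ orth E, ε y
        = ∑ z with z ∈ orth E, ε z * chi z x := by
      intro x hx
      have hx' : x ∈ orth E := by simpa using hx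
      rw [← sum_code_add (orth E) hx' ε, mul_sum]
      exact sum_congr rfl fun z hz => hmul x hx' z (by simpa using hz)
    rw [sum_congr rfl h1, sum_comm]
    refine sum_congr rfl fun z _ => ?_
    rw [← mul_sum]
    congr 1
    have h2 := sum_chi_code (orth E) z
    rw [orth_orth] at h2
    rw [← h2]
    exact sum_congr rfl fun x _ => chi_comm z x
  have hE : (∑ x with x ∈ orth E, ε x) ^ 2
      = codeCard (orth E) * ∑ z with z ∈ E, chi s z := by
    rw [hsq, mul_sum]
    simp only [mul_ite, mul_zero]
    rw [← sum_filter, filter_filter]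
    have hfil : univ.filter (fun z => z ∈ orth E ∧ z ∈ E) = univ.filter (· ∈ E) := by
      ext z
      simp only [mem_filter, mem_univ, true_and]
      exact ⟨fun h => h.2, fun hz => ⟨h.le_orth hz, hz⟩⟩
    rw [hfil]
    refine sum_congr rfl fun z hz => ?_
    have hz' : z ∈ E := by simpa using hz
    rw [hs z hz', mul_comm]
  have hsum : ∑ z with z ∈ E, chi s z = if s ∈ orth E then (codeCard E : ℤ) else 0 := by
    rw [← sum_chi_code]
    exact sum_congr rfl fun x _ => chi_comm s x
  rw [hsum] at hE
  split_ifs at hE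
  · right
    rw [hE, ← Nat.cast_mul, mul_comm, codeCard_mul_codeCard_orth E]
    simp
  · left
    rw [hE, mul_zero]

/-- In length 32 the dual code has an even number of words of weight 8. -/
lemma even_card_weight_eight (h : DualWeightEight E) (hn : Fintype.card ι = 32) :
    Even #{x | x ∈ orth E ∧ hammingNorm x = 8} := by
  set N := #{x | x ∈ orth E ∧ hammingNorm x = 8} with hN
  set G := ∑ x with x ∈ orth E, (-1 : ℤ) ^ (hammingNorm x / 2) with hG
  -- A polynomial that, corrected by the sign of half the weight, detects the weights 8 and 24.
  set g : ℤ → ℤ := fun w => ([10, 12, 16, 16, 20, 22].map fun a => w - a).prod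
    + 2 * ([12, 16, 16, 20].map fun a => w - a).prod + (-720) with hg
  have hdeg : DegLE (fun x : ι → ZMod 2 => g (hammingNorm x)) 7 :=
    ((((degLE_prod_weight_sub [10, 12, 16, 16, 20, 22]).mono (by simp)).add
      (((degLE_prod_weight_sub [12, 16, 16, 20]).mono (by simp)).const_mul 2)).add
      (DegLE.const (-720) 7))
  have h1 := h.sum_orth hdeg
  have h24 : #{x | x ∈ orth E ∧ hammingNorm x = 24} = N := by
    rw [hN]
    refine card_bij' (fun x _ => x + 1) (fun x _ => x + 1) ?_ ?_ ?_ ?_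
    · intro x hx
      simp only [mem_filter, mem_univ, true_and] at hx ⊢
      have := hammingNorm_add_one x
      exact ⟨(orth E).add_mem hx.1 (h.le_orth h.one_mem), by omega⟩
    · intro x hx
      simp only [mem_filter, mem_univ, true_and] at hx ⊢
      have := hammingNorm_add_one x
      exact ⟨(orth E).add_mem hx.1 (h.le_orth h.one_mem), by omega⟩
    · intro x _; exact add_add_cancel_word x 1
    · intro x _; exact add_add_cancel_word x 1
  have hsum : ∑ x with x ∈ orth E, (g (hammingNorm x) + 720 * (-1) ^ (hammingNorm x / 2)
      - 92160 * (if hammingNorm x = 8 then 1 else 0)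
      - 92160 * (if hammingNorm x = 24 then 1 else 0)) = 2 * 13639680 := by
    rw [sum_two_words (h.le_orth h.one_mem) (by omega) (fun x hx h0 hne => ?_)]
    · rw [hammingNorm_zero, hammingNorm_one_word, hn]
      decide
    · have a := h.eight_le x hx h0
      have b := (h.eq_one_or_hammingNorm_add_le hx).resolve_left hne
      have c := h.even x hx
      have d : hammingNorm x ≤ 24 := by omega
      interval_cases hammingNorm x <;> first | omega | decide
  have e8 : ∑ x with x ∈ orth E, (if hammingNorm x = 8 then (1 : ℤ) else 0) = N := by
    rw [← sum_filter, filter_filter, sum_const, nsmul_eq_mul, mul_one]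
  have e24 : ∑ x with x ∈ orth E, (if hammingNorm x = 24 then (1 : ℤ) else 0) = N := by
    rw [← sum_filter, filter_filter, sum_const, nsmul_eq_mul, mul_one, h24]
  rw [sum_sub_distrib, sum_sub_distrib, sum_add_distrib, ← mul_sum, ← mul_sum, ← mul_sum,
    e8, e24] at hsum
  have ehat : hatSum 32 0 g = 2 ^ 32 * 1440 := by decide +kernel
  rw [hn, ehat] at h1
  -- The dual code has `2 ^ 16 * m` words.
  obtain ⟨m, hm⟩ : 2 ^ 16 ∣ codeCard (orth E) := by
    have h2 := codeCard_mul_codeCard_orth E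
    have h3 := h.card_le
    rw [hn] at h2
    rw [codeCard_eq_two_pow (orth E)] at h2 h3 ⊢
    apply pow_dvd_pow
    by_contra hlt
    push Not at hlt
    have h4 : 2 ^ Module.finrank (ZMod 2) (orth E) ≤ 2 ^ 15 :=
      Nat.pow_le_pow_right (by norm_num) (by omega)
    nlinarith
  have h2 : (codeCard E : ℤ) * (2 ^ 16 * m) = 2 ^ 32 := by
    have := codeCard_mul_codeCard_orth E
    rw [hm, hn] at this
    exact_mod_cast this
  have hpos : (0 : ℤ) < codeCard E := by exact_mod_cast codeCard_pos E
  have hq : ∑ x with x ∈ orth E, g (hammingNorm x) = 2 ^ 16 * m * 1440 := by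
    apply mul_left_cancel₀ hpos.ne'
    rw [h1]
    linear_combination (-1440) * h2
  have hG' : G = 0 ∨ G = 2 ^ 16 ∨ G = -2 ^ 16 := by
    rcases h.gauss_sum_sq with h3 | h3
    · left
      exact pow_eq_zero_iff (two_ne_zero) |>.1 h3
    · right
      rw [hn, show (2 : ℤ) ^ 32 = (2 ^ 16) ^ 2 by norm_num] at h3
      exact sq_eq_sq_iff_eq_or_eq_neg.1 h3
  rw [hq] at hsum
  rw [Nat.even_iff]
  rcases hG' with h3 | h3 | h3 <;> rw [← hG, h3] at hsum <;> omega

end DualWeightEight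

end ThirtyTwo

/-! ### Orbit counting and nilpotent operators -/

section Orbits

/-- A permutation of order dividing `2^(k+1)` whose `2^k`-th power has no fixed points
has only cycles of length `2^(k+1)`. -/
lemma two_pow_dvd_card {Y : Type*} [Fintype Y] [DecidableEq Y] (g : Equiv.Perm Y) (k : ℕ)
    (h1 : g ^ 2 ^ (k + 1) = 1) (h2 : ∀ y, (g ^ 2 ^ k) y ≠ y) : 2 ^ (k + 1) ∣ Fintype.card Y := by
  have hsupp : g.support = univ := by
    ext y
    simp only [Equiv.Perm.mem_support, mem_univ, iff_true]
    intro hy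
    apply h2 y
    exact Equiv.Perm.pow_apply_eq_self_of_apply_eq_self hy _
  have hcyc : ∀ n ∈ g.cycleType, 2 ^ (k + 1) ∣ n := by
    intro n hn
    have hdvd : n ∣ 2 ^ (k + 1) :=
      (Equiv.Perm.dvd_of_mem_cycleType hn).trans (orderOf_dvd_of_pow_eq_one h1)
    obtain ⟨j, hj, rfl⟩ := (Nat.dvd_prime_pow Nat.prime_two).1 hdvd
    by_contra hcon
    have hjk : j ≤ k := by
      by_contra hlt
      exact hcon (pow_dvd_pow 2 (by omega))
    obtain ⟨c, τ, hg, hd, hc, hcard⟩ := (Equiv.Perm.mem_cycleType_iff).1 hn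
    obtain ⟨x, hx⟩ := hc.nonempty_support
    apply h2 x
    have hτ : τ x = x := by
      rcases hd x with h | h
      · exact absurd h (Equiv.Perm.mem_support.1 hx)
      · exact h
    have hc1 : c ^ 2 ^ k = 1 := by
      rw [← orderOf_dvd_iff_pow_eq_one, hc.orderOf, hcard]
      exact pow_dvd_pow 2 hjk
    rw [hg, hd.commute.mul_pow, hc1, one_mul]
    exact Equiv.Perm.pow_apply_eq_self_of_apply_eq_self hτ _
  have h3 := Equiv.Perm.sum_cycleType g
  rw [hsupp, card_univ] at h3
  rw [← h3]
  exact Multiset.dvd_sum hcyc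

/-- If `g^(2^(k+1))` is the identity on an invariant set, then the number of points of this set
is congruent modulo `2^(k+1)` to the number of points fixed by `g^(2^k)`. -/
lemma card_modEq_card_fixed {α : Type*} [Fintype α] [DecidableEq α] (X : Finset α)
    (g : Equiv.Perm α) (k : ℕ) (hX : ∀ x, g x ∈ X ↔ x ∈ X)
    (h1 : g ^ 2 ^ (k + 1) = 1) :
    #X ≡ #(X.filter fun x => (g ^ 2 ^ k) x = x) [MOD 2 ^ (k + 1)] := by
  have hp : ∀ x, (g x ∈ X ∧ (g ^ 2 ^ k) (g x) ≠ g x) ↔ (x ∈ X ∧ (g ^ 2 ^ k) x ≠ x) := by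
    intro x
    have : (g ^ 2 ^ k) (g x) = g ((g ^ 2 ^ k) x) := by
      rw [← Equiv.Perm.mul_apply, ← Equiv.Perm.mul_apply, ← pow_succ, ← pow_succ']
    rw [hX, this, Ne, Ne, g.injective.eq_iff]
  let g' : Equiv.Perm {x // x ∈ X ∧ (g ^ 2 ^ k) x ≠ x} := g.subtypePerm hp
  have hpow : ∀ n, g' ^ n = (g ^ n).subtypePerm
      (p := fun x => x ∈ X ∧ (g ^ 2 ^ k) x ≠ x) (fun x => by
        induction n with
        | zero => simp
        | succ n ih => rw [pow_succ', Equiv.Perm.mul_apply, hp, ih]) := by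
    intro n
    exact Equiv.Perm.subtypePerm_pow g n hp
  have h3 := two_pow_dvd_card g' k (by
    rw [hpow]
    ext x
    simp [h1]) (by
    intro y hy
    rw [hpow] at hy
    exact y.2.2 (congrArg Subtype.val hy))
  rw [Fintype.card_subtype] at h3
  have h4 : univ.filter (fun x => x ∈ X ∧ (g ^ 2 ^ k) x ≠ x)
      = X.filter (fun x => ¬ (g ^ 2 ^ k) x = x) := by
    ext x; simp
  rw [h4] at h3
  have h5 := card_filter_add_card_filter_not (s := X) (fun x => (g ^ 2 ^ k) x = x)
  rw [← h5]
  obtain ⟨m, hm⟩ := h3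
  rw [hm]
  exact (Nat.modEq_iff_dvd' (by omega)).2 ⟨m, by omega⟩ |>.symm

/-- An operator whose kernel equals its range halves the dimension. -/
lemma finrank_eq_two_mul_of_ker_eq_range {k V : Type*} [Field k] [AddCommGroup V] [Module k V]
    [FiniteDimensional k V] (f : V →ₗ[k] V) (h : LinearMap.ker f = LinearMap.range f) :
    Module.finrank k V = 2 * Module.finrank k (LinearMap.ker f) := by
  have h1 := f.finrank_range_add_finrank_ker
  rw [← h] at h1
  omega

/-- If `N^m` maps the kernel of `N^(2m)` onto the kernel of `N^m`, then the latter has half the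
dimension of the former. -/
lemma finrank_ker_pow_halve {k V : Type*} [Field k] [AddCommGroup V] [Module k V]
    [FiniteDimensional k V] (N : V →ₗ[k] V) (m : ℕ)
    (key : ∀ x, (N ^ m) x = 0 → ∃ y, (N ^ (2 * m)) y = 0 ∧ (N ^ m) y = x) :
    Module.finrank k (LinearMap.ker (N ^ (2 * m)))
      = 2 * Module.finrank k (LinearMap.ker (N ^ m)) := by
  have hadd : ∀ x, (N ^ (2 * m)) x = (N ^ m) ((N ^ m) x) := by
    intro x
    rw [two_mul, pow_add, Module.End.mul_apply]
  have hmaps : ∀ x ∈ LinearMap.ker (N ^ (2 * m)), (N ^ m) x ∈ LinearMap.ker (N ^ (2 * m)) := by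
    intro x hx
    rw [LinearMap.mem_ker] at hx ⊢
    rw [hadd, ← hadd x, hx, map_zero]
  set f := (N ^ m).restrict hmaps with hf
  have hker : LinearMap.ker f = LinearMap.range f := by
    ext x
    rw [LinearMap.mem_ker, LinearMap.mem_range]
    constructor
    · intro hx
      obtain ⟨y, hy, hyx⟩ := key x (congrArg Subtype.val hx)
      exact ⟨⟨y, hy⟩, Subtype.ext hyx⟩
    · rintro ⟨y, rfl⟩
      apply Subtype.ext
      exact (hadd y.1).symm.trans y.2
  rw [finrank_eq_two_mul_of_ker_eq_range f hker]
  congr 1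
  apply LinearEquiv.finrank_eq
  refine LinearEquiv.ofLinearMap
    (LinearMap.codRestrict _ ((Submodule.subtype _).comp (Submodule.subtype _)) ?_)
    (LinearMap.codRestrict _ (LinearMap.codRestrict _ (Submodule.subtype _) ?_) ?_) ?_ ?_
  · intro x
    exact congrArg Subtype.val x.2
  · intro x
    rw [LinearMap.mem_ker, hadd]
    exact (congrArg _ x.2).trans (map_zero _)
  · intro x
    exact Subtype.ext x.2
  · ext x; rfl
  · ext x; rfl

/-- A nilpotent operator with `ker N^4 = im N^4` has only Jordan blocks of size 8. -/
lemma eight_dvd_finrank {k V : Type*} [Field k] [AddCommGroup V] [Module k V]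
    [FiniteDimensional k V] (N : V →ₗ[k] V) (h : ∀ x, (N ^ 4) x = 0 ↔ ∃ y, (N ^ 4) y = x) :
    8 ∣ Module.finrank k V := by
  have key : ∀ m ≤ 4, ∀ x, (N ^ m) x = 0 → ∃ y, (N ^ (2 * m)) y = 0 ∧ (N ^ m) y = x := by
    intro m hm x hx
    have h0 : (N ^ 4) x = 0 := by
      rw [← Nat.sub_add_cancel hm, pow_add, Module.End.mul_apply, hx, map_zero]
    obtain ⟨w, rfl⟩ := (h x).1 h0
    refine ⟨(N ^ (4 - m)) w, ?_, ?_⟩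
    · rw [← hx, ← Module.End.mul_apply, ← Module.End.mul_apply, ← pow_add, ← pow_add]
      congr 2
      omega
    · rw [← Module.End.mul_apply, ← pow_add]
      congr 2
      omega
  have h4 : LinearMap.ker (N ^ 4) = LinearMap.range (N ^ 4) := by
    ext x
    exact h x
  have e4 := finrank_eq_two_mul_of_ker_eq_range _ h4
  have e2 : Module.finrank k (LinearMap.ker (N ^ 4)) = _ :=
    finrank_ker_pow_halve N 2 (key 2 (by norm_num))
  have e1 : Module.finrank k (LinearMap.ker (N ^ 2)) = _ :=
    finrank_ker_pow_halve N 1 (key 1 (by norm_num))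
  omega

end Orbits

/-! ### Symmetries of Hadamard matrices of order 24 -/

section Hadamard

/-- There is no ternary self-dual code of length 6: `(1,1,1,0,0,0)` and `(0,1,-1,1,0,0)` span a
self-orthogonal code `T`, and a self-dual `U` could not be separated from `T` by the coordinate
with index `4`, since `-1` is not a square modulo `3`. -/
lemma false_of_ternary_self_dual (U : Submodule (ZMod 3) (Fin 6 → ZMod 3))
    (hU : ∀ x, x ∈ U ↔ ∀ y ∈ U, x ⬝ᵥ y = 0) : False := by
  set T : Submodule (ZMod 3) (Fin 6 → ZMod 3) :=
    Submodule.span (ZMod 3) {![1, 1, 1, 0, 0, 0], ![0, 1, -1, 1, 0, 0]} with hT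
  by_cases h4 : Pi.single 4 1 ∈ U ⊔ T
  · obtain ⟨u, hu, t, ht, hut⟩ := Submodule.mem_sup.1 h4
    obtain ⟨α, β, rfl⟩ := Submodule.mem_span_pair.1 ht
    have hu0 := (hU u).1 hu u hu
    obtain rfl : u = _ := eq_sub_of_add_eq hut
    revert hu0
    clear * -
    revert α β
    simp only [dotProduct, Fin.sum_univ_six]
    decide
  · obtain ⟨φ, hφ, hle⟩ := Submodule.exists_le_ker_of_notMem h4
    set y : Fin 6 → ZMod 3 := fun i => φ fun j => if i = j then 1 else 0 with hy
    have hφy : ∀ x, φ x = y ⬝ᵥ x := by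
      intro x
      rw [LinearMap.pi_apply_eq_sum_univ φ, dotProduct]
      exact sum_congr rfl fun i _ => by rw [smul_eq_mul, mul_comm]
    have hyU : y ∈ U := (hU y).2 fun x hx => by
      rw [← hφy]
      exact hle (Submodule.mem_sup_left hx)
    have hyT : ∀ x ∈ T, y ⬝ᵥ x = 0 := fun x hx => by
      rw [← hφy]
      exact hle (Submodule.mem_sup_right hx)
    have h1 := hyT _ (Submodule.subset_span (Set.mem_insert _ _))
    have h2 := hyT _ (Submodule.subset_span (Set.mem_insert_of_mem _ rfl))
    have h3 := (hU y).1 hyU y hyU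
    rw [hφy] at hφ
    clear_value y
    simp only [dotProduct, Fin.sum_univ_six] at h1 h2 h3 hφ
    revert h1 h2 h3 hφ
    generalize y 0 = y0, y 1 = y1, y 2 = y2, y 3 = y3, y 4 = y4, y 5 = y5
    revert y0 y1 y2 y3 y4 y5
    decide +kernel

variable {F Ω : Type*} [Fintype F] [DecidableEq F] [Fintype Ω] [DecidableEq Ω]

/-- Orbit representatives for a permutation of 24 points all of whose cycles have length 4. -/
lemma exists_orbit_representatives {Ω : Type*} [Fintype Ω] (b : Equiv.Perm Ω) (hb : b ^ 4 = 1)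
    (hb2 : ∀ t, (b ^ 2) t ≠ t) (hΩ : Fintype.card Ω = 24) :
    ∃ o : Fin 6 → Ω, Function.Bijective fun p : Fin 6 × Fin 4 => (b ^ (p.2 : ℕ)) (o p.1) := by
  classical
  let S := Equiv.Perm.SameCycle.setoid b
  let f : Quotient S × Fin 4 → Ω := fun p => (b ^ (p.2 : ℕ)) p.1.out
  have hf : Function.Bijective f := by
    constructor
    · rintro ⟨q, k⟩ ⟨q', l⟩ h
      have hS : b.SameCycle q.out q'.out := by
        refine (Equiv.Perm.sameCycle_pow_left (n := (k : ℕ))).1 ?_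
        refine (Equiv.Perm.sameCycle_pow_right (n := (l : ℕ))).1 ?_
        have : (b ^ (k : ℕ)) q.out = (b ^ (l : ℕ)) q'.out := h
        rw [this]
      have hq : q = q' := by
        rw [← q.out_eq, ← q'.out_eq]
        exact Quotient.sound hS
      subst hq
      have hkl : ∀ k l : Fin 4, k < l → (b ^ (k : ℕ)) q.out ≠ (b ^ (l : ℕ)) q.out := by
        intro k l hlt heq
        have h1 : (b ^ (l - k : ℕ)) q.out = q.out := by
          apply (b ^ (k : ℕ)).injective
          rw [← Equiv.Perm.mul_apply, ← pow_add, heq, Nat.add_sub_cancel' (le_of_lt hlt)]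
        have h2 : (l - k : ℕ) = 1 ∨ (l - k : ℕ) = 2 ∨ (l - k : ℕ) = 3 := by omega
        have h3 := Equiv.Perm.pow_apply_eq_self_of_apply_eq_self h1 2
        rw [← pow_mul] at h3
        apply hb2 q.out
        rcases h2 with h2 | h2 | h2
        · rwa [h2] at h3
        · rwa [h2] at h1
        · rw [h2, show 3 * 2 = 4 + 2 from rfl, pow_add, hb, one_mul] at h3
          exact h3
      rcases lt_trichotomy k l with hlt | rfl | hlt
      · exact absurd h (hkl k l hlt)
      · rfl
      · exact absurd h.symm (hkl l k hlt)
    · intro t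
      have hS : b.SameCycle (Quotient.mk S t).out t := Quotient.mk_out t
      obtain ⟨n, -, hn⟩ := hS.exists_pow_eq'
      refine ⟨(Quotient.mk S t, ⟨n % 4, Nat.mod_lt _ (by norm_num)⟩), ?_⟩
      have hmod : b ^ n = b ^ (n % 4) := by
        conv_lhs => rw [← Nat.div_add_mod n 4, pow_add, pow_mul, hb, one_pow, one_mul]
      change (b ^ (n % 4)) (Quotient.mk S t).out = t
      rw [← hmod, hn]
  have hc : Fintype.card (Quotient S) = 6 := by
    have := Fintype.card_of_bijective hf
    rw [Fintype.card_prod, Fintype.card_fin, hΩ] at this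
    omega
  let e : Fin 6 ≃ Quotient S := (Fintype.equivFinOfCardEq hc).symm
  exact ⟨fun i => (e i).out, hf.comp (e.prodCongr (Equiv.refl (Fin 4))).bijective⟩

/-- Rows of a square matrix with orthogonal columns are orthogonal. -/
lemma rows_orthogonal {H : F → Ω → ℤ} (hF : Fintype.card F = 24) (hΩ : Fintype.card Ω = 24)
    (hcol : ∀ s t, ∑ i, H i s * H i t = if s = t then 24 else 0) (i j : F) :
    ∑ t, H i t * H j t = if i = j then 24 else 0 := by
  set A : Matrix F Ω ℚ := Matrix.of fun i t => (H i t : ℚ) with hA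
  have h1 : ((1 / 24 : ℚ) • A.transpose) * A = 1 := by
    ext s t
    have h := congrArg (Int.cast : ℤ → ℚ) (hcol s t)
    push_cast at h
    rw [Matrix.smul_mul, Matrix.smul_apply, Matrix.mul_apply, Matrix.one_apply]
    simp only [hA, Matrix.transpose_apply, Matrix.of_apply, h]
    split_ifs <;> norm_num
  have h2 := (Matrix.mul_eq_one_comm_of_card_eq Ω F ℚ (hΩ.trans hF.symm)).1 h1
  have h3 := congrFun (congrFun h2 i) j
  rw [Matrix.mul_smul, Matrix.smul_apply, Matrix.mul_apply, Matrix.one_apply] at h3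
  simp only [hA, Matrix.transpose_apply, Matrix.of_apply] at h3
  have h4 : ((∑ t, H i t * H j t : ℤ) : ℚ) = ((if i = j then 24 else 0 : ℤ) : ℚ) := by
    push_cast
    split_ifs at h3 ⊢
    · rw [smul_eq_mul] at h3; linarith
    · rw [smul_eq_mul] at h3; linarith
  exact_mod_cast h4

/-- If the sign cocycle of the column permutation is trivial on all cycles, the columns can be
averaged over the cycles. Modulo 3 the averaged matrix would define a ternary self-dual code of
length 6. -/
lemma false_of_trivial_cocycle {H : F → Ω → ℤ} (hF : Fintype.card F = 24)
    (hΩ : Fintype.card Ω = 24)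
    (hcol : ∀ s t, ∑ i, H i s * H i t = if s = t then 24 else 0)
    (a : Equiv.Perm F) (b : Equiv.Perm Ω) (hb : b ^ 4 = 1) (hb2 : ∀ t, (b ^ 2) t ≠ t)
    (r : F → ℤ) (c : Ω → ℤ) (hc : ∀ t, c t * c t = 1)
    (hH : ∀ i t, H (a i) (b t) = r i * c t * H i t)
    (hcc : ∀ t, c t * c (b t) * c ((b ^ 2) t) * c ((b ^ 3) t) = 1) : False := by
  obtain ⟨o, ho⟩ := exists_orbit_representatives b hb hb2 hΩ
  -- `D t k` is the sign picked up on the way from `t` to `b^k t`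
  set D : Ω → ℕ → ℤ := fun t k => ∏ j ∈ range k, c ((b ^ j) t) with hD
  have hDsucc : ∀ t k, D t (k + 1) = D t k * c ((b ^ k) t) := fun t k => prod_range_succ _ _
  have hDsq : ∀ t k, D t k * D t k = 1 := by
    intro t k
    rw [hD, ← prod_mul_distrib]
    exact prod_eq_one fun j _ => hc _
  set V : Ω → F → ℤ := fun t i => ∑ k ∈ range 4, D t k * H i ((b ^ k) t) with hV
  have hVb : ∀ t i, V (b t) i = c t * V t i := by
    intro t i
    have e : ∀ k, (b ^ k) (b t) = (b ^ (k + 1)) t := fun k => by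
      rw [← Equiv.Perm.mul_apply, ← pow_succ]
    have h1 : ∀ k, c t * D (b t) k = D t (k + 1) := by
      intro k
      simp only [hD, e]
      rw [prod_range_succ' _ k]
      simp [mul_comm]
    have h2 : c t * V (b t) i = V t i := by
      simp only [hV]
      rw [mul_sum]
      have h4 : D t 4 = 1 := by
        rw [← hcc t]
        simp [hD, prod_range_succ]
      have h3 : ∀ k, c t * (D (b t) k * H i ((b ^ k) (b t)))
          = D t (k + 1) * H i ((b ^ (k + 1)) t) := by
        intro k
        rw [← mul_assoc, h1, e]
      rw [sum_congr rfl fun k _ => h3 k, sum_range_succ, sum_range_succ' _ 3, h4, hb]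
      simp [hD]
    rw [← h2, ← mul_assoc, hc, one_mul]
  have hVpow : ∀ k t i, V ((b ^ k) t) i = D t k * V t i := by
    intro k t i
    induction k with
    | zero => simp [hD]
    | succ k ih =>
      rw [pow_succ', Equiv.Perm.mul_apply, hVb, ih, hDsucc]
      ring
  have hsum : ∀ g : Ω → ℤ, ∑ t, g t = ∑ j, ∑ k ∈ range 4, g ((b ^ k) (o j)) := by
    intro g
    rw [← ho.sum_comp, Fintype.sum_prod_type]
    exact sum_congr rfl fun j _ => (Fin.sum_univ_eq_sum_range (fun k => g ((b ^ k) (o j))) 4)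
  -- the averaged columns are orthogonal, of norm 96
  have hcolV : ∀ j j', ∑ i, V (o j) i * V (o j') i = if j = j' then 96 else 0 := by
    intro j j'
    simp only [hV, sum_mul_sum]
    rw [sum_comm]
    have h1 : ∀ k ∈ range 4, ∑ i, ∑ l ∈ range 4,
        D (o j) k * H i ((b ^ k) (o j)) * (D (o j') l * H i ((b ^ l) (o j')))
        = if j = j' then 24 else 0 := by
      intro k hk
      rw [sum_comm]
      have h2 : ∀ l ∈ range 4, ∑ i,
          D (o j) k * H i ((b ^ k) (o j)) * (D (o j') l * H i ((b ^ l) (o j')))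
          = if l = k then (if j = j' then 24 else 0) else 0 := by
        intro l hl
        have h3 : ∀ i, D (o j) k * H i ((b ^ k) (o j)) * (D (o j') l * H i ((b ^ l) (o j')))
          = D (o j) k * D (o j') l * (H i ((b ^ k) (o j)) * H i ((b ^ l) (o j'))) :=
          fun i => by ring
        rw [sum_congr rfl fun i _ => h3 i, ← mul_sum, hcol]
        have h4 : ((b ^ k) (o j) = (b ^ l) (o j')) ↔ j = j' ∧ k = l := by
          constructor
          · intro h
            have := @ho.1 (j, ⟨k, mem_range.1 hk⟩) (j', ⟨l, mem_range.1 hl⟩) h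
            exact ⟨congrArg Prod.fst this, congrArg (fun p => (p.2 : ℕ)) this⟩
          · rintro ⟨rfl, rfl⟩; rfl
        simp only [h4]
        by_cases hjj : j = j'
        · subst hjj
          by_cases hkl : k = l
          · subst hkl
            simp [hDsq]
          · simp [hkl, Ne.symm hkl]
        · simp [hjj]
      rw [sum_congr rfl h2, sum_ite_eq' , if_pos hk]
    rw [sum_congr rfl h1]
    split_ifs <;> simp
  have hshift : ∀ l i, ∃ ρ : ℤ, ∃ i', ∀ t, D t l * H i ((b ^ l) t) = ρ * H i' t := by
    intro l
    induction l with
    | zero => exact fun i => ⟨1, i, fun t => by simp [hD]⟩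
    | succ l ih =>
      intro i
      obtain ⟨ρ, i', h⟩ := ih (a.symm i)
      refine ⟨r (a.symm i) * ρ, i', fun t => ?_⟩
      have h1 := hH (a.symm i) ((b ^ l) t)
      rw [Equiv.apply_symm_apply] at h1
      rw [hDsucc, pow_succ', Equiv.Perm.mul_apply, h1, mul_assoc _ ρ, ← h t]
      linear_combination (r (a.symm i) * D t l * H (a.symm i) ((b ^ l) t)) * hc ((b ^ l) t)
  have hrowV : ∀ i i', (24 : ℤ) ∣ ∑ j, V (o j) i * V (o j) i' := by
    intro i i'
    have h1 : ∑ j, V (o j) i * V (o j) i' = ∑ t, V t i * H i' t := by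
      rw [hsum]
      refine sum_congr rfl fun j _ => ?_
      simp only [hVpow]
      rw [hV, mul_sum]
      exact sum_congr rfl fun k _ => by ring
    rw [h1]
    simp only [hV, sum_mul]
    rw [sum_comm]
    refine dvd_sum fun l _ => ?_
    obtain ⟨ρ, i'', h⟩ := hshift l i
    simp only [h, mul_assoc, ← mul_sum]
    rw [rows_orthogonal hF hΩ hcol]
    split_ifs <;> simp
  -- the ternary code orthogonal to the averaged rows
  let U : Submodule (ZMod 3) (Fin 6 → ZMod 3) :=
    { carrier := {x | ∀ i, ∑ j, (V (o j) i : ZMod 3) * x j = 0}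
      zero_mem' := fun i => by simp
      add_mem' := fun {x y} hx hy i => by
        simp only [Pi.add_apply, mul_add, sum_add_distrib]
        rw [hx i, hy i, add_zero]
      smul_mem' := fun s x hx i => by
        simp only [Pi.smul_apply, smul_eq_mul, mul_left_comm _ s, ← mul_sum]
        rw [hx i, mul_zero] }
  have hself : ∀ x ∈ U, ∀ y ∈ U, x ⬝ᵥ y = 0 := by
    have hlift : ∀ x ∈ U, ∀ i, (3 : ℤ) ∣ ∑ j, V (o j) i * ((x j).val : ℤ) := by
      intro x hx i
      apply (ZMod.intCast_zmod_eq_zero_iff_dvd _ 3).1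
      push_cast
      simpa using hx i
    intro x hx y hy
    have h1 : ∑ i, (∑ j, V (o j) i * ((x j).val : ℤ)) * (∑ j, V (o j) i * ((y j).val : ℤ))
        = 96 * ∑ j, ((x j).val : ℤ) * ((y j).val : ℤ) := by
      simp only [sum_mul_sum]
      rw [sum_comm, mul_sum]
      refine sum_congr rfl fun j _ => ?_
      rw [sum_comm]
      have h2 : ∀ j', ∑ i, V (o j) i * ((x j).val : ℤ) * (V (o j') i * ((y j').val : ℤ))
          = if j = j' then 96 * (((x j).val : ℤ) * ((y j').val : ℤ)) else 0 := by
        intro j'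
        have h3 : ∀ i, V (o j) i * ((x j).val : ℤ) * (V (o j') i * ((y j').val : ℤ))
            = ((x j).val : ℤ) * ((y j').val : ℤ) * (V (o j) i * V (o j') i) := fun i => by ring
        rw [sum_congr rfl fun i _ => h3 i, ← mul_sum, hcolV]
        split_ifs <;> ring
      rw [sum_congr rfl fun j' _ => h2 j', sum_ite_eq, if_pos (mem_univ _)]
    -- 96 is divisible by 3 but not by 9
    have h2 : (9 : ℤ) ∣ 96 * ∑ j, ((x j).val : ℤ) * ((y j).val : ℤ) := by
      rw [← h1]
      exact dvd_sum fun i _ => mul_dvd_mul (hlift x hx i) (hlift y hy i)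
    have h3 : (3 : ℤ) ∣ ∑ j, ((x j).val : ℤ) * ((y j).val : ℤ) := by omega
    have h4 := (ZMod.intCast_zmod_eq_zero_iff_dvd _ 3).2 h3
    push_cast at h4
    simpa [dotProduct] using h4
  refine false_of_ternary_self_dual U fun x => ⟨fun hx => hself x hx, fun hx i => ?_⟩
  have hB : (fun j => (V (o j) i : ZMod 3)) ∈ U := by
    intro i'
    have h1 := (ZMod.intCast_zmod_eq_zero_iff_dvd _ 3).2
      ((by norm_num : (3 : ℤ) ∣ 24).trans (hrowV i' i))
    push_cast at h1
    exact h1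
  have := hx _ hB
  rw [dotProduct_comm] at this
  exact this

/-- A monomial symmetry of a Hadamard matrix of order 24 whose column permutation consists of
4-cycles permutes four of the rows cyclically in such a way that their product sums to zero. -/
lemma exists_row_orbit_sum_eq_zero {H : F → Ω → ℤ} (hF : Fintype.card F = 24)
    (hΩ : Fintype.card Ω = 24) (hpm : ∀ i t, H i t * H i t = 1)
    (hcol : ∀ s t, ∑ i, H i s * H i t = if s = t then 24 else 0)
    (a : Equiv.Perm F) (b : Equiv.Perm Ω) (ha : a ^ 4 = 1) (hb : b ^ 4 = 1)
    (hb2 : ∀ t, (b ^ 2) t ≠ t)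
    (r : F → ℤ) (c : Ω → ℤ) (hr : ∀ i, r i * r i = 1) (hc : ∀ t, c t * c t = 1)
    (hH : ∀ i t, H (a i) (b t) = r i * c t * H i t) :
    ∃ i, (a ^ 2) i ≠ i ∧
      ∑ t, H i t * H (a i) t * H ((a ^ 2) i) t * H ((a ^ 3) i) t = 0 := by
  have ha' : ∀ i, a (a (a (a i))) = i := fun i => Equiv.Perm.congr_fun ha i
  have hb' : ∀ i, b (b (b (b i))) = i := fun i => Equiv.Perm.congr_fun hb i
  simp only [pow_succ, pow_zero, one_mul, Equiv.Perm.mul_apply] at hb2 ⊢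
  -- the signs picked up along full cycles; their values are all equal
  set R : F → ℤ := fun i => r i * r (a i) * r (a (a i)) * r (a (a (a i))) with hR
  set S : Ω → ℤ := fun t => c t * c (b t) * c (b (b t)) * c (b (b (b t))) with hS
  have hRS : ∀ i t, R i * S t = 1 := by
    intro i t
    have h1 : H (a (a (a (a i)))) (b (b (b (b t)))) = R i * S t * H i t := by
      rw [hH, hH, hH, hH, hR, hS]
      ring
    rw [ha', hb'] at h1
    linear_combination (1 - R i * S t) * hpm i t - H i t * h1
  have hRR : ∀ i, R i * R i = 1 := by
    intro i
    simp only [hR]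
    calc _ = (r i * r i) * (r (a i) * r (a i)) * (r (a (a i)) * r (a (a i))) *
          (r (a (a (a i))) * r (a (a (a i)))) := by ring
      _ = 1 := by simp [hr]
  by_cases hneg : ∃ i, R i = -1
  · obtain ⟨i, hi⟩ := hneg
    refine ⟨i, fun hfix => ?_, ?_⟩
    · have h1 : R i = (r i * r i) * (r (a i) * r (a i)) := by
        simp only [hR, hfix]
        ring
      rw [h1, hr, hr] at hi
      omega
    · set w : Ω → ℤ := fun t => H i t * H (a i) t * H (a (a i)) t * H (a (a (a i))) t with hw
      have h1 : ∀ t, w (b t) = - w t := by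
        intro t
        have h2 := hH (a (a (a i))) t
        rw [ha'] at h2
        have h3 : w (b t) = R i * ((c t * c t) * (c t * c t)) * w t := by
          simp only [hw]
          rw [h2, hH, hH, hH, hR]
          ring
        rw [h3, hc, hi]
        ring
      have h2 : ∑ t, w (b t) = ∑ t, w t := Equiv.sum_comp b w
      rw [sum_congr rfl fun t _ => h1 t, sum_neg_distrib] at h2
      linarith
  · exfalso
    have hR1 : ∀ i, R i = 1 := by
      intro i
      rcases mul_self_eq_one_iff.1 (hRR i) with h | h
      · exact h
      · exact absurd ⟨i, h⟩ hneg
    obtain ⟨i⟩ : Nonempty F := Fintype.card_pos_iff.1 (by omega)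
    refine false_of_trivial_cocycle hF hΩ hcol a b hb (fun t => ?_) r c hc hH fun t => ?_
    · exact hb2 t
    · have := hRS i t
      rw [hR1, one_mul] at this
      exact this

end Hadamard

/-! ### Words fixed by an involution of the coordinates -/

section Involution

variable {ι : Type*} [LinearOrder ι]

/-- The fixed points of a coordinate permutation. -/
abbrev FixedPts (τ : Equiv.Perm ι) : Type _ := {i : ι // τ i = i}

/-- A transversal for the cycles of length two of an involution: the smaller point of each. -/
abbrev TwoCycles (τ : Equiv.Perm ι) : Type _ := {i : ι // i < τ i}

/-- The `τ`-fixed word with given values on the fixed points and on the two-cycles of `τ`. -/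
def fixedWord (τ : Equiv.Perm ι) (hτ : ∀ i, τ (τ i) = i) :
    ((FixedPts τ → ZMod 2) × (TwoCycles τ → ZMod 2)) →ₗ[ZMod 2] (ι → ZMod 2) where
  toFun p i := if h : τ i = i then p.1 ⟨i, h⟩ else if h' : i < τ i then p.2 ⟨i, h'⟩ else
    p.2 ⟨τ i, by rw [hτ]; exact lt_of_le_of_ne (not_lt.1 h') h⟩
  map_add' p q := by
    funext i
    simp only [Pi.add_apply, Prod.fst_add, Prod.snd_add]
    split_ifs <;> rfl
  map_smul' a p := by
    funext i
    simp only [Pi.smul_apply, Prod.smul_fst, Prod.smul_snd, RingHom.id_apply]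
    split_ifs <;> rfl

/-- The sums of the entries of a word over the two-cycles of `τ`. -/
def foldWord (τ : Equiv.Perm ι) : (ι → ZMod 2) →ₗ[ZMod 2] (TwoCycles τ → ZMod 2) where
  toFun v t := v t + v (τ t)
  map_add' v w := by
    funext t
    simp only [Pi.add_apply]
    ring
  map_smul' a v := by
    funext t
    simp [mul_add]

variable {τ : Equiv.Perm ι}

lemma foldWord_apply (v : ι → ZMod 2) (t : TwoCycles τ) : foldWord τ v t = v t + v (τ t) := rfl

lemma fixedWord_fixed (hτ : ∀ i, τ (τ i) = i)
    (p : (FixedPts τ → ZMod 2) × (TwoCycles τ → ZMod 2)) (i : FixedPts τ) :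
    fixedWord τ hτ p i = p.1 i := by
  have := i.2
  simp [fixedWord, this]

lemma fixedWord_left (hτ : ∀ i, τ (τ i) = i)
    (p : (FixedPts τ → ZMod 2) × (TwoCycles τ → ZMod 2)) (t : TwoCycles τ) :
    fixedWord τ hτ p t = p.2 t := by
  have := t.2
  simp [fixedWord, this, this.ne']

lemma fixedWord_right (hτ : ∀ i, τ (τ i) = i)
    (p : (FixedPts τ → ZMod 2) × (TwoCycles τ → ZMod 2)) (t : TwoCycles τ) :
    fixedWord τ hτ p (τ t) = p.2 t := by
  have := t.2
  simp [fixedWord, hτ, this.not_gt, this.ne]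

lemma forall_iff_of_involution (hτ : ∀ i, τ (τ i) = i) {P : ι → Prop} :
    (∀ i, P i) ↔ (∀ i : FixedPts τ, P i) ∧ ∀ t : TwoCycles τ, P t ∧ P (τ t) := by
  refine ⟨fun h => ⟨fun i => h i, fun t => ⟨h _, h _⟩⟩, fun ⟨h1, h2⟩ i => ?_⟩
  rcases lt_trichotomy i (τ i) with h | h | h
  · exact (h2 ⟨i, h⟩).1
  · exact h1 ⟨i, h.symm⟩
  · have := (h2 ⟨τ i, by rwa [hτ]⟩).2
    simpa only [hτ] using this

lemma fixedWord_comp (hτ : ∀ i, τ (τ i) = i)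
    (p : (FixedPts τ → ZMod 2) × (TwoCycles τ → ZMod 2)) :
    fixedWord τ hτ p ∘ τ = fixedWord τ hτ p := by
  funext i
  revert i
  refine (forall_iff_of_involution hτ).2 ⟨fun i => ?_, fun t => ⟨?_, ?_⟩⟩
  · rw [Function.comp_apply, i.2]
  · rw [Function.comp_apply, fixedWord_left, fixedWord_right]
  · rw [Function.comp_apply, hτ, fixedWord_left, fixedWord_right]

lemma fixedWord_injective (hτ : ∀ i, τ (τ i) = i) : Function.Injective (fixedWord τ hτ) := by
  intro p p' h
  ext i
  · rw [← fixedWord_fixed hτ, h, fixedWord_fixed hτ]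
  · rw [← fixedWord_left hτ, h, fixedWord_left hτ]

/-- A word fixed by `τ` is determined by its restrictions. -/
lemma eq_fixedWord (hτ : ∀ i, τ (τ i) = i) {v : ι → ZMod 2} (hv : v ∘ τ = v) :
    v = fixedWord τ hτ (fun i => v i, fun t => v t) := by
  funext i
  revert i
  refine (forall_iff_of_involution hτ).2 ⟨fun i => ?_, fun t => ⟨?_, ?_⟩⟩
  · rw [fixedWord_fixed]
  · rw [fixedWord_left]
  · rw [fixedWord_right]
    exact congrFun hv t

lemma fixedWord_foldWord (hτ : ∀ i, τ (τ i) = i) (v : ι → ZMod 2) :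
    fixedWord τ hτ (0, foldWord τ v) = v + v ∘ τ := by
  funext i
  revert i
  refine (forall_iff_of_involution hτ).2 ⟨fun i => ?_, fun t => ⟨?_, ?_⟩⟩
  · rw [fixedWord_fixed, Pi.add_apply, Function.comp_apply, i.2]
    exact (CharTwo.add_self_eq_zero _).symm
  · rw [fixedWord_left]
    rfl
  · rw [fixedWord_right, Pi.add_apply, Function.comp_apply, hτ, add_comm]
    rfl

/-- The fixed words of `C` that vanish on the fixed points, as words on the two-cycles. -/
def pureCode (τ : Equiv.Perm ι) (hτ : ∀ i, τ (τ i) = i) (C : Submodule (ZMod 2) (ι → ZMod 2)) :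
    Submodule (ZMod 2) (TwoCycles τ → ZMod 2) :=
  (C.comap (fixedWord τ hτ)).comap (LinearMap.inr _ _ _)

lemma mem_pureCode {hτ : ∀ i, τ (τ i) = i} {C : Submodule (ZMod 2) (ι → ZMod 2)}
    {x : TwoCycles τ → ZMod 2} : x ∈ pureCode τ hτ C ↔ fixedWord τ hτ (0, x) ∈ C := Iff.rfl

/-- The restrictions of the fixed words of `C` to the fixed points. -/
def fixedPart (τ : Equiv.Perm ι) (hτ : ∀ i, τ (τ i) = i) (C : Submodule (ZMod 2) (ι → ZMod 2)) :
    Submodule (ZMod 2) (FixedPts τ → ZMod 2) :=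
  (C.comap (fixedWord τ hτ)).map (LinearMap.fst _ _ _)

lemma mem_fixedPart {hτ : ∀ i, τ (τ i) = i} {C : Submodule (ZMod 2) (ι → ZMod 2)}
    {q : FixedPts τ → ZMod 2} :
    q ∈ fixedPart τ hτ C ↔ ∃ x, fixedWord τ hτ (q, x) ∈ C := by
  constructor
  · rintro ⟨⟨q', x⟩, h, rfl⟩
    exact ⟨x, h⟩
  · rintro ⟨x, h⟩
    exact ⟨(q, x), h, rfl⟩

variable [Fintype ι]

lemma sum_eq_of_involution (hτ : ∀ i, τ (τ i) = i) {M : Type*} [AddCommMonoid M] (g : ι → M) :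
    ∑ i, g i = ∑ i : FixedPts τ, g i + ∑ t : TwoCycles τ, (g t + g (τ t)) := by
  have h1 : ∑ i : FixedPts τ, g i = ∑ i with τ i = i, g i :=
    (sum_subtype _ (fun i => by simp) g).symm
  have h2 : ∑ t : TwoCycles τ, g t = ∑ i with i < τ i, g i :=
    (sum_subtype _ (fun i => by simp) g).symm
  have h3 : ∑ t : TwoCycles τ, g (τ t) = ∑ i with τ i < i, g i := by
    rw [← sum_subtype (univ.filter fun i => i < τ i) (fun i => by simp) fun i => g (τ i)]
    refine sum_bij' (fun i _ => τ i) (fun i _ => τ i) ?_ ?_ ?_ ?_ ?_ <;> simp [hτ]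
  have h4 : univ.filter (fun i => ¬ τ i = i)
      = univ.filter (fun i => i < τ i) ∪ univ.filter (fun i => τ i < i) := by
    ext i
    simp only [mem_filter, mem_univ, true_and, mem_union]
    exact ⟨fun h => (lt_or_gt_of_ne h).symm, fun h => h.elim ne_of_gt ne_of_lt⟩
  rw [sum_add_distrib, h1, h2, h3, ← sum_filter_add_sum_filter_not univ fun i => τ i = i, h4,
    sum_union]
  rw [disjoint_filter]
  exact fun i _ h => not_lt.2 h.le

lemma card_eq_of_involution (hτ : ∀ i, τ (τ i) = i) :
    Fintype.card ι = Fintype.card (FixedPts τ) + 2 * Fintype.card (TwoCycles τ) := by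
  have h := sum_eq_of_involution hτ (fun _ => 1)
  simp only [sum_const, card_univ, smul_eq_mul, mul_one] at h
  omega

lemma hammingNorm_fixedWord (hτ : ∀ i, τ (τ i) = i)
    (p : (FixedPts τ → ZMod 2) × (TwoCycles τ → ZMod 2)) :
    hammingNorm (fixedWord τ hτ p) = hammingNorm p.1 + 2 * hammingNorm p.2 := by
  rw [hammingNorm_eq_sum, hammingNorm_eq_sum, hammingNorm_eq_sum, sum_eq_of_involution hτ]
  simp only [fixedWord_fixed, fixedWord_left, fixedWord_right, ← two_mul, mul_sum]

lemma dotProduct_fixedWord (hτ : ∀ i, τ (τ i) = i) (v : ι → ZMod 2)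
    (p : (FixedPts τ → ZMod 2) × (TwoCycles τ → ZMod 2)) :
    v ⬝ᵥ fixedWord τ hτ p = (fun i : FixedPts τ => v i) ⬝ᵥ p.1 + foldWord τ v ⬝ᵥ p.2 := by
  rw [dotProduct, sum_eq_of_involution hτ]
  simp only [fixedWord_fixed, fixedWord_left, fixedWord_right, ← add_mul]
  rfl

lemma fixedWord_dotProduct_fixedWord (hτ : ∀ i, τ (τ i) = i)
    (p p' : (FixedPts τ → ZMod 2) × (TwoCycles τ → ZMod 2)) :
    fixedWord τ hτ p ⬝ᵥ fixedWord τ hτ p' = p.1 ⬝ᵥ p'.1 := by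
  rw [dotProduct_fixedWord]
  have h : foldWord τ (fixedWord τ hτ p) = 0 := by
    funext t
    rw [foldWord_apply, fixedWord_left, fixedWord_right]
    exact CharTwo.add_self_eq_zero _
  rw [h, zero_dotProduct, add_zero]
  simp only [fixedWord_fixed]

lemma orth_map_foldWord (hτ : ∀ i, τ (τ i) = i) {C : Submodule (ZMod 2) (ι → ZMod 2)}
    (hC : orth C = C) : orth (C.map (foldWord τ)) = pureCode τ hτ C := by
  ext x
  rw [mem_pureCode]
  conv_rhs => rw [← hC]
  rw [mem_orth, mem_orth]
  constructor
  · intro h v hv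
    rw [dotProduct_comm, dotProduct_fixedWord, dotProduct_zero, zero_add, dotProduct_comm]
    exact h _ (Submodule.mem_map_of_mem hv)
  · rintro h _ ⟨v, hv, rfl⟩
    have := h v hv
    rwa [dotProduct_comm, dotProduct_fixedWord, dotProduct_zero, zero_add,
      dotProduct_comm] at this

end Involution

/-! ### Words of weight 16 in extremal codes of length 72 -/

/-- Self-dual codes of length 72 and minimum weight at least 16. -/
structure ExtremalSeventyTwo {ι : Type*} [Fintype ι]
    (C : Submodule (ZMod 2) (ι → ZMod 2)) : Prop where
  card_eq : Fintype.card ι = 72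
  orth_eq : orth C = C
  sixteen_le : ∀ v ∈ C, v ≠ 0 → 16 ≤ hammingNorm v

namespace ExtremalSeventyTwo

section Weights

open scoped Classical

variable {ι : Type*} [Fintype ι] [DecidableEq ι] {C : Submodule (ZMod 2) (ι → ZMod 2)}

lemma four_dvd (h : ExtremalSeventyTwo C) {v : ι → ZMod 2} (hv : v ∈ C) : 4 ∣ hammingNorm v :=
  four_dvd_weight_of_extremal h.card_eq h.orth_eq h.sixteen_le v hv

lemma one_mem {ι : Type*} [Fintype ι] {C : Submodule (ZMod 2) (ι → ZMod 2)}
    (h : ExtremalSeventyTwo C) : (1 : ι → ZMod 2) ∈ C := one_mem_of_orth_eq h.orth_eq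

/-- The all-ones word is the only word of weight above 56. -/
lemma weight_cases (h : ExtremalSeventyTwo C) {v : ι → ZMod 2} (hv : v ∈ C) :
    v = 0 ∨ v = 1 ∨ 16 ≤ hammingNorm v ∧ hammingNorm v ≤ 56 ∧ 4 ∣ hammingNorm v := by
  by_cases h0 : v = 0
  · exact Or.inl h0
  by_cases h1 : v + 1 = 0
  · right; left
    exact eq_of_add_eq_zero_word h1
  · right; right
    have a := h.sixteen_le v hv h0
    have b := h.sixteen_le _ (C.add_mem hv h.one_mem) h1
    have c := hammingNorm_add_one v
    rw [h.card_eq] at c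
    exact ⟨a, by omega, h.four_dvd hv⟩

lemma codeCard_eq (h : ExtremalSeventyTwo C) : codeCard C = 2 ^ 36 := by
  have := codeCard_mul_codeCard_orth C
  rw [h.orth_eq, h.card_eq] at this
  nlinarith

/-- A polynomial in the weight that vanishes at the weights `20, 24, …, 56`. -/
def annihilator (w : ℤ) : ℤ :=
  ([20, 24, 28, 32, 36, 40, 44, 48, 52, 56].map fun a => w - a).prod

/-- Designs: `annihilator`, restricted to words with at most five prescribed equal coordinates, has
degree at most 15, and hence the same average over `C` and over all words. -/
lemma sum_annihilator (h : ExtremalSeventyTwo C) (T : Finset ι) (b : ZMod 2) (hT : #T ≤ 5) :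
    2 ^ 36 * ∑ v with v ∈ C, (if ∀ i ∈ T, v i = b then annihilator (hammingNorm v) else 0)
      = ∑ v : ι → ZMod 2, (if ∀ i ∈ T, v i = b then annihilator (hammingNorm v) else 0) := by
  have h1 := sum_orth_of_degLE (E := C) (r := 15)
    (fun z hz h0 => h.sixteen_le z hz h0)
    (((degLE_prod_weight_sub (ι := ι) [20, 24, 28, 32, 36, 40, 44, 48, 52, 56]).ite_forall_eq
      T b).mono (by simp; omega))
  rw [h.orth_eq, h.codeCard_eq] at h1
  exact_mod_cast h1

/-- Only the words of weight 0, 16 and 72 contribute to a sum of values of `annihilator`. -/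
lemma sum_annihilator_eq (h : ExtremalSeventyTwo C) (P : (ι → ZMod 2) → Prop)
    [DecidablePred P] :
    ∑ v with v ∈ C, (if P v then annihilator (hammingNorm v) else 0)
      = annihilator 16 * #{v | v ∈ C ∧ P v ∧ hammingNorm v = 16}
        + (if P 0 then annihilator 0 else 0) + (if P 1 then annihilator 72 else 0) := by
  have h01 : (1 : ι → ZMod 2) ≠ 0 := by
    intro h'
    have := hammingNorm_one_word (ι := ι)
    rw [h', hammingNorm_zero, h.card_eq] at this
    omega
  have hterm : ∀ v ∈ univ.filter (· ∈ C), (if P v then annihilator (hammingNorm v) else 0)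
      = annihilator 16 * (if P v ∧ hammingNorm v = 16 then 1 else 0)
        + (if v = 0 then (if P 0 then annihilator 0 else 0) else 0)
        + (if v = 1 then (if P 1 then annihilator 72 else 0) else 0) := by
    intro v hv
    simp only [mem_filter, mem_univ, true_and] at hv
    rcases h.weight_cases hv with rfl | rfl | ⟨h1, h2, h3⟩
    · simp [h01.symm]
    · simp [h01, hammingNorm_one_word, h.card_eq]
    · have hv0 : v ≠ 0 := by
        rintro rfl
        rw [hammingNorm_zero] at h1
        omega
      have hv1 : v ≠ 1 := by
        rintro rfl
        rw [hammingNorm_one_word, h.card_eq] at h2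
        omega
      by_cases h16 : hammingNorm v = 16
      · simp [h16, hv0, hv1]
      · have : annihilator (hammingNorm v) = 0 := by
          obtain ⟨m, hm⟩ := h3
          have : m = 5 ∨ m = 6 ∨ m = 7 ∨ m = 8 ∨ m = 9 ∨ m = 10 ∨ m = 11 ∨ m = 12 ∨ m = 13 ∨
            m = 14 := by omega
          rw [hm]
          rcases this with rfl | rfl | rfl | rfl | rfl | rfl | rfl | rfl | rfl | rfl <;>
            decide
        simp [this, h16, hv0, hv1]
  rw [sum_congr rfl hterm, sum_add_distrib, sum_add_distrib, ← mul_sum, sum_ite_eq', sum_ite_eq',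
    sum_boole, filter_filter]
  simp only [mem_filter, mem_univ, true_and, C.zero_mem, h.one_mem, if_true]

/-- The number of words of weight 16 vanishing at five given coordinates. -/
lemma card_weight_sixteen_zero_on (h : ExtremalSeventyTwo C) (T : Finset ι) (hT : #T = 5) :
    #{v | v ∈ C ∧ (∀ i ∈ T, v i = 0) ∧ hammingNorm v = 16} = 68211 := by
  have h1 := h.sum_annihilator T 0 hT.le
  have h2 := h.sum_annihilator_eq fun v => ∀ i ∈ T, v i = 0
  rw [h2, sum_eq_zero_on, h.card_eq, hT, if_pos (by simp), if_neg] at h1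
  · have e : restrSum 72 5 0 annihilator = 2 ^ 36 * (annihilator 16 * 68211 + annihilator 0) := by
      decide +kernel
    have e1 : annihilator 16 = 3805072588800 := by decide
    rw [e, e1] at h1
    have := mul_left_cancel₀ (by norm_num) h1
    omega
  · obtain ⟨i, hi⟩ : T.Nonempty := card_pos.1 (by omega)
    exact fun h' => absurd (h' i hi) (by simp)

/-- The number of words of weight 16 whose support contains four given coordinates. -/
lemma card_weight_sixteen_one_on (h : ExtremalSeventyTwo C) (T : Finset ι) (hT : #T = 4) :
    #{v | v ∈ C ∧ (∀ i ∈ T, v i = 1) ∧ hammingNorm v = 16} = 442 := by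
  have h1 := h.sum_annihilator T 1 (by omega)
  have h2 := h.sum_annihilator_eq fun v => ∀ i ∈ T, v i = 1
  rw [h2, sum_eq_one_on, h.card_eq, hT, if_neg, if_pos (by simp)] at h1
  · have e : restrSum 72 4 1 annihilator = 2 ^ 36 * (annihilator 16 * 442 + annihilator 72) := by
      decide +kernel
    have e1 : annihilator 16 = 3805072588800 := by decide
    rw [e, e1] at h1
    have := mul_left_cancel₀ (by norm_num) h1
    omega
  · obtain ⟨i, hi⟩ : T.Nonempty := card_pos.1 (by omega)
    exact fun h' => absurd (h' i hi) (by simp)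

end Weights

end ExtremalSeventyTwo

/-! ### Involutive automorphisms with other than 24 two-cycles -/

section Symmetries

variable {ι : Type*}

/-- The permutation of words induced by a permutation of the coordinates. -/
def permWord (σ : Equiv.Perm ι) : Equiv.Perm (ι → ZMod 2) := σ.symm.arrowCongr (Equiv.refl _)

lemma permWord_apply (σ : Equiv.Perm ι) (v : ι → ZMod 2) : permWord σ v = v ∘ σ := rfl

lemma permWord_pow (σ : Equiv.Perm ι) (n : ℕ) : permWord σ ^ n = permWord (σ ^ n) := by
  induction n with
  | zero => rfl
  | succ n ih =>
    rw [pow_succ, ih]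
    ext v
    rw [Equiv.Perm.mul_apply, permWord_apply, permWord_apply, permWord_apply, pow_succ']
    rfl

lemma comp_pow_mem {σ : Equiv.Perm ι} {C : Submodule (ZMod 2) (ι → ZMod 2)}
    (hσ : ∀ v ∈ C, v ∘ σ ∈ C) (n : ℕ) : ∀ v ∈ C, v ∘ (σ ^ n : Equiv.Perm ι) ∈ C := by
  induction n with
  | zero => exact fun w hw => hw
  | succ n ih =>
    intro w hw
    rw [pow_succ', Equiv.Perm.coe_mul, ← Function.comp_assoc]
    exact ih _ (hσ w hw)

lemma comp_mem_iff {σ : Equiv.Perm ι} [Finite ι] {C : Submodule (ZMod 2) (ι → ZMod 2)}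
    (hσ : ∀ v ∈ C, v ∘ σ ∈ C) (v : ι → ZMod 2) : v ∘ σ ∈ C ↔ v ∈ C := by
  refine ⟨fun h => ?_, hσ v⟩
  have h2 := comp_pow_mem hσ (orderOf σ - 1) _ h
  rw [Function.comp_assoc, ← Equiv.Perm.coe_mul, ← pow_succ',
    Nat.sub_add_cancel (orderOf_pos σ), pow_orderOf_eq_one] at h2
  exact h2

lemma hammingNorm_comp_perm [Fintype ι] (σ : Equiv.Perm ι) (v : ι → ZMod 2) :
    hammingNorm (v ∘ σ) = hammingNorm v := by
  rw [hammingNorm_eq_sum, hammingNorm_eq_sum]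
  exact Equiv.sum_comp σ fun i => (v i).val

end Symmetries

namespace ExtremalSeventyTwo

section Involution

open scoped Classical

variable {ι : Type*} [LinearOrder ι] [Fintype ι] {C : Submodule (ZMod 2) (ι → ZMod 2)}
  {τ : Equiv.Perm ι}

/-- The code of sums over the two-cycles is dual to that of fixed words vanishing on the fixed
points, whose weights in `C` are twice those on the two-cycles. -/
lemma dualWeightEight_map_foldWord (h : ExtremalSeventyTwo C) (hτ : ∀ i, τ (τ i) = i)
    (hinv : ∀ v ∈ C, v ∘ τ ∈ C) : DualWeightEight (C.map (foldWord τ)) where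
  le_orth := by
    rintro _ ⟨v, hv, rfl⟩
    rw [orth_map_foldWord hτ h.orth_eq, mem_pureCode, fixedWord_foldWord]
    exact C.add_mem hv (hinv v hv)
  eight_le x hx h0 := by
    rw [orth_map_foldWord hτ h.orth_eq, mem_pureCode] at hx
    have h1 := h.sixteen_le _ hx fun h' => h0 <|
      congrArg Prod.snd (fixedWord_injective hτ (h'.trans (map_zero _).symm))
    rw [hammingNorm_fixedWord, hammingNorm_zero, zero_add] at h1
    change 16 ≤ 2 * hammingNorm x at h1
    omega
  even x hx := by
    rw [orth_map_foldWord hτ h.orth_eq, mem_pureCode] at hx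
    have h1 := h.four_dvd hx
    rw [hammingNorm_fixedWord, hammingNorm_zero, zero_add] at h1
    change 4 ∣ 2 * hammingNorm x at h1
    omega

/-- The numbers of two-cycles that survive the analysis of the codes on the two-cycles. -/
lemma card_twoCycles (h : ExtremalSeventyTwo C) (hτ : ∀ i, τ (τ i) = i)
    (hinv : ∀ v ∈ C, v ∘ τ ∈ C) (h4 : 4 ∣ Fintype.card (TwoCycles τ))
    (h0 : 0 < Fintype.card (TwoCycles τ)) :
    Fintype.card (TwoCycles τ) = 24 ∨ Fintype.card (TwoCycles τ) = 32 ∨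
      Fintype.card (TwoCycles τ) = 36 := by
  have hE := h.dualWeightEight_map_foldWord hτ hinv
  have h1 := hE.sixteen_le_card (by omega)
  have h2 := hE.card_ne_sixteen
  have h3 := hE.card_ne_twenty
  have h5 := hE.card_ne_twentyEight
  have h6 := card_eq_of_involution hτ
  rw [h.card_eq] at h6
  omega

/-- If `σ^4` is an involution without fixed points, then `C` is a free module for `⟨σ⟩`, which
has order 8; but 8 does not divide the dimension 36. -/
lemma card_twoCycles_ne_thirtySix (h : ExtremalSeventyTwo C) {σ : Equiv.Perm ι}
    (hσ : ∀ v ∈ C, v ∘ σ ∈ C) (hτ : ∀ i, τ (τ i) = i) (hστ : σ ^ 4 = τ) :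
    Fintype.card (TwoCycles τ) ≠ 36 := by
  intro hc
  have hinv : ∀ v ∈ C, v ∘ τ ∈ C := hστ ▸ comp_pow_mem hσ 4
  have hKE := (h.dualWeightEight_map_foldWord hτ hinv).orth_eq_of_card_eq_thirtySix hc
  rw [orth_map_foldWord hτ h.orth_eq] at hKE
  have hF : IsEmpty (FixedPts τ) := by
    rw [← Fintype.card_eq_zero_iff]
    have := card_eq_of_involution hτ
    rw [h.card_eq] at this
    omega
  -- `N = σ - 1` satisfies `N^4 = σ^4 - 1 = τ - 1` in characteristic two
  let N : C →ₗ[ZMod 2] C :=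
    { toFun := fun v => ⟨v + (v : ι → ZMod 2) ∘ σ, C.add_mem v.2 (hσ _ v.2)⟩
      map_add' := fun v w => by
        ext i
        simp only [Submodule.coe_add, Pi.add_apply, Function.comp_apply]
        ring
      map_smul' := fun a v => by
        ext i
        simp }
  have hN4 : ∀ v : C, ((N ^ 4) v : ι → ZMod 2) = v + (v : ι → ZMod 2) ∘ τ := by
    intro v
    have h2 : (2 : ZMod 2) = 0 := rfl
    funext i
    simp only [← hστ, pow_succ, pow_zero, one_mul, Module.End.mul_apply, N, LinearMap.coe_mk,
      AddHom.coe_mk, Pi.add_apply, Function.comp_apply, Equiv.Perm.mul_apply]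
    linear_combination (2 * (v : ι → ZMod 2) (σ i) + 3 * (v : ι → ZMod 2) (σ (σ i))
      + 2 * (v : ι → ZMod 2) (σ (σ (σ i)))) * h2
  have h8 := eight_dvd_finrank N fun x => by
    constructor
    · intro hx
      have h1 : (x : ι → ZMod 2) ∘ τ = x := by
        have h2 := hN4 x
        rw [hx] at h2
        exact (eq_of_add_eq_zero_word h2.symm).symm
      have h2 := eq_fixedWord hτ h1
      rw [Subsingleton.elim (fun i : FixedPts τ => (x : ι → ZMod 2) i) 0] at h2
      have h3 : (fun t : TwoCycles τ => (x : ι → ZMod 2) t) ∈ pureCode τ hτ C := by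
        rw [mem_pureCode, ← h2]
        exact x.2
      rw [hKE] at h3
      obtain ⟨v, hv, hvx⟩ := h3
      refine ⟨⟨v, hv⟩, Subtype.ext ?_⟩
      rw [hN4, h2, ← fixedWord_foldWord hτ, hvx]
    · rintro ⟨y, rfl⟩
      apply Subtype.ext
      rw [hN4, hN4]
      funext i
      simp only [Pi.add_apply, Function.comp_apply, hτ, Submodule.coe_zero, Pi.zero_apply]
      rw [add_comm _ ((y : ι → ZMod 2) i), CharTwo.add_self_eq_zero]
  have h36 : Module.finrank (ZMod 2) C = 36 := by
    have := h.codeCard_eq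
    rw [codeCard_eq_two_pow] at this
    exact Nat.pow_right_injective (le_refl 2) this
  omega

lemma fixedPart_le_orth (h : ExtremalSeventyTwo C) (hτ : ∀ i, τ (τ i) = i) :
    fixedPart τ hτ C ≤ orth (fixedPart τ hτ C) := by
  intro q hq q' hq'
  obtain ⟨x, hx⟩ := mem_fixedPart.1 hq
  obtain ⟨x', hx'⟩ := mem_fixedPart.1 hq'
  have h1 := fixedWord_dotProduct_fixedWord hτ (q, x) (q', x')
  rw [← h1]
  rw [← h.orth_eq] at hx
  exact hx _ hx'

end Involution

end ExtremalSeventyTwo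

/-- In a self-orthogonal code of length greater than 4 there are three coordinates that do not
contain the support of a nonzero word, since the words of weight two have disjoint supports. -/
lemma exists_three_free_coordinates {κ : Type*} [Fintype κ] [DecidableEq κ]
    {Q : Submodule (ZMod 2) (κ → ZMod 2)} (hQ : Q ≤ orth Q) (hκ : 4 < Fintype.card κ) :
    ∃ B : Finset κ, #B = 3 ∧ ∀ q ∈ Q, (∀ i ∉ B, q i = 0) → q = 0 := by
  classical
  set R : κ → Finset κ := fun a => univ.filter fun b => b ≠ a ∧ Pi.single a 1 + Pi.single b 1 ∈ Q
    with hR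
  have hR1 : ∀ a, #(R a) ≤ 1 := by
    intro a
    rw [card_le_one]
    intro b hb b' hb'
    simp only [hR, mem_filter, mem_univ, true_and] at hb hb'
    by_contra hne
    have := hQ hb.2 _ hb'.2
    simp [hb.1, hb'.1, hne] at this
  obtain ⟨a⟩ : Nonempty κ := Fintype.card_pos_iff.1 (by omega)
  obtain ⟨b, -, hb⟩ := exists_mem_notMem_of_card_lt_card (s := insert a (R a)) (t := univ)
    ((card_insert_le _ _).trans_lt (by rw [card_univ]; have := hR1 a; omega))
  obtain ⟨c, -, hc⟩ := exists_mem_notMem_of_card_lt_card (s := insert a (insert b (R a ∪ R b)))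
    (t := univ) ((card_insert_le _ _).trans_lt (by
      have h1 := card_insert_le b (R a ∪ R b)
      have h2 := card_union_le (R a) (R b)
      have h3 := hR1 a
      have h4 := hR1 b
      rw [card_univ]
      omega))
  simp only [mem_insert, mem_union, not_or, hR, mem_filter, mem_univ, true_and, not_and] at hb hc
  obtain ⟨hba, hb⟩ := hb
  obtain ⟨hca, hcb, hc1, hc2⟩ := hc
  refine ⟨{a, b, c}, card_eq_three.2 ⟨a, b, c, Ne.symm hba, Ne.symm hca, Ne.symm hcb, rfl⟩, ?_⟩
  intro q hq hzero
  have hq0 : q = Pi.single a (q a) + Pi.single b (q b) + Pi.single c (q c) := by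
    funext i
    by_cases ha : i = a
    · subst ha
      simp [Ne.symm hba, Ne.symm hca]
    by_cases hb : i = b
    · subst hb
      simp [hba, Ne.symm hcb]
    by_cases hc : i = c
    · subst hc
      simp [hca, hcb]
    simp only [Pi.add_apply, Pi.single_apply, if_neg ha, if_neg hb, if_neg hc, add_zero]
    exact hzero i (by simp [ha, hb, hc])
  have hqq := hQ hq q hq
  rw [hq0] at hqq hq ⊢
  rcases zmod_two_cases (q a) with h1 | h1 <;> rcases zmod_two_cases (q b) with h2 | h2 <;>
    rcases zmod_two_cases (q c) with h3 | h3 <;> rw [h1, h2, h3] at hqq hq ⊢ <;>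
    simp [hba, hca, hcb, Ne.symm hba, Ne.symm hca,
      Ne.symm hcb] at hqq hq ⊢
  · exact absurd hq (hc2 hcb)
  · exact absurd hq (hc1 hca)
  · exact absurd hq (hb hba)
  · exact absurd hqq (by decide)

namespace ExtremalSeventyTwo

section EightFixedPoints

open scoped Classical

variable {ι : Type*} [LinearOrder ι] [Fintype ι] {C : Submodule (ZMod 2) (ι → ZMod 2)}
  {τ : Equiv.Perm ι}

/-- If an involution has eight fixed points, choose five of them outside of which no fixed word
has a nonzero part. The number of words of weight 16 that vanish there is odd, but the fixed ones
among them are even in number. -/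
lemma card_twoCycles_ne_thirtyTwo (h : ExtremalSeventyTwo C) (hτ : ∀ i, τ (τ i) = i)
    (hinv : ∀ v ∈ C, v ∘ τ ∈ C) : Fintype.card (TwoCycles τ) ≠ 32 := by
  intro hc
  have hF : Fintype.card (FixedPts τ) = 8 := by
    have := card_eq_of_involution hτ
    rw [h.card_eq] at this
    omega
  obtain ⟨B, hB, hBQ⟩ := exists_three_free_coordinates (h.fixedPart_le_orth hτ) (by omega)
  set T : Finset ι := Bᶜ.map (Function.Embedding.subtype _) with hT
  have hTcard : #T = 5 := by
    rw [hT, card_map, card_compl, hF, hB]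
  have hTmem : ∀ v : ι → ZMod 2, (∀ i ∈ T, v i = 0) ↔ ∀ i : FixedPts τ, i ∉ B → v i = 0 := by
    intro v
    simp only [hT, mem_map, mem_compl, Function.Embedding.subtype_apply]
    exact ⟨fun hv i hi => hv i ⟨i, hi, rfl⟩, by rintro hv _ ⟨i, hi, rfl⟩; exact hv i hi⟩
  set X : Finset (ι → ZMod 2) :=
    univ.filter fun v => v ∈ C ∧ (∀ i ∈ T, v i = 0) ∧ hammingNorm v = 16 with hX
  have hXcard : #X = 68211 := h.card_weight_sixteen_zero_on T hTcard
  have hτ2 : τ ^ 2 = 1 := by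
    ext i
    rw [pow_two, Equiv.Perm.mul_apply, hτ, Equiv.Perm.one_apply]
  have hmod := card_modEq_card_fixed X (permWord τ) 0 (fun v => by
    simp only [hX, mem_filter, mem_univ, true_and, permWord_apply, hammingNorm_comp_perm,
      comp_mem_iff hinv, hTmem, Function.comp_apply]
    have : ∀ i : FixedPts τ, τ (i : ι) = i := fun i => i.2
    simp only [this]) (by
    rw [permWord_pow, zero_add, pow_one, hτ2]
    rfl)
  have hfix : X.filter (fun v => (permWord τ ^ 2 ^ 0) v = v)
      = (univ.filter fun x : TwoCycles τ → ZMod 2 =>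
        x ∈ orth (C.map (foldWord τ)) ∧ hammingNorm x = 8).image
        fun x => fixedWord τ hτ (0, x) := by
    ext v
    simp only [hX, mem_filter, mem_univ, true_and, mem_image, pow_zero, pow_one, permWord_apply,
      orth_map_foldWord hτ h.orth_eq, mem_pureCode]
    constructor
    · rintro ⟨⟨hv, hv0, hv16⟩, hvτ⟩
      have h1 := eq_fixedWord hτ hvτ
      have h2 : (fun i : FixedPts τ => v i) = 0 :=
        hBQ _ (mem_fixedPart.2 ⟨_, h1 ▸ hv⟩) ((hTmem v).1 hv0)
      rw [h2] at h1
      refine ⟨fun t => v t, ⟨h1 ▸ hv, ?_⟩, h1.symm⟩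
      have h3 := hv16
      rw [h1, hammingNorm_fixedWord, hammingNorm_zero, zero_add] at h3
      change 2 * hammingNorm (fun t : TwoCycles τ => v t) = 16 at h3
      omega
    · rintro ⟨x, ⟨hx, hx8⟩, rfl⟩
      refine ⟨⟨hx, (hTmem _).2 fun i _ => by rw [fixedWord_fixed]; rfl, ?_⟩, fixedWord_comp hτ _⟩
      rw [hammingNorm_fixedWord, hammingNorm_zero, hx8]
  rw [hXcard, hfix, card_image_of_injective] at hmod
  · obtain ⟨m, hm⟩ := (h.dualWeightEight_map_foldWord hτ hinv).even_card_weight_eight hc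
    rw [hm] at hmod
    have : 68211 % 2 = (m + m) % 2 := hmod
    omega
  · intro x y hxy
    exact congrArg Prod.snd (fixedWord_injective hτ hxy)

end EightFixedPoints

end ExtremalSeventyTwo

/-! ### Self-dual codes of length 24 and minimum weight 8 -/

lemma card_le_hammingNorm_mul {ι : Type*} [Fintype ι] {x z : ι → ZMod 2} {T : Finset ι}
    (hx : ∀ i ∈ T, x i = 1) (hz : ∀ i ∈ T, z i = 1) : #T ≤ hammingNorm (x * z) := by
  rw [hammingNorm]
  refine card_le_card fun i hi => ?_
  simp [hx i hi, hz i hi]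

namespace DualWeightEight

section Golay

open scoped Classical

variable {ι : Type*} [Fintype ι] [DecidableEq ι] {E : Submodule (ZMod 2) (ι → ZMod 2)}

/-- The design property of the words of weight 8: the quadratic with roots 12 and 16, restricted to
words containing at most five given coordinates, has degree at most 7, and only the words of
weight 8 and 24 contribute to its sum over the code. -/
lemma sum_code_ite_one_on (h : DualWeightEight E) (hn : Fintype.card ι = 24) (T : Finset ι)
    (hT0 : T.Nonempty) (hT5 : #T ≤ 5) :
    2 ^ 12 * (32 * (#{x | x ∈ E ∧ (∀ i ∈ T, x i = 1) ∧ hammingNorm x = 8} : ℤ) + 96)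
      = restrSum 24 #T 1 fun w => (w - 12) * (w - 16) := by
  obtain ⟨hcard, horth, hwt⟩ := h.of_card_eq_twentyFour hn
  set g : ℤ → ℤ := fun w => ([12, 16].map fun a => w - a).prod with hg
  have hg' : g = fun w => (w - 12) * (w - 16) := by
    funext w
    simp [hg]
  have h1 := sum_orth_of_degLE (E := E) (r := 7)
    (fun z hz h0 => h.eight_le z (h.le_orth hz) h0)
    (((degLE_prod_weight_sub (ι := ι) [12, 16]).ite_forall_eq T 1).mono (by simp; omega))
  have h2 := sum_eq_one_on T g
  rw [horth, hcard] at h1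
  rw [← hg', ← hn, ← h2, ← h1]
  push_cast
  congr 1
  have h01 : ¬ ∀ i ∈ T, (0 : ι → ZMod 2) i = 1 := by
    obtain ⟨i, hi⟩ := hT0
    exact fun h' => absurd (h' i hi) (by simp)
  have hterm : ∀ x ∈ univ.filter (· ∈ E),
      (if ∀ i ∈ T, x i = 1 then g (hammingNorm x) else 0)
      = 32 * (if (∀ i ∈ T, x i = 1) ∧ hammingNorm x = 8 then 1 else 0)
        + (if x = 1 then 96 else 0) := by
    intro x hx
    simp only [mem_filter, mem_univ, true_and] at hx
    by_cases hx1 : x = 1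
    · subst hx1
      simp [hammingNorm_one_word, hn, hg]
    · have h24 : hammingNorm x ≠ 24 := by
        intro h'
        rcases h.eq_one_or_hammingNorm_add_le (h.le_orth hx) with h'' | h''
        · exact hx1 h''
        · omega
      by_cases hT : ∀ i ∈ T, x i = 1
      · rcases hwt x hx with h' | h' | h' | h' | h'
        · exact absurd hT (by rwa [hammingNorm_eq_zero.1 h'])
        · simp [h', hx1, hg]
        · simp [h', hx1, hg]
        · simp [h', hx1, hg]
        · exact absurd h' h24
      · simp [hT, hx1]
  have h3 := sum_congr rfl hterm
  rw [sum_add_distrib, ← mul_sum, sum_boole, filter_filter, sum_ite_eq'] at h3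
  simp only [mem_filter, mem_univ, true_and, h.one_mem, if_true] at h3
  exact h3.symm

lemma card_weight_eight_four (h : DualWeightEight E) (hn : Fintype.card ι = 24) {T : Finset ι}
    (hT : #T = 4) : #{x | x ∈ E ∧ (∀ i ∈ T, x i = 1) ∧ hammingNorm x = 8} = 5 := by
  have h1 := h.sum_code_ite_one_on hn T (card_pos.1 (by omega)) (by omega)
  rw [hT] at h1
  have e : (restrSum 24 4 1 fun w => (w - 12) * (w - 16)) = 2 ^ 12 * (32 * 5 + 96) := by
    decide +kernel
  rw [e] at h1
  have := mul_left_cancel₀ (by norm_num) h1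
  omega

lemma exists_weight_eight_of_five (h : DualWeightEight E) (hn : Fintype.card ι = 24) {T : Finset ι}
    (hT : #T = 5) : ∃ x ∈ E, (∀ i ∈ T, x i = 1) ∧ hammingNorm x = 8 := by
  have h1 := h.sum_code_ite_one_on hn T (card_pos.1 (by omega)) (by omega)
  rw [hT] at h1
  have e : (restrSum 24 5 1 fun w => (w - 12) * (w - 16)) = 2 ^ 12 * (32 * 1 + 96) := by
    decide +kernel
  rw [e] at h1
  have h2 := mul_left_cancel₀ (by norm_num) h1
  have h3 : 0 < #{x | x ∈ E ∧ (∀ i ∈ T, x i = 1) ∧ hammingNorm x = 8} := by omega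
  obtain ⟨x, hx⟩ := card_pos.1 h3
  exact ⟨x, by simpa using hx⟩

/-- The covering radius is at most 4: a word of larger weight can be shortened by a codeword of
weight 8 containing five of its points. -/
lemma exists_add_hammingNorm_le_four (h : DualWeightEight E) (hn : Fintype.card ι = 24)
    (x : ι → ZMod 2) : ∃ z ∈ E, hammingNorm (x + z) ≤ 4 := by
  induction hw : hammingNorm x using Nat.strong_induction_on generalizing x with
  | _ n ih =>
    by_cases h4 : n ≤ 4
    · exact ⟨0, E.zero_mem, by rw [add_zero, hw]; exact h4⟩
    · obtain ⟨T, hTsub, hT⟩ := exists_subset_card_eq (s := univ.filter fun i => x i ≠ 0) (n := 5)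
        (by change 5 ≤ hammingNorm x; omega)
      obtain ⟨z, hz, hzT, hz8⟩ := h.exists_weight_eight_of_five hn hT
      have hxT : ∀ i ∈ T, x i = 1 := by
        intro i hi
        have := (mem_filter.1 (hTsub hi)).2
        exact (zmod_two_cases (x i)).resolve_left this
      have h1 := card_le_hammingNorm_mul hxT hzT
      have h2 := hammingNorm_add_add x z
      obtain ⟨z', hz', hle⟩ := ih (hammingNorm (x + z)) (by omega) (x + z) rfl
      exact ⟨z + z', E.add_mem hz hz', by rwa [← add_assoc]⟩

/-- A coset containing a word of weight 4 contains six such words: their supports form a partition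
of the 24 coordinates. -/
lemma card_weight_four_coset (h : DualWeightEight E) (hn : Fintype.card ι = 24)
    {x : ι → ZMod 2} (hx : hammingNorm x = 4) : #{y | y + x ∈ E ∧ hammingNorm y = 4} = 6 := by
  set Y := univ.filter fun y : ι → ZMod 2 => y + x ∈ E ∧ hammingNorm y = 4 with hY
  have hmem : ∀ y, y ∈ Y ↔ y + x ∈ E ∧ hammingNorm y = 4 := by simp [hY]
  have hdiff : ∀ y ∈ Y, ∀ y' ∈ Y, y + y' ∈ E := by
    intro y hy y' hy'
    have := E.add_mem ((hmem y).1 hy).1 ((hmem y').1 hy').1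
    rwa [show y + x + (y' + x) = y + y' + x + x by abel, add_add_cancel_word] at this
  have hone : ∀ i, #(Y.filter fun y => y i = 1) = 1 := by
    intro i
    rw [card_eq_one]
    have hex : ∃ y ∈ Y, y i = 1 := by
      rcases zmod_two_cases (x i) with hi | hi
      · set T := insert i (univ.filter fun j => x j ≠ 0) with hT
        have hTc : #T = 5 := by
          rw [hT, card_insert_of_notMem (by simp [hi])]
          change hammingNorm x + 1 = 5
          omega
        obtain ⟨z, hz, hzT, hz8⟩ := h.exists_weight_eight_of_five hn hTc
        refine ⟨z + x, (hmem _).2 ⟨by rwa [add_add_cancel_word], ?_⟩, ?_⟩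
        · have h1 := hammingNorm_add_add z x
          have h2 : z * x = x := by
            funext j
            rcases zmod_two_cases (x j) with hj | hj
            · simp [hj]
            · rw [Pi.mul_apply, hzT j (by simp [hT, hj]), one_mul]
          rw [h2] at h1
          omega
        · rw [Pi.add_apply, hi, add_zero]
          exact hzT i (mem_insert_self _ _)
      · exact ⟨x, (hmem x).2 ⟨by rw [add_self_word]; exact E.zero_mem, hx⟩, hi⟩
    obtain ⟨y, hy, hyi⟩ := hex
    refine ⟨y, ?_⟩
    ext y'
    simp only [mem_filter, mem_singleton]
    constructor
    · rintro ⟨hy', hyi'⟩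
      by_contra hne
      have h1 := hdiff y' hy' y hy
      have h2 := h.eight_le _ (h.le_orth h1) fun h0 => hne <|
        eq_of_add_eq_zero_word h0
      have h3 := hammingNorm_add_add y' y
      have h4 := card_le_hammingNorm_mul (T := {i}) (x := y') (z := y) (by simpa using hyi')
        (by simpa using hyi)
      have h5 := ((hmem y').1 hy').2
      have h6 := ((hmem y).1 hy).2
      rw [card_singleton] at h4
      omega
    · rintro rfl
      exact ⟨hy, hyi⟩
  have h1 : ∑ y ∈ Y, hammingNorm y = ∑ i : ι, #(Y.filter fun y => y i = 1) := by
    simp only [card_filter]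
    rw [sum_comm]
    refine sum_congr rfl fun y _ => ?_
    rw [hammingNorm_eq_sum]
    refine sum_congr rfl fun i _ => ?_
    rcases zmod_two_cases (y i) with hi | hi <;> rw [hi] <;> decide
  rw [sum_congr rfl fun y hy => ((hmem y).1 hy).2, sum_congr rfl fun i _ => hone i, sum_const,
    sum_const, card_univ, hn, smul_eq_mul, smul_eq_mul] at h1
  omega

end Golay

end DualWeightEight

/-! ### Dimension counts -/

section Dimension

/-- Dimension formula for a subspace `D` and an exact pair of linear maps. -/
lemma finrank_map_add_finrank_comap {k A B V : Type*} [Field k] [AddCommGroup A] [Module k A]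
    [AddCommGroup B] [Module k B] [AddCommGroup V] [Module k V] [FiniteDimensional k V]
    (D : Submodule k V) (f : V →ₗ[k] A) (g : B →ₗ[k] V) (hg : Function.Injective g)
    (hfg : LinearMap.range g = LinearMap.ker f) :
    Module.finrank k (D.map f) + Module.finrank k (D.comap g) = Module.finrank k D := by
  have h1 := (f.domRestrict D).finrank_range_add_finrank_ker
  rw [LinearMap.range_domRestrict] at h1
  rw [← h1]
  congr 1
  rw [(Submodule.equivMapOfInjective g hg (D.comap g)).finrank_eq, Submodule.map_comap_eq, hfg,
    LinearMap.ker_domRestrict, ← Submodule.finrank_map_subtype_eq D, Submodule.map_comap_subtype,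
    inf_comm]

open scoped Classical in
lemma eq_zero_or_one_of_codeCard {κ : Type*} [Fintype κ] [DecidableEq κ] [Nonempty κ]
    {L : Submodule (ZMod 2) (κ → ZMod 2)} (hL : codeCard L = 2) (h1 : (1 : κ → ZMod 2) ∈ L)
    {q : κ → ZMod 2} (hq : q ∈ L) : q = 0 ∨ q = 1 := by
  have h01 : (0 : κ → ZMod 2) ≠ 1 := by
    intro h
    obtain ⟨i⟩ := ‹Nonempty κ›
    simpa using congrFun h i
  have h2 : ({0, 1} : Finset (κ → ZMod 2)) = univ.filter (· ∈ L) := by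
    apply eq_of_subset_of_card_le
    · intro x hx
      simp only [mem_insert, mem_singleton] at hx
      rcases hx with rfl | rfl <;> simp [h1]
    · rw [card_pair h01]
      exact hL.le
  have h3 : q ∈ univ.filter (· ∈ L) := by simpa using hq
  rw [← h2] at h3
  simpa using h3

end Dimension

/-! ### Automorphisms commuting with an involution -/

section InducedPermutations

lemma inv_commute {ι : Type*} {τ σ : Equiv.Perm ι} (hσ : ∀ i, σ (τ i) = τ (σ i)) (i : ι) :
    σ⁻¹ (τ i) = τ (σ⁻¹ i) := by
  rw [Equiv.Perm.inv_eq_iff_eq, hσ]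
  exact congrArg τ (σ.apply_symm_apply i).symm

lemma pow_commute {ι : Type*} {τ σ : Equiv.Perm ι} (hσ : ∀ i, σ (τ i) = τ (σ i)) (n : ℕ) (i : ι) :
    (σ ^ n) (τ i) = τ ((σ ^ n) i) := by
  induction n with
  | zero => rfl
  | succ n ih => rw [pow_succ', Equiv.Perm.mul_apply, ih, hσ, Equiv.Perm.mul_apply]

/-- The permutation of the fixed points of `τ` induced by a permutation commuting with `τ`. -/
def fixedPerm {ι : Type*} {τ : Equiv.Perm ι} (σ : Equiv.Perm ι)
    (hσ : ∀ i, σ (τ i) = τ (σ i)) : Equiv.Perm (FixedPts τ) :=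
  σ.subtypePerm fun i => by rw [← hσ, σ.injective.eq_iff]

lemma fixedPerm_pow_four {ι : Type*} {τ σ : Equiv.Perm ι}
    (hσ : ∀ i, σ (τ i) = τ (σ i)) (hστ : σ ^ 4 = τ) :
    fixedPerm σ hσ ^ 4 = 1 := by
  ext i
  have h1 : (σ ^ 4) (i : ι) = i := by
    rw [hστ]
    exact i.2
  exact h1

variable {ι : Type*} [LinearOrder ι] {τ : Equiv.Perm ι}

/-- The chosen representative of the two-cycle of a moved point. -/
def cycleRep (hτ : ∀ i, τ (τ i) = i) (i : ι) (hi : τ i ≠ i) : TwoCycles τ :=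
  if h : i < τ i then ⟨i, h⟩ else ⟨τ i, by rw [hτ]; exact lt_of_le_of_ne (not_lt.1 h) hi⟩

lemma cycleRep_eq (hτ : ∀ i, τ (τ i) = i) (i : ι) (hi : τ i ≠ i) :
    (cycleRep hτ i hi : ι) = i ∨ (cycleRep hτ i hi : ι) = τ i := by
  unfold cycleRep
  split_ifs with h
  · exact Or.inl rfl
  · exact Or.inr rfl

lemma twoCycles_eq (hτ : ∀ i, τ (τ i) = i) {s t : TwoCycles τ} (h : (s : ι) = t ∨ (s : ι) = τ t) :
    s = t := by
  rcases h with h | h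
  · exact Subtype.ext h
  · have h1 := s.2
    rw [h, hτ] at h1
    exact absurd t.2 h1.not_gt

lemma moved_of_commute {σ : Equiv.Perm ι} (hσ : ∀ i, σ (τ i) = τ (σ i)) (t : TwoCycles τ) :
    τ (σ t) ≠ σ t := by
  rw [← hσ, Ne, σ.injective.eq_iff]
  exact t.2.ne'

/-- The map on two-cycles induced by a permutation commuting with `τ`. -/
def cycleMap (hτ : ∀ i, τ (τ i) = i) (σ : Equiv.Perm ι) (hσ : ∀ i, σ (τ i) = τ (σ i))
    (t : TwoCycles τ) : TwoCycles τ := cycleRep hτ (σ t) (moved_of_commute hσ t)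

lemma cycleMap_eq (hτ : ∀ i, τ (τ i) = i) (σ : Equiv.Perm ι) (hσ : ∀ i, σ (τ i) = τ (σ i))
    (t : TwoCycles τ) :
    (cycleMap hτ σ hσ t : ι) = σ t ∨ (cycleMap hτ σ hσ t : ι) = τ (σ t) :=
  cycleRep_eq hτ _ _

/-- The induced maps on two-cycles compose like the permutations. -/
lemma cycleMap_cycleMap (hτ : ∀ i, τ (τ i) = i) {σ ρ π : Equiv.Perm ι}
    (hσ : ∀ i, σ (τ i) = τ (σ i)) (hρ : ∀ i, ρ (τ i) = τ (ρ i)) (hπ : ∀ i, π (τ i) = τ (π i))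
    (hmul : σ * ρ = π) (t : TwoCycles τ) :
    cycleMap hτ σ hσ (cycleMap hτ ρ hρ t) = cycleMap hτ π hπ t := by
  subst hmul
  apply twoCycles_eq hτ
  rcases cycleMap_eq hτ _ hπ t with h1 | h1 <;>
    rcases cycleMap_eq hτ _ hρ t with h2 | h2 <;>
    rcases cycleMap_eq hτ _ hσ (cycleMap hτ ρ hρ t) with h3 | h3 <;>
    rw [h1, h3, h2] <;> simp [hσ, hτ]

lemma cycleMap_one (hτ : ∀ i, τ (τ i) = i) (t : TwoCycles τ) :
    cycleMap hτ 1 (fun _ => rfl) t = t :=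
  twoCycles_eq hτ (cycleMap_eq hτ 1 (fun _ => rfl) t)

/-- The permutation of the two-cycles induced by a permutation commuting with `τ`. -/
def cyclePerm (hτ : ∀ i, τ (τ i) = i) (σ : Equiv.Perm ι) (hσ : ∀ i, σ (τ i) = τ (σ i)) :
    Equiv.Perm (TwoCycles τ) where
  toFun := cycleMap hτ σ hσ
  invFun := cycleMap hτ σ⁻¹ (inv_commute hσ)
  left_inv t := by
    rw [cycleMap_cycleMap hτ _ _ (π := 1) (fun _ => rfl) (inv_mul_cancel σ), cycleMap_one]
  right_inv t := by
    rw [cycleMap_cycleMap hτ _ _ (π := 1) (fun _ => rfl) (mul_inv_cancel σ), cycleMap_one]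

lemma cyclePerm_pow (hτ : ∀ i, τ (τ i) = i) {σ : Equiv.Perm ι} (hσ : ∀ i, σ (τ i) = τ (σ i))
    (n : ℕ) (t : TwoCycles τ) :
    ((cyclePerm hτ σ hσ) ^ n) t = cycleMap hτ (σ ^ n) (pow_commute hσ n) t := by
  induction n with
  | zero => exact (cycleMap_one hτ t).symm
  | succ n ih =>
    rw [pow_succ', Equiv.Perm.mul_apply, ih]
    exact cycleMap_cycleMap hτ hσ _ _ (pow_succ' σ n).symm t

lemma cyclePerm_pow_four (hτ : ∀ i, τ (τ i) = i) {σ : Equiv.Perm ι}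
    (hσ : ∀ i, σ (τ i) = τ (σ i)) (hστ : σ ^ 4 = τ) : (cyclePerm hτ σ hσ) ^ 4 = 1 := by
  ext t
  rw [cyclePerm_pow, Equiv.Perm.one_apply]
  congr 1
  apply twoCycles_eq hτ
  have := cycleMap_eq hτ _ (pow_commute hσ 4) t
  simp only [hστ, hτ] at this ⊢
  exact this.symm

/-- If `σ^4 = τ`, then the permutation induced on the two-cycles of `τ` has only cycles of
length 4. -/
lemma cyclePerm_sq_ne (hτ : ∀ i, τ (τ i) = i) {σ : Equiv.Perm ι}
    (hσ : ∀ i, σ (τ i) = τ (σ i)) (hστ : σ ^ 4 = τ) (t : TwoCycles τ) :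
    ((cyclePerm hτ σ hσ) ^ 2) t ≠ t := by
  intro h
  rw [cyclePerm_pow] at h
  have h4 : ∀ i, (σ ^ 2) ((σ ^ 2) i) = τ i := fun i => by
    rw [← hστ, ← Equiv.Perm.mul_apply, ← pow_add]
  have hmoved := t.2.ne'
  rcases cycleMap_eq hτ _ (pow_commute hσ 2) t with h1 | h1
  · rw [h] at h1
    apply hmoved
    rw [← h4, ← h1, ← h1]
  · rw [h] at h1
    have h2 : (σ ^ 2) (t : ι) = τ t := by rw [h1, hτ, ← h1]
    apply hmoved
    have h3 := h4 t
    rw [h2, pow_commute hσ 2, h2, hτ] at h3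
    exact h3.symm

lemma fixedWord_comp_perm (hτ : ∀ i, τ (τ i) = i) {σ : Equiv.Perm ι}
    (hσ : ∀ i, σ (τ i) = τ (σ i)) (q : FixedPts τ → ZMod 2) (x : TwoCycles τ → ZMod 2) :
    fixedWord τ hτ (q, x) ∘ σ = fixedWord τ hτ (q ∘ fixedPerm σ hσ, x ∘ cyclePerm hτ σ hσ) := by
  have hfix := fixedWord_comp hτ (q, x)
  have h1 : (fixedWord τ hτ (q, x) ∘ σ) ∘ τ = fixedWord τ hτ (q, x) ∘ σ := by
    funext i
    have := congrFun hfix (σ i)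
    simp only [Function.comp_apply] at this ⊢
    rw [hσ, this]
  rw [eq_fixedWord hτ h1]
  congr 2
  · funext i
    exact fixedWord_fixed hτ (q, x) (fixedPerm σ hσ i)
  · funext t
    have h2 : _ = x _ := fixedWord_left hτ (q, x) (cycleMap hτ σ hσ t)
    change _ = x (cycleMap hτ σ hσ t)
    rw [Function.comp_apply, ← h2]
    rcases cycleMap_eq hτ σ hσ t with h3 | h3
    · rw [h3]
    · rw [h3]
      exact (congrFun hfix (σ t)).symm

end InducedPermutations

/-! ### Involutive automorphisms with 24 two-cycles -/

section Pairs

variable {κ : Type*}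

lemma hammingNorm_single_add_single [Fintype κ] [DecidableEq κ] {s t : κ} (hst : s ≠ t) :
    hammingNorm (Pi.single s 1 + Pi.single t 1 : κ → ZMod 2) = 2 := by
  refine Eq.trans ?_ (card_pair hst)
  rw [hammingNorm]
  congr 1
  ext i
  simp only [mem_filter, mem_univ, true_and, mem_insert, mem_singleton, Pi.add_apply,
    Pi.single_apply]
  by_cases h1 : i = s <;> by_cases h2 : i = t <;> simp_all

lemma single_add_single_eq_iff [DecidableEq κ] {s t a b : κ} (hst : s ≠ t) :
    (Pi.single s 1 + Pi.single t 1 : κ → ZMod 2) = Pi.single a 1 + Pi.single b 1 ↔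
      s = a ∧ t = b ∨ s = b ∧ t = a := by
  constructor
  · intro h
    have hs := congrFun h s
    have ht := congrFun h t
    simp only [Pi.add_apply, Pi.single_apply, if_pos, if_neg hst, if_neg hst.symm] at hs ht
    by_cases h1 : s = a <;> by_cases h2 : s = b <;> by_cases h3 : t = a <;>
      by_cases h4 : t = b <;> simp_all
  · rintro (⟨rfl, rfl⟩ | ⟨rfl, rfl⟩)
    · rfl
    · exact add_comm _ _

lemma exists_eq_single_add_single [Fintype κ] [DecidableEq κ] {x : κ → ZMod 2}
    (hx : hammingNorm x = 2) :
    ∃ s t, s ≠ t ∧ x = Pi.single s 1 + Pi.single t 1 := by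
  obtain ⟨s, t, hst, h⟩ := card_eq_two.1 hx
  refine ⟨s, t, hst, ?_⟩
  funext i
  have hi := Finset.ext_iff.1 h i
  simp only [mem_filter, mem_univ, true_and, mem_insert, mem_singleton] at hi
  rcases zmod_two_cases (x i) with h0 | h1
  · simp only [h0, ne_eq, not_true, false_iff, not_or] at hi
    simp [h0, hi.1, hi.2]
  · simp only [h1, ne_eq, one_ne_zero, not_false_iff, true_iff] at hi
    rcases hi with rfl | rfl
    · simp [h1, hst]
    · simp [h1, hst.symm]

/-- For four pairwise orthogonal sign vectors of length 24 whose product sums to zero, the number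
of pairs of coordinates at which the four sign changes agree. -/
lemma card_pairs_eq_seventyTwo [Fintype κ] {u v w z : κ → ℤ} (hκ : Fintype.card κ = 24)
    (hu : ∀ t, u t = 1 ∨ u t = -1) (hv : ∀ t, v t = 1 ∨ v t = -1)
    (hw : ∀ t, w t = 1 ∨ w t = -1) (hz : ∀ t, z t = 1 ∨ z t = -1)
    (huv : ∑ t, u t * v t = 0) (huw : ∑ t, u t * w t = 0) (huz : ∑ t, u t * z t = 0)
    (hvw : ∑ t, v t * w t = 0) (hvz : ∑ t, v t * z t = 0) (hwz : ∑ t, w t * z t = 0)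
    (h4 : ∑ t, u t * v t * w t * z t = 0) :
    #{p : κ × κ | u p.1 * u p.2 = v p.1 * v p.2 ∧ u p.1 * u p.2 = w p.1 * w p.2 ∧
      u p.1 * u p.2 = z p.1 * z p.2} = 72 := by
  have hterm : ∀ p : κ × κ, (8 : ℤ) * (if u p.1 * u p.2 = v p.1 * v p.2 ∧
      u p.1 * u p.2 = w p.1 * w p.2 ∧ u p.1 * u p.2 = z p.1 * z p.2 then 1 else 0)
      = 1 + (u p.1 * v p.1) * (u p.2 * v p.2) + (u p.1 * w p.1) * (u p.2 * w p.2)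
        + (u p.1 * z p.1) * (u p.2 * z p.2) + (v p.1 * w p.1) * (v p.2 * w p.2)
        + (v p.1 * z p.1) * (v p.2 * z p.2) + (w p.1 * z p.1) * (w p.2 * z p.2)
        + (u p.1 * v p.1 * w p.1 * z p.1) * (u p.2 * v p.2 * w p.2 * z p.2) := by
    have hprod : ∀ {f : κ → ℤ}, (∀ t, f t = 1 ∨ f t = -1) → ∀ s t, f s * f t = 1 ∨
        f s * f t = -1 := by
      intro f hf s t
      rcases hf s with h1 | h1 <;> rcases hf t with h2 | h2 <;> simp [h1, h2]
    intro p
    have key : ∀ a b c d : ℤ, (a = 1 ∨ a = -1) → (b = 1 ∨ b = -1) → (c = 1 ∨ c = -1) →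
        (d = 1 ∨ d = -1) → (8 : ℤ) * (if a = b ∧ a = c ∧ a = d then 1 else 0)
        = 1 + a * b + a * c + a * d + b * c + b * d + c * d + a * b * c * d := by
      rintro a b c d (rfl | rfl) (rfl | rfl) (rfl | rfl) (rfl | rfl) <;> norm_num
    rw [key _ _ _ _ (hprod hu _ _) (hprod hv _ _) (hprod hw _ _) (hprod hz _ _)]
    ring
  have hzero : ∀ f : κ → ℤ, ∑ t, f t = 0 → ∑ p : κ × κ, f p.1 * f p.2 = 0 := by
    intro f hf
    rw [Fintype.sum_prod_type]
    simp only [← mul_sum, hf, mul_zero, sum_const_zero]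
  have h1 := Fintype.sum_congr _ _ hterm
  rw [← mul_sum, sum_boole] at h1
  simp only [sum_add_distrib] at h1
  rw [hzero _ huv, hzero _ huw, hzero _ huz, hzero _ hvw, hzero _ hvz, hzero _ hwz, hzero _ h4,
    sum_const, card_univ, Fintype.card_prod, hκ] at h1
  simp only [nsmul_eq_mul, mul_one, add_zero] at h1
  push_cast at h1
  omega

end Pairs

/-- `τ` is an involutive automorphism with 24 two-cycles (hence 24 fixed points) of the extremal
code `C`. -/
structure TwentyFourCycles {ι : Type*} [LinearOrder ι] [Fintype ι]
    (C : Submodule (ZMod 2) (ι → ZMod 2)) (τ : Equiv.Perm ι) : Prop where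
  extremal : ExtremalSeventyTwo C
  invol : ∀ i, τ (τ i) = i
  comp_mem : ∀ v ∈ C, v ∘ τ ∈ C
  card_eq : Fintype.card (TwoCycles τ) = 24

namespace TwentyFourCycles

section Structure

open scoped Classical

variable {ι : Type*} [LinearOrder ι] [Fintype ι] {C : Submodule (ZMod 2) (ι → ZMod 2)}
  {τ : Equiv.Perm ι}

lemma card_fixedPts (h : TwentyFourCycles C τ) : Fintype.card (FixedPts τ) = 24 := by
  have h1 := card_eq_of_involution h.invol
  rw [h.extremal.card_eq, h.card_eq] at h1
  omega

lemma map_foldWord_eq (h : TwentyFourCycles C τ) : C.map (foldWord τ) = pureCode τ h.invol C := by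
  have h1 := h.extremal.dualWeightEight_map_foldWord h.invol h.comp_mem
  rw [← orth_map_foldWord h.invol h.extremal.orth_eq]
  exact (h1.of_card_eq_twentyFour h.card_eq).2.1.symm

lemma dualWeightEight_pureCode (h : TwentyFourCycles C τ) :
    DualWeightEight (pureCode τ h.invol C) := by
  rw [← h.map_foldWord_eq]
  exact h.extremal.dualWeightEight_map_foldWord h.invol h.comp_mem

/-- By duality, a word on the fixed points that is orthogonal to all restrictions of fixed words
extends to a fixed word of `C`. -/
lemma orth_fixedPart_le (h : TwentyFourCycles C τ) :
    orth (fixedPart τ h.invol C) ≤ fixedPart τ h.invol C := by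
  intro q hq
  set W := LinearMap.range ((fixedWord τ h.invol).comp (LinearMap.inr (ZMod 2) _ _)) with hW
  have h1 : fixedWord τ h.invol (q, 0) ∈ orth (orth (C ⊔ W)) := by
    intro v hv
    have hvC : v ∈ C := by
      rw [← h.extremal.orth_eq]
      exact fun c hc => hv c (Submodule.mem_sup_left hc)
    have hvW : ∀ x, foldWord τ v ⬝ᵥ x = 0 := by
      intro x
      have := hv (fixedWord τ h.invol (0, x)) (Submodule.mem_sup_right ⟨x, rfl⟩)
      rwa [dotProduct_fixedWord, dotProduct_zero, zero_add] at this
    have hfold : foldWord τ v = 0 := dotProduct_eq_zero _ hvW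
    have hvτ : v ∘ τ = v := by
      have h2 := fixedWord_foldWord h.invol v
      rw [hfold] at h2
      exact (eq_of_add_eq_zero_word (h2.symm.trans (map_zero _))).symm
    have h4 := eq_fixedWord h.invol hvτ
    rw [h4, fixedWord_dotProduct_fixedWord]
    exact hq _ (mem_fixedPart.2 ⟨_, h4 ▸ hvC⟩)
  rw [orth_orth] at h1
  obtain ⟨c, hc, _, ⟨x, rfl⟩, hcx⟩ := Submodule.mem_sup.1 h1
  refine mem_fixedPart.2 ⟨x, ?_⟩
  have h2 : fixedWord τ h.invol (q, x) = c := by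
    have h3 := add_add_cancel_word c (fixedWord τ h.invol (0, x))
    rw [← h3]
    change _ = c + (fixedWord τ h.invol).comp (LinearMap.inr (ZMod 2) _ _) x + _
    rw [hcx, ← map_add]
    simp
  rw [h2]
  exact hc

/-- Every fixed word of `C` can be modified to one that meets the two-cycles in at most four. -/
lemma exists_hammingNorm_le_four (h : TwentyFourCycles C τ) {q : FixedPts τ → ZMod 2}
    (hq : q ∈ fixedPart τ h.invol C) :
    ∃ x, fixedWord τ h.invol (q, x) ∈ C ∧ hammingNorm x ≤ 4 := by
  obtain ⟨x, hx⟩ := mem_fixedPart.1 hq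
  obtain ⟨z, hz, hle⟩ := h.dualWeightEight_pureCode.exists_add_hammingNorm_le_four h.card_eq x
  refine ⟨x + z, ?_, hle⟩
  have := C.add_mem hx (mem_pureCode.1 hz)
  rw [← map_add] at this
  simpa using this

lemma dualWeightEight_fixedPart (h : TwentyFourCycles C τ) :
    DualWeightEight (fixedPart τ h.invol C) where
  le_orth := h.extremal.fixedPart_le_orth h.invol
  eight_le q hq h0 := by
    obtain ⟨x, hx, hle⟩ := h.exists_hammingNorm_le_four (h.orth_fixedPart_le hq)
    have h1 := h.extremal.sixteen_le _ hx fun h' => h0 <|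
      congrArg Prod.fst (fixedWord_injective h.invol (h'.trans (map_zero _).symm))
    rw [hammingNorm_fixedWord] at h1
    change 16 ≤ hammingNorm q + 2 * hammingNorm x at h1
    omega
  even q hq := by
    obtain ⟨x, hx⟩ := mem_fixedPart.1 (h.orth_fixedPart_le hq)
    have h1 := h.extremal.four_dvd hx
    rw [hammingNorm_fixedWord] at h1
    change 4 ∣ hammingNorm q + 2 * hammingNorm x at h1
    omega

lemma fixedPart_weights (h : TwentyFourCycles C τ) {q : FixedPts τ → ZMod 2}
    (hq : q ∈ fixedPart τ h.invol C) : hammingNorm q = 0 ∨ hammingNorm q = 8 ∨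
      hammingNorm q = 12 ∨ hammingNorm q = 16 ∨ hammingNorm q = 24 :=
  (h.dualWeightEight_fixedPart.of_card_eq_twentyFour h.card_fixedPts).2.2 q hq

/-- The all-ones word on the fixed points is the sum of two words of `C`. -/
lemma fixedWord_one_zero_mem (h : TwentyFourCycles C τ) : fixedWord τ h.invol (1, 0) ∈ C := by
  have h1 := C.add_mem h.extremal.one_mem (mem_pureCode.1 h.dualWeightEight_pureCode.one_mem)
  have h2 : fixedWord τ h.invol (1, 1) = 1 :=
    (eq_fixedWord (v := 1) h.invol rfl).symm
  rw [← h2, ← map_add] at h1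
  convert h1 using 2
  ext i
  · simp
  · exact (CharTwo.add_self_eq_zero (1 : ZMod 2)).symm

lemma sixteen_le_of_ne_zero (h : TwentyFourCycles C τ) {q : FixedPts τ → ZMod 2}
    {x : TwoCycles τ → ZMod 2} (hqx : fixedWord τ h.invol (q, x) ∈ C) (h0 : q ≠ 0 ∨ x ≠ 0) :
    16 ≤ hammingNorm q + 2 * hammingNorm x := by
  have h1 := h.extremal.sixteen_le _ hqx fun h' => by
    have h2 := fixedWord_injective h.invol (h'.trans (map_zero _).symm)
    exact h0.elim (fun h3 => h3 (congrArg Prod.fst h2)) fun h3 => h3 (congrArg Prod.snd h2)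
  rwa [hammingNorm_fixedWord] at h1

lemma fixedWord_add_one_mem (h : TwentyFourCycles C τ) {q : FixedPts τ → ZMod 2}
    {x : TwoCycles τ → ZMod 2} (hqx : fixedWord τ h.invol (q, x) ∈ C) :
    fixedWord τ h.invol (q + 1, x) ∈ C := by
  have := C.add_mem hqx h.fixedWord_one_zero_mem
  rw [← map_add] at this
  simpa using this

lemma hammingNorm_add_one_fixed (h : TwentyFourCycles C τ) (q : FixedPts τ → ZMod 2) :
    hammingNorm (q + 1) + hammingNorm q = 24 := by
  have := hammingNorm_add_one q
  rw [h.card_fixedPts] at this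
  omega

/-- The only words of `C` supported on the fixed points are the two constant ones. -/
lemma eq_zero_or_one (h : TwentyFourCycles C τ) {q : FixedPts τ → ZMod 2}
    (hq : fixedWord τ h.invol (q, 0) ∈ C) : q = 0 ∨ q = 1 := by
  by_contra hcon
  push Not at hcon
  have h1 := h.sixteen_le_of_ne_zero hq (Or.inl hcon.1)
  have h2 := h.sixteen_le_of_ne_zero (h.fixedWord_add_one_mem hq) (Or.inl fun h' => hcon.2 <|
    eq_of_add_eq_zero_word h')
  have h3 := h.hammingNorm_add_one_fixed q
  rw [hammingNorm_zero] at h1 h2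
  omega

/-- A fixed word that meets exactly two two-cycles meets the fixed points in twelve points. -/
lemma hammingNorm_eq_twelve (h : TwentyFourCycles C τ) {q : FixedPts τ → ZMod 2}
    {x : TwoCycles τ → ZMod 2} (hqx : fixedWord τ h.invol (q, x) ∈ C) (hx : hammingNorm x = 2) :
    hammingNorm q = 12 := by
  have hx0 : x ≠ 0 := by
    rintro rfl
    rw [hammingNorm_zero] at hx
    omega
  have h1 := h.sixteen_le_of_ne_zero hqx (Or.inr hx0)
  have h2 := h.sixteen_le_of_ne_zero (h.fixedWord_add_one_mem hqx) (Or.inr hx0)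
  have h3 := h.hammingNorm_add_one_fixed q
  omega

/-- Every pair of two-cycles occurs in a fixed word of `C`: by a dimension count, the restrictions
of fixed words to the two-cycles are all the words of even weight. -/
lemma exists_fixedWord_pair_mem (h : TwentyFourCycles C τ) (s t : TwoCycles τ) :
    ∃ q, fixedWord τ h.invol (q, Pi.single s 1 + Pi.single t 1) ∈ C := by
  set D := C.comap (fixedWord τ h.invol) with hD
  set X := D.map (LinearMap.snd (ZMod 2) _ _) with hX
  set L := D.comap (LinearMap.inl (ZMod 2) (FixedPts τ → ZMod 2) (TwoCycles τ → ZMod 2)) with hL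
  have hpow : ∀ {m n : ℕ}, 2 ^ m = 2 ^ n → m = n := fun h => Nat.pow_right_injective (le_refl 2) h
  have h1 : Module.finrank (ZMod 2) (fixedPart τ h.invol C) = 12 := hpow <| by
    rw [← codeCard_eq_two_pow]
    exact (h.dualWeightEight_fixedPart.of_card_eq_twentyFour h.card_fixedPts).1
  have h2 : Module.finrank (ZMod 2) (pureCode τ h.invol C) = 12 := hpow <| by
    rw [← codeCard_eq_two_pow]
    exact (h.dualWeightEight_pureCode.of_card_eq_twentyFour h.card_eq).1
  have h3 := finrank_map_add_finrank_comap D (LinearMap.fst _ _ _) (LinearMap.inr _ _ _)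
    LinearMap.inr_injective (LinearMap.range_inr _ _ _)
  have h4 := finrank_map_add_finrank_comap D (LinearMap.snd _ _ _) (LinearMap.inl _ _ _)
    LinearMap.inl_injective (LinearMap.range_inl _ _ _)
  have hF : Nonempty (FixedPts τ) := Fintype.card_pos_iff.1 (by rw [h.card_fixedPts]; omega)
  have h01 : (0 : FixedPts τ → ZMod 2) ≠ 1 := by
    intro h'
    obtain ⟨i⟩ := hF
    simpa using congrFun h' i
  have h5 : codeCard L = 2 := by
    rw [codeCard, card_eq_two]
    refine ⟨0, 1, h01, ?_⟩
    ext q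
    simp only [mem_filter, mem_univ, true_and, mem_insert, mem_singleton]
    refine ⟨fun hq => h.eq_zero_or_one hq, ?_⟩
    rintro (rfl | rfl)
    · exact L.zero_mem
    · exact h.fixedWord_one_zero_mem
  have h6 : Module.finrank (ZMod 2) L = 1 := hpow <| by
    rw [← codeCard_eq_two_pow, h5, pow_one]
  have h7 : Module.finrank (ZMod 2) X = 23 := by
    have e1 : Module.finrank (ZMod 2) (fixedPart τ h.invol C)
      + Module.finrank (ZMod 2) (pureCode τ h.invol C) = Module.finrank (ZMod 2) D := h3
    have e2 : Module.finrank (ZMod 2) X + Module.finrank (ZMod 2) L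
      = Module.finrank (ZMod 2) D := h4
    omega
  have h8 : codeCard (orth X) = 2 := by
    have e := codeCard_mul_codeCard_orth X
    rw [codeCard_eq_two_pow X, h7, h.card_eq] at e
    omega
  have hone : (1 : TwoCycles τ → ZMod 2) ∈ orth X := by
    rintro _ ⟨⟨q, x⟩, hp, rfl⟩
    rw [dotProduct_comm, dotProduct_one_word, ZMod.natCast_eq_zero_iff]
    have e1 := h.extremal.four_dvd hp
    rw [hammingNorm_fixedWord] at e1
    change 4 ∣ hammingNorm q + 2 * hammingNorm x at e1
    have e2 := h.fixedPart_weights (mem_fixedPart.2 ⟨x, hp⟩)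
    change 2 ∣ hammingNorm x
    omega
  have hmem : Pi.single s 1 + Pi.single t 1 ∈ X := by
    rw [← orth_orth X]
    intro y hy
    have : Nonempty (TwoCycles τ) := ⟨s⟩
    rcases eq_zero_or_one_of_codeCard h8 hone hy with rfl | rfl
    · rw [dotProduct_zero]
    · rw [add_dotProduct, single_dotProduct, single_dotProduct]
      exact CharTwo.add_self_eq_zero (1 * 1 : ZMod 2)
  obtain ⟨⟨q, x⟩, hp, hx⟩ := hmem
  refine ⟨q, ?_⟩
  rw [← hx]
  exact hp

end Structure

end TwentyFourCycles

/-! ### Counting fixed words of weight 16 -/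

namespace TwentyFourCycles

section Counting

open scoped Classical

variable {ι : Type*} [LinearOrder ι] [Fintype ι] {C : Submodule (ZMod 2) (ι → ZMod 2)}
  {τ : Equiv.Perm ι}

/-- Four points of the fixed part lie in 5 words of weight 8, each of which extends to
6 words of `C` of weight 16. -/
lemma card_eight_four (h : TwentyFourCycles C τ) {S : Finset (FixedPts τ)} (hS : #S = 4) :
    #{p : (FixedPts τ → ZMod 2) × (TwoCycles τ → ZMod 2) | fixedWord τ h.invol p ∈ C ∧
      (∀ i ∈ S, p.1 i = 1) ∧ hammingNorm p.1 = 8 ∧ hammingNorm p.2 = 4} = 30 := by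
  set P := univ.filter fun p : (FixedPts τ → ZMod 2) × (TwoCycles τ → ZMod 2) =>
    fixedWord τ h.invol p ∈ C ∧ (∀ i ∈ S, p.1 i = 1) ∧ hammingNorm p.1 = 8 ∧ hammingNorm p.2 = 4
    with hP
  set O := univ.filter fun q : FixedPts τ → ZMod 2 =>
    q ∈ fixedPart τ h.invol C ∧ (∀ i ∈ S, q i = 1) ∧ hammingNorm q = 8 with hO
  have hOcard : #O = 5 := h.dualWeightEight_fixedPart.card_weight_eight_four h.card_fixedPts hS
  have hmaps : ∀ p ∈ P, p.1 ∈ O := by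
    intro p hp
    simp only [hP, mem_filter, mem_univ, true_and] at hp
    simp only [hO, mem_filter, mem_univ, true_and]
    exact ⟨mem_fixedPart.2 ⟨p.2, hp.1⟩, hp.2.1, hp.2.2.1⟩
  have hfib : ∀ q ∈ O, #(P.filter fun p => p.1 = q) = 6 := by
    intro q hq
    simp only [hO, mem_filter, mem_univ, true_and] at hq
    obtain ⟨hq, hqS, hq8⟩ := hq
    obtain ⟨x, hx, hle⟩ := h.exists_hammingNorm_le_four hq
    have hq0 : q ≠ 0 := by
      rintro rfl
      rw [hammingNorm_zero] at hq8
      omega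
    have h1 := h.sixteen_le_of_ne_zero hx (Or.inl hq0)
    have hx4 : hammingNorm x = 4 := by omega
    rw [← h.dualWeightEight_pureCode.card_weight_four_coset h.card_eq hx4]
    refine card_bij' (fun p _ => p.2) (fun y _ => (q, y)) ?_ ?_ ?_ ?_
    · rintro ⟨q', y⟩ hp
      simp only [hP, mem_filter, mem_univ, true_and] at hp ⊢
      obtain ⟨⟨hy, -, -, hy4⟩, rfl⟩ := hp
      refine ⟨?_, hy4⟩
      rw [mem_pureCode]
      have h2 := C.add_mem hy hx
      rw [← map_add, Prod.mk_add_mk] at h2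
      rwa [add_self_word q'] at h2
    · intro y hy
      simp only [mem_filter, mem_univ, true_and] at hy
      simp only [hP, mem_filter, mem_univ, true_and]
      refine ⟨⟨?_, hqS, hq8, hy.2⟩, trivial⟩
      have h2 := C.add_mem (mem_pureCode.1 hy.1) hx
      rwa [← map_add, Prod.mk_add_mk, zero_add, add_add_cancel_word] at h2
    · rintro ⟨q', y⟩ hp
      simp only [mem_filter] at hp
      rw [← hp.2]
    · intro y _
      rfl
  rw [card_eq_sum_card_fiberwise hmaps, sum_congr rfl hfib, sum_const, hOcard]
  rfl

lemma fixedWord_pair_mem (h : TwentyFourCycles C τ) {o : TwoCycles τ}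
    {q : TwoCycles τ → FixedPts τ → ZMod 2}
    (hq : ∀ t, fixedWord τ h.invol (q t, Pi.single o 1 + Pi.single t 1) ∈ C) (s t : TwoCycles τ) :
    fixedWord τ h.invol (q s + q t, Pi.single s 1 + Pi.single t 1) ∈ C := by
  have h2 := C.add_mem (hq s) (hq t)
  rw [← map_add, Prod.mk_add_mk] at h2
  convert h2 using 3
  funext j
  simp only [Pi.add_apply]
  linear_combination -CharTwo.add_self_eq_zero ((Pi.single o 1 : TwoCycles τ → ZMod 2) j)

/-- The matrix with entries `sgn (q t i)`, where `q t` completes a pair of two-cycles to a fixed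
word, is a Hadamard matrix. -/
lemma sum_sgn_mul_sgn (h : TwentyFourCycles C τ) {o : TwoCycles τ}
    {q : TwoCycles τ → FixedPts τ → ZMod 2}
    (hq : ∀ t, fixedWord τ h.invol (q t, Pi.single o 1 + Pi.single t 1) ∈ C) (s t : TwoCycles τ) :
    ∑ i, sgn (q s i) * sgn (q t i) = if s = t then 24 else 0 := by
  split_ifs with hst
  · subst hst
    simp only [sgn_mul_self, sum_const, card_univ, h.card_fixedPts]
    rfl
  · have h2 := h.hammingNorm_eq_twelve (h.fixedWord_pair_mem hq s t)
      (hammingNorm_single_add_single hst)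
    have h3 := sum_sgn (q s + q t)
    rw [h2, h.card_fixedPts] at h3
    simp only [Pi.add_apply, sgn_add] at h3
    rw [h3]
    norm_num

/-- The completions of a pair of two-cycles to a fixed word of `C` are two complementary words. -/
lemma fixedWord_pair_mem_iff (h : TwentyFourCycles C τ) {o : TwoCycles τ}
    {q : TwoCycles τ → FixedPts τ → ZMod 2}
    (hq : ∀ t, fixedWord τ h.invol (q t, Pi.single o 1 + Pi.single t 1) ∈ C) (s t : TwoCycles τ)
    (q' : FixedPts τ → ZMod 2) :
    fixedWord τ h.invol (q', Pi.single s 1 + Pi.single t 1) ∈ C ↔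
      q' = q s + q t ∨ q' = q s + q t + 1 := by
  have h1 := h.fixedWord_pair_mem hq s t
  constructor
  · intro h2
    have h3 := C.add_mem h2 h1
    rw [← map_add, Prod.mk_add_mk, add_self_word (Pi.single s 1 + Pi.single t 1)] at h3
    have h4 := add_add_cancel_word q' (q s + q t)
    rcases h.eq_zero_or_one h3 with h5 | h5
    · rw [h5, zero_add] at h4
      exact Or.inl h4.symm
    · rw [h5, add_comm] at h4
      exact Or.inr h4.symm
  · rintro (rfl | rfl)
    · exact h1
    · exact h.fixedWord_add_one_mem h1

/-- Twice the number of fixed words of weight 16 that contain `S` and meet exactly two of the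
two-cycles is the number of ordered pairs of distinct two-cycles whose associated words differ by
a constant on `S`. -/
lemma two_mul_card_twelve_two (h : TwentyFourCycles C τ) {o : TwoCycles τ}
    {q : TwoCycles τ → FixedPts τ → ZMod 2}
    (hq : ∀ t, fixedWord τ h.invol (q t, Pi.single o 1 + Pi.single t 1) ∈ C)
    {S : Finset (FixedPts τ)} (hS : S.Nonempty) :
    #{p : (FixedPts τ → ZMod 2) × (TwoCycles τ → ZMod 2) | fixedWord τ h.invol p ∈ C ∧
      (∀ i ∈ S, p.1 i = 1) ∧ hammingNorm p.1 = 12 ∧ hammingNorm p.2 = 2} * 2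
      = #{r : TwoCycles τ × TwoCycles τ | r.1 ≠ r.2 ∧ ∃ e, ∀ i ∈ S, q r.1 i + q r.2 i = e} * 1 := by
  obtain ⟨i0, hi0⟩ := hS
  refine card_mul_eq_card_mul (fun p r => p.2 = Pi.single r.1 1 + Pi.single r.2 1) ?_ ?_
  · rintro ⟨q', x⟩ hp
    simp only [mem_filter, mem_univ, true_and] at hp
    obtain ⟨hC, hone, h12, hx2⟩ := hp
    obtain ⟨s, t, hst, rfl⟩ := exists_eq_single_add_single hx2
    have hconst : ∃ e, ∀ i ∈ S, q s i + q t i = e := by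
      rcases (h.fixedWord_pair_mem_iff hq s t q').1 hC with rfl | rfl
      · exact ⟨1, hone⟩
      · refine ⟨0, fun i hi => ?_⟩
        have := hone i hi
        simp only [Pi.add_apply, Pi.one_apply] at this
        linear_combination this
    refine Eq.trans (congrArg card ?_)
      (card_pair (show (s, t) ≠ (t, s) from fun h' => hst (congrArg Prod.fst h')))
    ext ⟨a, b⟩
    simp only [mem_bipartiteAbove, mem_filter, mem_univ, true_and, mem_insert, mem_singleton,
      Prod.mk.injEq]
    rw [single_add_single_eq_iff hst]
    constructor
    · rintro ⟨-, ⟨rfl, rfl⟩ | ⟨rfl, rfl⟩⟩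
      · exact Or.inl ⟨rfl, rfl⟩
      · exact Or.inr ⟨rfl, rfl⟩
    · rintro (⟨rfl, rfl⟩ | ⟨rfl, rfl⟩)
      · exact ⟨⟨hst, hconst⟩, Or.inl ⟨rfl, rfl⟩⟩
      · refine ⟨⟨hst.symm, ?_⟩, Or.inr ⟨rfl, rfl⟩⟩
        simpa only [add_comm] using hconst
  · rintro ⟨s, t⟩ hr
    simp only [mem_filter, mem_univ, true_and] at hr
    obtain ⟨hst, e, he⟩ := hr
    rw [card_eq_one]
    refine ⟨(q s + q t + fun _ => e + 1, Pi.single s 1 + Pi.single t 1), ?_⟩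
    ext ⟨q', x⟩
    simp only [mem_bipartiteBelow, mem_filter, mem_univ, true_and, mem_singleton,
      Prod.mk.injEq]
    constructor
    · rintro ⟨⟨hC, hone, -, -⟩, rfl⟩
      refine ⟨?_, rfl⟩
      have h1 := he i0 hi0
      have h2 := hone i0 hi0
      rcases (h.fixedWord_pair_mem_iff hq s t q').1 hC with rfl | rfl
      · have h3 : e = 1 := h1.symm.trans h2
        funext i
        simp only [Pi.add_apply, h3]
        exact (add_zero _).symm
      · have h3 : e = 0 := by
          simp only [Pi.add_apply, Pi.one_apply, h1] at h2
          linear_combination h2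
        funext i
        simp only [Pi.add_apply, h3, Pi.one_apply, zero_add]
    · rintro ⟨rfl, rfl⟩
      have hx2 := hammingNorm_single_add_single hst
      have hmem : fixedWord τ h.invol (q s + q t + fun _ => e + 1,
          Pi.single s 1 + Pi.single t 1) ∈ C := by
        rw [h.fixedWord_pair_mem_iff hq]
        rcases zmod_two_cases e with rfl | rfl
        · right
          funext i
          simp
        · left
          funext i
          rw [Pi.add_apply, show (1 : ZMod 2) + 1 = 0 from rfl, add_zero]
      refine ⟨⟨hmem, fun i hi => ?_, h.hammingNorm_eq_twelve hmem hx2, hx2⟩, rfl⟩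
      simp only [Pi.add_apply, he i hi]
      rw [← add_assoc, CharTwo.add_self_eq_zero, zero_add]

/-- The fixed words of weight 16 containing `S`, split by the weight of their fixed part. -/
lemma card_fixed_sixteen (h : TwentyFourCycles C τ) {S : Finset (FixedPts τ)}
    (hS : S.Nonempty) :
    #{p : (FixedPts τ → ZMod 2) × (TwoCycles τ → ZMod 2) | fixedWord τ h.invol p ∈ C ∧
      (∀ i ∈ S, p.1 i = 1) ∧ hammingNorm p.1 + 2 * hammingNorm p.2 = 16}
      = #{p : (FixedPts τ → ZMod 2) × (TwoCycles τ → ZMod 2) | fixedWord τ h.invol p ∈ C ∧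
      (∀ i ∈ S, p.1 i = 1) ∧ hammingNorm p.1 = 8 ∧ hammingNorm p.2 = 4}
      + #{p : (FixedPts τ → ZMod 2) × (TwoCycles τ → ZMod 2) | fixedWord τ h.invol p ∈ C ∧
      (∀ i ∈ S, p.1 i = 1) ∧ hammingNorm p.1 = 12 ∧ hammingNorm p.2 = 2} := by
  rw [← card_union_of_disjoint]
  · congr 1
    ext ⟨q, x⟩
    simp only [mem_filter, mem_univ, true_and, mem_union]
    constructor
    · rintro ⟨hC, hone, hwt⟩
      rcases h.fixedPart_weights (mem_fixedPart.2 ⟨x, hC⟩) with h1 | h1 | h1 | h1 | h1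
      · rw [hammingNorm_eq_zero] at h1
        obtain ⟨i, hi⟩ := hS
        have := hone i hi
        rw [h1] at this
        exact absurd this (by simp)
      · exact Or.inl ⟨hC, hone, h1, by omega⟩
      · exact Or.inr ⟨hC, hone, h1, by omega⟩
      · have h2 : x = 0 := hammingNorm_eq_zero.1 (by omega)
        subst h2
        rcases h.eq_zero_or_one hC with rfl | rfl
        · rw [hammingNorm_zero] at h1
          omega
        · rw [hammingNorm_one_word, h.card_fixedPts] at h1
          omega
      · omega
    · rintro (⟨hC, hone, h1, h2⟩ | ⟨hC, hone, h1, h2⟩)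
      · exact ⟨hC, hone, by omega⟩
      · exact ⟨hC, hone, by omega⟩
  · rw [disjoint_filter]
    rintro p - ⟨-, -, h1, -⟩ ⟨-, -, h2, -⟩
    omega

end Counting

end TwentyFourCycles

/-! ### Automorphisms of order 8 -/

namespace TwentyFourCycles

open scoped Classical in
/-- The Hadamard matrix of completions is preserved up to signs by `σ`, so there is an orbit `S` of
four fixed points of `τ` whose rows have a product summing to zero. Of the 442 words of weight 16
containing `S` exactly 54 are fixed by `τ`, and these numbers are not congruent modulo 8. -/
lemma false_of_pow_four_eq {ι : Type*} [LinearOrder ι] [Fintype ι]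
    {C : Submodule (ZMod 2) (ι → ZMod 2)} {τ σ : Equiv.Perm ι} (h : TwentyFourCycles C τ)
    (hσC : ∀ v ∈ C, v ∘ σ ∈ C) (hστ : σ ^ 4 = τ) : False := by
  have hσ : ∀ i, σ (τ i) = τ (σ i) := fun i => by
    rw [← hστ, ← Equiv.Perm.mul_apply, ← Equiv.Perm.mul_apply, ← pow_succ, ← pow_succ']
  set a := fixedPerm σ hσ with ha
  set b := cyclePerm h.invol σ hσ with hb
  have ha4 : a ^ 4 = 1 := fixedPerm_pow_four hσ hστ
  have hb4 : b ^ 4 = 1 := cyclePerm_pow_four h.invol hσ hστ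
  obtain ⟨o⟩ : Nonempty (TwoCycles τ) := Fintype.card_pos_iff.1 (by rw [h.card_eq]; omega)
  choose q hq using h.exists_fixedWord_pair_mem o
  have hcocycle : ∀ t, ∃ e, ∀ i, q (b o) (a i) + q (b t) (a i) = q o i + q t i + e := by
    intro t
    have h1 := hσC _ ((h.fixedWord_pair_mem_iff hq (b o) (b t) _).2 (Or.inl rfl))
    rw [fixedWord_comp_perm h.invol hσ] at h1
    have h2 : (Pi.single (b o) 1 + Pi.single (b t) 1 : TwoCycles τ → ZMod 2) ∘ b
        = Pi.single o 1 + Pi.single t 1 := by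
      funext j
      simp [Pi.single_apply]
    rw [← hb, h2, h.fixedWord_pair_mem_iff hq] at h1
    rcases h1 with h1 | h1
    · exact ⟨0, fun i => (congrFun h1 i).trans (add_zero _).symm⟩
    · exact ⟨1, fun i => congrFun h1 i⟩
  choose e he using hcocycle
  have hsq : ∀ x : ZMod 2, sgn x * sgn x = 1 := sgn_mul_self
  have hcol := h.sum_sgn_mul_sgn hq
  have hHad : ∀ i t, sgn (q (b t) (a i))
      = (sgn (q (b o) (a i)) * sgn (q o i)) * sgn (e t) * sgn (q t i) := by
    intro i t
    have h1 := congrArg sgn (he t i)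
    simp only [sgn_add] at h1
    calc sgn (q (b t) (a i))
        = sgn (q (b o) (a i)) * (sgn (q (b o) (a i)) * sgn (q (b t) (a i))) := by
          rw [← mul_assoc, hsq, one_mul]
      _ = _ := by rw [h1]; ring
  obtain ⟨i, hi, hsum⟩ := exists_row_orbit_sum_eq_zero (H := fun i t => sgn (q t i))
    h.card_fixedPts h.card_eq (fun i t => hsq _) hcol a b ha4 hb4
    (cyclePerm_sq_ne h.invol hσ hστ) _ _
    (fun i => by rw [mul_mul_mul_comm, hsq, hsq, one_mul]) (fun t => hsq (e t)) hHad
  have ha4' : ∀ j, a (a (a (a j))) = j := fun j => Equiv.Perm.congr_fun ha4 j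
  simp only [pow_succ, pow_zero, one_mul, Equiv.Perm.mul_apply] at hi hsum
  have n01 : i ≠ a i := fun h' => hi (by rw [← h', ← h'])
  have n02 : i ≠ a (a i) := fun h' => hi h'.symm
  have n03 : i ≠ a (a (a i)) := fun h' => n01 (by
    conv_lhs => rw [← ha4' i, ← h'])
  have n12 : a i ≠ a (a i) := fun h' => n01 (a.injective h')
  have n13 : a i ≠ a (a (a i)) := fun h' => n02 (a.injective h')
  have n23 : a (a i) ≠ a (a (a i)) := fun h' => n12 (a.injective h')
  set S : Finset (FixedPts τ) := {i, a i, a (a i), a (a (a i))} with hS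
  have hScard : #S = 4 := card_eq_four.2 ⟨_, _, _, _, n01, n02, n03, n12, n13, n23, rfl⟩
  have hSne : S.Nonempty := ⟨i, by simp [hS]⟩
  have hSall : ∀ P : FixedPts τ → Prop,
      (∀ j ∈ S, P j) ↔ P i ∧ P (a i) ∧ P (a (a i)) ∧ P (a (a (a i))) := by
    intro P
    simp [hS]
  -- 72 ordered pairs of two-cycles, including 24 on the diagonal, differ by a constant on `S`
  have hpairs : #{r : TwoCycles τ × TwoCycles τ | r.1 ≠ r.2 ∧
      ∃ e, ∀ j ∈ S, q r.1 j + q r.2 j = e} = 48 := by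
    have hrow : ∀ j k, j ≠ k → ∑ t, sgn (q t j) * sgn (q t k) = 0 := fun j k hjk => by
      have := rows_orthogonal (H := fun i t => sgn (q t i)) h.card_fixedPts h.card_eq hcol j k
      rwa [if_neg hjk] at this
    have h72 := card_pairs_eq_seventyTwo h.card_eq (fun t => sgn_eq_or (q t i))
      (fun t => sgn_eq_or (q t (a i))) (fun t => sgn_eq_or (q t (a (a i))))
      (fun t => sgn_eq_or (q t (a (a (a i))))) (hrow _ _ n01) (hrow _ _ n02) (hrow _ _ n03)
      (hrow _ _ n12) (hrow _ _ n13) (hrow _ _ n23) hsum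
    have hinj : Function.Injective sgn := fun x y => by revert x y; decide
    simp only [← sgn_add, hinj.eq_iff] at h72
    have hiff : ∀ r : TwoCycles τ × TwoCycles τ,
        (q r.1 i + q r.2 i = q r.1 (a i) + q r.2 (a i) ∧
          q r.1 i + q r.2 i = q r.1 (a (a i)) + q r.2 (a (a i)) ∧
          q r.1 i + q r.2 i = q r.1 (a (a (a i))) + q r.2 (a (a (a i)))) ↔
        ∃ e, ∀ j ∈ S, q r.1 j + q r.2 j = e := by
      intro r
      constructor
      · rintro ⟨h1, h2, h3⟩
        exact ⟨_, (hSall _).2 ⟨rfl, h1.symm, h2.symm, h3.symm⟩⟩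
      · rintro ⟨e, he⟩
        obtain ⟨h0, h1, h2, h3⟩ := (hSall _).1 he
        exact ⟨h0.trans h1.symm, h0.trans h2.symm, h0.trans h3.symm⟩
    simp only [hiff] at h72
    have hdiag : #{r : TwoCycles τ × TwoCycles τ | r.1 = r.2 ∧
        ∃ e, ∀ j ∈ S, q r.1 j + q r.2 j = e} = 24 := by
      rw [← h.card_eq, ← card_univ]
      refine card_bij' (fun r _ => r.1) (fun t _ => (t, t)) ?_ ?_ ?_ ?_
      · simp
      · intro t _
        simp only [mem_filter, mem_univ, true_and]
        exact ⟨0, fun j _ => CharTwo.add_self_eq_zero _⟩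
      · rintro ⟨s, t⟩ hr
        simp only [mem_filter, mem_univ, true_and] at hr
        rw [Prod.mk.injEq]
        exact ⟨rfl, hr.1⟩
      · simp
    have hsplit := card_filter_add_card_filter_not (s := univ.filter
      fun r : TwoCycles τ × TwoCycles τ => ∃ e, ∀ j ∈ S, q r.1 j + q r.2 j = e)
      (fun r => r.1 = r.2)
    rw [filter_filter, filter_filter] at hsplit
    simp only [and_comm (b := _ = _), and_comm (b := ¬ _)] at hsplit
    simp only [ne_eq]
    omega
  have h24 := h.two_mul_card_twelve_two hq hSne
  rw [hpairs] at h24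
  have h54 := h.card_fixed_sixteen hSne
  rw [h.card_eight_four hScard] at h54
  -- the words of weight 16 containing `S`
  set T : Finset ι := S.map (Function.Embedding.subtype _) with hT
  have hTcard : #T = 4 := by rw [hT, card_map, hScard]
  have hTall : ∀ P : ι → Prop, (∀ j ∈ T, P j) ↔ ∀ j ∈ S, P j := by
    intro P
    simp only [hT, forall_mem_map, Function.Embedding.subtype_apply]
  set X : Finset (ι → ZMod 2) :=
    univ.filter fun v => v ∈ C ∧ (∀ j ∈ T, v j = 1) ∧ hammingNorm v = 16 with hX
  have hXcard : #X = 442 := h.extremal.card_weight_sixteen_one_on T hTcard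
  have hσ8 : σ ^ 8 = 1 := by
    ext j
    rw [show 8 = 4 + 4 from rfl, pow_add, hστ, Equiv.Perm.mul_apply, h.invol,
      Equiv.Perm.one_apply]
  have hmod := card_modEq_card_fixed X (permWord σ) 2 (fun v => by
    have hcyc : (∀ j ∈ S, v (σ j) = 1) ↔ ∀ j ∈ S, v j = 1 := by
      rw [hSall, hSall]
      have e : ∀ j : FixedPts τ, σ (j : ι) = (a j : FixedPts τ) := fun j => rfl
      simp only [e, ha4']
      tauto
    simp only [hX, mem_filter, mem_univ, true_and, permWord_apply, hammingNorm_comp_perm,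
      comp_mem_iff hσC, hTall, Function.comp_apply, hcyc]) (by
    rw [permWord_pow]
    exact congrArg permWord hσ8)
  have hfix : X.filter (fun v => (permWord σ ^ 2 ^ 2) v = v)
      = (univ.filter fun p : (FixedPts τ → ZMod 2) × (TwoCycles τ → ZMod 2) =>
        fixedWord τ h.invol p ∈ C ∧ (∀ j ∈ S, p.1 j = 1) ∧
          hammingNorm p.1 + 2 * hammingNorm p.2 = 16).image (fixedWord τ h.invol) := by
    ext v
    rw [permWord_pow, show 2 ^ 2 = 4 from rfl, hστ]
    simp only [hX, mem_filter, mem_univ, true_and, mem_image, permWord_apply, hTall]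
    constructor
    · rintro ⟨⟨hv, hvS, hv16⟩, hvτ⟩
      have h1 := eq_fixedWord h.invol hvτ
      refine ⟨_, ⟨h1 ▸ hv, hvS, ?_⟩, h1.symm⟩
      rw [← hammingNorm_fixedWord h.invol, ← h1, hv16]
    · rintro ⟨p, ⟨hp, hpS, hp16⟩, rfl⟩
      refine ⟨⟨hp, ?_, by rw [hammingNorm_fixedWord, hp16]⟩, fixedWord_comp h.invol p⟩
      simpa only [fixedWord_fixed] using hpS
  rw [hXcard, hfix, card_image_of_injective _ (fixedWord_injective h.invol)] at hmod
  have hm : 442 % 8 = _ % 8 := hmod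
  omega

end TwentyFourCycles

/-- If `σ` has order 8, then `σ^4` is an involution whose number of two-cycles is a positive
multiple of 4; each such number is excluded. -/
theorem mainTheorem2 (C : BinaryCode 72) (hC : C.IsExtremal) :
    ¬ ∃ σ : C.aut, orderOf σ = 8 := by
  rintro ⟨g, hg⟩
  have hsd : orth C = C := hC.isSelfDual.symm
  have hmin : ∀ v ∈ C, v ≠ 0 → 16 ≤ hammingNorm v := by
    intro v hv h0
    have h1 : C.minDist = 16 := hC.minDist_eq
    rw [← h1]
    exact Nat.sInf_le ⟨v, hv, h0, rfl⟩
  have hX : ExtremalSeventyTwo C := ⟨Fintype.card_fin 72, hsd, hmin⟩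
  set σ : Equiv.Perm (Fin 72) := (g : Equiv.Perm (Fin 72))⁻¹ with hσdef
  have hord : orderOf σ = 8 := by
    rw [hσdef, orderOf_inv, Subgroup.orderOf_coe, hg]
  have hσ : ∀ v ∈ C, v ∘ σ ∈ C := by
    intro v hv
    have h1 : (BinaryCode.permute (g : Equiv.Perm (Fin 72))) '' (C : Set (Fin 72 → ZMod 2)) = C :=
      g.2
    have h2 : BinaryCode.permute (g : Equiv.Perm (Fin 72)) v ∈ (C : Set (Fin 72 → ZMod 2)) := by
      rw [← h1]
      exact Set.mem_image_of_mem _ hv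
    exact h2
  have h8 : σ ^ 8 = 1 := hord ▸ pow_orderOf_eq_one σ
  set τ := σ ^ 4 with hτdef
  have hτ : ∀ i, τ (τ i) = i := fun i => by
    rw [← Equiv.Perm.mul_apply, hτdef, ← pow_add, h8, Equiv.Perm.one_apply]
  have hinv : ∀ v ∈ C, v ∘ τ ∈ C := comp_pow_mem hσ 4
  have hpos : 0 < Fintype.card (TwoCycles τ) := by
    rw [Fintype.card_pos_iff]
    by_contra hcon
    rw [not_nonempty_iff] at hcon
    have h1 : σ ^ 4 = 1 := by
      ext i
      congr 1
      exact (forall_iff_of_involution hτ (P := fun i => τ i = i)).2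
        ⟨fun i => i.2, fun t => (hcon.false t).elim⟩ i
    have h2 := orderOf_dvd_of_pow_eq_one h1
    rw [hord] at h2
    exact absurd h2 (by norm_num)
  have hdvd : 4 ∣ Fintype.card (TwoCycles τ) := by
    have h1 := card_modEq_card_fixed univ σ 2 (fun _ => by simp) h8
    have h2 := card_eq_of_involution hτ
    have h3 : #(univ.filter fun i => (σ ^ 2 ^ 2) i = i) = Fintype.card (FixedPts τ) :=
      (Fintype.card_subtype _).symm
    rw [h3, card_univ, h2] at h1
    have h4 := (Nat.modEq_iff_dvd' (by omega)).1 h1.symm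
    omega
  rcases hX.card_twoCycles hτ hinv hdvd hpos with h | h | h
  · exact TwentyFourCycles.false_of_pow_four_eq ⟨hX, hτ, hinv, h⟩ hσ rfl
  · exact hX.card_twoCycles_ne_thirtyTwo hτ hinv h
  · exact hX.card_twoCycles_ne_thirtySix hσ hτ rfl h
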